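/- **Multiset rewriting.** Judgments are closed atomic formulas over a countably infinite set of constants; some are declared persistent. A rule $r:\forall\vec x.F(\vec x)\to\exists\vec n.G(\vec x,\vec n)$ has finite multisets $F,G$, where $G$ includes the persistent formulas of $F$ (these are not repeated on the right below). The instantiation $r(\theta)$ is applicable to $M$ if $M=F(\theta),M'$ for some $M'$, and then $M\xrightarrow{(r;(\theta,\xi))}G(\theta,\xi),M'$. A trace from $M_0$ is a finite or infinite sequence of steps $M_0\xrightarrow{(r_1;(\theta_1,\xi_1))}M_1\xrightarrow{(r_2;(\theta_2,\xi_2))}\cdots$ in which every $\xi_j$ is one-to-one and its constants do not occur in $M_i$ for any $i<j$. An execution is a maximally long trace. Two instantiations are equivalent if their left-hand sides are equal and their right-hand sides $\exists\vec n.G$ are equal up to renaming of $\vec n$. An execution is fair if, for every $i\ge 0$ and every $r(\theta)$ applicable to $M_i$, there is $j>i$ such that $r_j(\theta_j)$ is equivalent to $r(\theta)$. **Types and processes.** Session types are $A::=\alpha\mid\mathbf 1\mid B\otimes A\mid\oplus\{l:A_l\}_{l\in L}\mid\&\{l:A_l\}_{l\in L}\mid\rho\alpha.A$ with $L$ a finite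 set of labels. All types below are closed; all but the $\&$-types are positive. Processes, up to renaming of bound channels and variables, are $$P::=\mathsf{fwd}\,a\,b\mid a{:}A\leftarrow P;Q\mid \mathsf{close}\,a\mid\mathsf{wait}\,a;P\mid\mathsf{send}\,a\,b;P\mid b\leftarrow\mathsf{recv}\,a;P\mid a.k;P\mid\mathsf{case}\,a\,\{l\Rightarrow P_l\}_{l\in L}\mid\mathsf{send}\,a\,\mathsf{unfold};P\mid\mathsf{unfold}\leftarrow\mathsf{recv}\,a;P\mid p\mid\mathsf{fix}\,p.P .$$ The judgment $\Pi;\Delta\vdash P::c:C$, with $\Pi$ a structural context of process variables $p:\{c:C\leftarrow\Delta\}$, $\Delta$ a linear context of channels, and bound channels always named freshly, is given by these rules: - $\Pi;a:A\vdash\mathsf{fwd}\,a\,b::b:A$ for $A$ positive; - $\Pi;\Delta_1,\Delta_2\vdash(a{:}A\leftarrow P;Q)::c:C$ if $\Pi;\Delta_1\vdash P::a:A$ and $\Pi;a:A,\Delta_2\vdash Q::c:C$; - $\Pi;\cdot\vdash\mathsf{close}\,a::a:\mathbf 1$; and $\Pi;\Delta,a:\mathbf 1\vdash\mathsf{wait}\,a;P::c:C$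 if $\Pi;\Delta\vdash P::c:C$; - $\Pi;\Delta,b:B\vdash\mathsf{send}\,a\,b;P::a:B\otimes A$ if $\Pi;\Delta\vdash P::a:A$; and $\Pi;\Delta,a:B\otimes A\vdash b\leftarrow\mathsf{recv}\,a;P::c:C$ if $\Pi;\Delta,a:A,b:B\vdash P::c:C$; - $\Pi;\Delta\vdash a.k;P::a:\oplus\{l:A_l\}_{l\in L}$ if $k\in L$ and $\Pi;\Delta\vdash P::a:A_k$; and $\Pi;\Delta,a:\oplus\{l:A_l\}_{l\in L}\vdash\mathsf{case}\,a\,\{l\Rightarrow P_l\}_{l\in L}::c:C$ if $\Pi;\Delta,a:A_l\vdash P_l::c:C$ for all $l\in L$; - $\Pi;\Delta\vdash\mathsf{case}\,a\,\{l\Rightarrow P_l\}_{l\in L}::a:\&\{l:A_l\}_{l\in L}$ if $\Pi;\Delta\vdash P_l::a:A_l$ for all $l\in L$; and $\Pi;\Delta,a:\&\{l:A_l\}_{l\in L}\vdash a.k;P::c:C$ if $k\in L$ and $\Pi;\Delta,a:A_k\vdash P::c:C$; - $\Pi;\Delta\vdash\mathsf{send}\,a\,\mathsf{unfold};P::a:\rho\alpha.A$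 if $\Pi;\Delta\vdash P::a:[\rho\alpha.A/\alpha]A$; and $\Pi;\Delta,a:\rho\alpha.A\vdash\mathsf{unfold}\leftarrow\mathsf{recv}\,a;P::c:C$ if $\Pi;\Delta,a:[\rho\alpha.A/\alpha]A\vdash P::c:C$; - $\Pi,p:\{c:C\leftarrow\Delta\};\Delta\vdash p::c:C$; and $\Pi;\Delta\vdash\mathsf{fix}\,p.P::c:C$ if $\Pi,p:\{c:C\leftarrow\Delta\};\Delta\vdash P::c:C$. **Dynamics.** The constants are channel names. Judgments are $\mathsf{proc}(c,P)$, $\mathsf{msg}(c,m)$ and the persistent $\mathbf{type}(c,A)$, where a message $m$ is $\ast$, $(e;d)$ (channel $e$), $(l;d)$ (label $l$) or $(\mathsf{unfold};d)$, with $d$ the continuation channel. The rules are - $\mathsf{msg}(a,m),\mathsf{proc}(b,\mathsf{fwd}\,a\,b)\to\mathsf{msg}(b,m)$; - $\mathsf{proc}(c,a{:}A\leftarrow P;Q)\to\exists b.\ \mathsf{proc}(b,[b/a]P),\mathsf{proc}(c,[b/a]Q),\mathbf{type}(b,A)$; - $\mathsf{proc}(a,\mathsf{close}\,a)\to\mathsf{msg}(a,\ast)$;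 and $\mathsf{msg}(a,\ast),\mathsf{proc}(c,\mathsf{wait}\,a;P)\to\mathsf{proc}(c,P)$; - $\mathsf{proc}(a,\mathsf{send}\,a\,b;P),\mathbf{type}(a,B\otimes A)\to\exists d.\ \mathsf{proc}(d,[d/a]P),\mathsf{msg}(a,(b;d)),\mathbf{type}(d,A)$; and $\mathsf{msg}(a,(e;d)),\mathsf{proc}(c,b\leftarrow\mathsf{recv}\,a;P)\to\mathsf{proc}(c,[e,d/b,a]P)$; - $\mathsf{proc}(a,a.k;P),\mathbf{type}(a,\oplus\{l:A_l\}_{l\in L})\to\exists d.\ \mathsf{msg}(a,(k;d)),\mathsf{proc}(d,[d/a]P),\mathbf{type}(d,A_k)$; and, for $c\ne a$, $\mathsf{msg}(a,(k;d)),\mathsf{proc}(c,\mathsf{case}\,a\,\{l\Rightarrow P_l\}_{l\in L})\to\mathsf{proc}(c,[d/a]P_k)$; - $\mathsf{msg}(a,(k;d)),\mathsf{proc}(a,\mathsf{case}\,a\,\{l\Rightarrow P_l\}_{l\in L})\to\mathsf{proc}(d,[d/a]P_k)$; and $\mathsf{proc}(c,a.k;P),\mathbf{type}(a,\&\{l:A_l\}_{l\in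 L})\to\exists d.\ \mathsf{msg}(a,(k;d)),\mathsf{proc}(c,[d/a]P),\mathbf{type}(d,A_k)$; - $\mathsf{proc}(a,\mathsf{send}\,a\,\mathsf{unfold};P),\mathbf{type}(a,\rho\alpha.A)\to\exists d.\ \mathsf{msg}(a,(\mathsf{unfold};d)),\mathsf{proc}(d,[d/a]P),\mathbf{type}(d,[\rho\alpha.A/\alpha]A)$; and $\mathsf{msg}(a,(\mathsf{unfold};d)),\mathsf{proc}(c,\mathsf{unfold}\leftarrow\mathsf{recv}\,a;P)\to\mathsf{proc}(c,[d/a]P)$; - $\mathsf{proc}(c,\mathsf{fix}\,p.P)\to\mathsf{proc}(c,[\mathsf{fix}\,p.P/p]P)$. For distinct channels $c_0,\dots,c_n$, a fair execution of the closed process $\cdot;c_1:A_1,\dots,c_n:A_n\vdash P::c_0:A_0$ is a fair execution from $\mathsf{proc}(c_0,P),\mathbf{type}(c_0,A_0),\dots,\mathbf{type}(c_n,A_n)$. **Observations.** Communications are the finite or infinite trees generated by $v::=\bot_A\mid\ast\mid(k,v)\mid(v,v')\mid(\mathsf{unfold},v)$. For a trace $T$ let $\mathcal T$ be the set of judgments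 that occur in some multiset of $T$. The judgment $T\rightsquigarrow v/c:A$ ("$v$ of type $A$ is observed on $c$ in $T$") is the largest relation such that each of its elements is the conclusion of one of these rules with premises in the relation: - $T\rightsquigarrow\bot_A/c:A$ if $\mathbf{type}(c,A)\in\mathcal T$ and $\mathsf{msg}(c,m)\notin\mathcal T$ for all $m$; - $T\rightsquigarrow\ast/c:\mathbf 1$ if $\mathsf{msg}(c,\ast)\in\mathcal T$; - $T\rightsquigarrow(l,v)/c:A$, for $A$ either $\oplus\{l:A_l\}_{l\in L}$ or $\&\{l:A_l\}_{l\in L}$, if $\mathsf{msg}(c,(l;d))\in\mathcal T$, $T\rightsquigarrow v/d:A_l$ and $\mathbf{type}(c,A)\in\mathcal T$; - $T\rightsquigarrow(u,v)/c:A\otimes B$ if $\mathsf{msg}(c,(a;d))\in\mathcal T$, $T\rightsquigarrow u/a:A$ and $T\rightsquigarrow v/d:B$; - $T\rightsquigarrow(\mathsf{unfold},v)/c:\rho\alpha.A$ if $\mathsf{msg}(c,(\mathsf{unfold};d))\in\mathcal T$ and $T\rightsquigarrow v/d:[\rho\alpha.A/\alpha]A$. **Theorem.** Let $T$ and $T'$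 be fair executions of a closed, well-typed process $\cdot;c_1:A_1,\dots,c_n:A_n\vdash P::c_0:A_0$. For all $0\le i\le n$, if $T\rightsquigarrow v_i/c_i:A_i$ and $T'\rightsquigarrow w_i/c_i:A_i$, then $v_i=w_i$. -/

import Mathlib

/-! ### Multiset rewriting systems, traces, fairness -/

open Classical in
/-- A multiset rewriting system over judgments `J` (closed formulas) and constants `K`.
A rule `r : ∀ x. F(x) → ∃ n. G(x, n)` is given by its matching substitutions `θ : Sub r`, the
multisets `F(θ) = lhs r θ`, the number `arity r` of existentially quantified variables `n`, and
the multisets `G(θ, ξ) = rhs r θ ξ` for the fresh-constant substitutions `ξ`.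
The persistent formulas of `F` must be included in `G`. -/
structure MRS (J K : Type) where
  Rule : Type
  Sub : Rule → Type
  arity : Rule → ℕ
  lhs : (r : Rule) → Sub r → Multiset J
  rhs : (r : Rule) → Sub r → (Fin (arity r) → K) → Multiset J
  /-- The constants that occur in a judgment. -/
  consts : J → Finset K
  IsPersistent : J → Prop
  persistent_le : ∀ r θ ξ, (lhs r θ).filter IsPersistent ≤ rhs r θ ξ

namespace MRS

variable {J K : Type}

/-- A rule instantiation `r(θ)`. -/
structure Instantiation (R : MRS J K) where
  rule : R.Rule
  sub : R.Sub rule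

/-- The label `(r; (θ, ξ))` of a rewriting step. -/
structure Action (R : MRS J K) extends Instantiation R where
  fresh : Fin (R.arity rule) → K

/-- `r(θ)` is applicable to `M` if `M = F(θ), M'` for some `M'`. -/
def Applicable (R : MRS J K) (x : R.Instantiation) (M : Multiset J) : Prop :=
  ∃ M', M = R.lhs x.rule x.sub + M'

/-- The rewriting relation `F(θ), M' --(r;(θ,ξ))--> G(θ,ξ), M'`. That the constants of `ξ` are
distinct and fresh is required of traces, below. -/
def Step (R : MRS J K) (s : R.Action) (M N : Multiset J) : Prop :=
  ∃ M', M = R.lhs s.rule s.sub + M' ∧ N = R.rhs s.rule s.sub s.fresh + M'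

/-- Equivalence of instantiations: equal left-hand sides, and right-hand sides `∃ n. G` that are
equal up to renaming of the bound variables `n`. -/
def Equivalent (R : MRS J K) (x y : R.Instantiation) : Prop :=
  R.lhs x.rule x.sub = R.lhs y.rule y.sub ∧
    ∃ e : Fin (R.arity x.rule) ≃ Fin (R.arity y.rule),
      ∀ ξ : Fin (R.arity y.rule) → K, R.rhs x.rule x.sub (ξ ∘ e) = R.rhs y.rule y.sub ξ

/-- A finite or infinite trace `M₀ --> M₁ --> M₂ --> ⋯`. Here `state i` is `Mᵢ` and `label i` is
the label of the step from `Mᵢ` to `Mᵢ₊₁`. A trace with exactly `n` steps has `label i = none` for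
all `i ≥ n`, and then `state` stays constant from `n` on. -/
structure Trace (R : MRS J K) (M₀ : Multiset J) where
  state : ℕ → Multiset J
  label : ℕ → Option R.Action
  state_zero : state 0 = M₀
  label_succ : ∀ i, label i = none → label (i + 1) = none
  state_idle : ∀ i, label i = none → state (i + 1) = state i
  state_step : ∀ i s, label i = some s → R.Step s (state i) (state (i + 1))
  fresh_injective : ∀ i s, label i = some s → Function.Injective s.fresh
  fresh_disjoint : ∀ i j s, i ≤ j → label j = some s →
    ∀ x ∈ state i, ∀ k, s.fresh k ∉ R.consts x

namespace Trace

variable {R : MRS J K} {M₀ : Multiset J}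

/-- The steps of `T` form an initial segment of those of `T'`. -/
def IsPrefix (T T' : Trace R M₀) : Prop :=
  ∀ i s, T.label i = some s → T'.label i = some s

/-- An execution is a maximally long trace. -/
def IsExecution (T : Trace R M₀) : Prop :=
  ∀ T' : Trace R M₀, T.IsPrefix T' → T'.IsPrefix T

/-- Every instantiation that is applicable to some `Mᵢ` is, up to equivalence, applied at some
later step. -/
def IsFair (T : Trace R M₀) : Prop :=
  ∀ i, ∀ x : R.Instantiation, R.Applicable x (T.state i) →
    ∃ j s, i ≤ j ∧ T.label j = some s ∧ R.Equivalent s.toInstantiation x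

def IsFairExecution (T : Trace R M₀) : Prop :=
  T.IsExecution ∧ T.IsFair

/-- The union of the supports of the multisets in a trace. -/
def support (T : Trace R M₀) : Set J :=
  {x | ∃ i, x ∈ T.state i}

end Trace

end MRS

/-! ### Session types -/

/-- Labels, drawn from a countably infinite set. -/
abbrev Label := ℕ

/-- Channel names, drawn from a countably infinite set. -/
abbrev Chan := ℕ

/-- Session types with at most `n` free type variables (de Bruijn indices):
`α`, `𝟏`, `B ⊗ A`, `⊕{l : A_l}`, `&{l : A_l}` and `ρα.A`. -/
inductive Ty : ℕ → Type
  | var {n : ℕ} (i : Fin n) : Ty n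
  | one {n : ℕ} : Ty n
  | tensor {n : ℕ} (B A : Ty n) : Ty n
  | plus {n : ℕ} (L : Finset Label) (A : {l // l ∈ L} → Ty n) : Ty n
  | amp {n : ℕ} (L : Finset Label) (A : {l // l ∈ L} → Ty n) : Ty n
  | mu {n : ℕ} (A : Ty (n + 1)) : Ty n

/-- Closed session types. -/
abbrev SType := Ty 0

namespace Ty

def rename : {n m : ℕ} → (Fin n → Fin m) → Ty n → Ty m
  | _, _, f, var i => var (f i)
  | _, _, _, one => one
  | _, _, f, tensor B A => tensor (B.rename f) (A.rename f)
  | _, _, f, plus L A => plus L fun l => (A l).rename f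
  | _, _, f, amp L A => amp L fun l => (A l).rename f
  | _, _, f, mu A => mu (A.rename (Fin.cases 0 fun i => (f i).succ))

/-- Capture-avoiding simultaneous substitution. -/
def subst : {n m : ℕ} → (Fin n → Ty m) → Ty n → Ty m
  | _, _, σ, var i => σ i
  | _, _, _, one => one
  | _, _, σ, tensor B A => tensor (B.subst σ) (A.subst σ)
  | _, _, σ, plus L A => plus L fun l => (A l).subst σ
  | _, _, σ, amp L A => amp L fun l => (A l).subst σ
  | _, _, σ, mu A => mu (A.subst (Fin.cases (var 0) fun i => (σ i).rename Fin.succ))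

/-- The unfolding `[ρα.A/α]A` of the closed type `ρα.A`. -/
def unfold (A : Ty 1) : SType :=
  A.subst fun _ => mu A

/-- Positive session types: every closed type but the external choices. -/
def IsPositive : SType → Prop
  | one => True
  | tensor _ _ => True
  | plus _ _ => True
  | amp _ _ => False
  | mu _ => True

end Ty

/-! ### The terms of the language, up to renaming of bound channels and variables -/

/-- An occurrence of a channel in a term: a free channel name or a bound channel, given by its
de Bruijn index (locally nameless representation). -/
inductive ChanRef : Type
  | free (a : Chan)
  | bound (i : ℕ)

/-- Process terms. Process variables are de Bruijn indices. -/
inductive Proc : Type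
  /-- Forward from `a` to `b`. -/
  | fwd (a b : ChanRef)
  /-- `a : A ← P; Q`, which binds the channel `a` in `P` and in `Q`. -/
  | cut (A : SType) (P Q : Proc)
  /-- `close a`. -/
  | close (a : ChanRef)
  /-- `wait a; P`. -/
  | wait (a : ChanRef) (P : Proc)
  /-- `send a b; P`. -/
  | sendC (a b : ChanRef) (P : Proc)
  /-- `b ← recv a; P`, which binds the channel `b` in `P`. -/
  | recvC (a : ChanRef) (P : Proc)
  /-- `a.k; P`. -/
  | sendL (a : ChanRef) (k : Label) (P : Proc)
  /-- `case a {l ⇒ P_l}`. -/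
  | caseL (a : ChanRef) (L : Finset Label) (P : {l // l ∈ L} → Proc)
  /-- `send a unfold; P`. -/
  | sendU (a : ChanRef) (P : Proc)
  /-- `unfold ← recv a; P`. -/
  | recvU (a : ChanRef) (P : Proc)
  /-- A process variable `p`. -/
  | pvar (p : ℕ)
  /-- `fix p.P`, which binds the process variable `p` in `P`. -/
  | fix (P : Proc)

namespace ChanRef

def names : ChanRef → Finset Chan
  | free a => {a}
  | bound _ => ∅

/-- Replace the bound channel `k` by the name `b`. -/
def openAt (b : Chan) (k : ℕ) : ChanRef → ChanRef
  | free a => free a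
  | bound i => if i = k then free b else bound i

/-- Replace the name `a` by the name `d`. -/
def rename (d a : Chan) : ChanRef → ChanRef
  | free x => if x = a then free d else free x
  | bound i => bound i

end ChanRef

namespace Proc

/-- The free channel names of a term. -/
def fcn : Proc → Finset Chan
  | fwd a b => a.names ∪ b.names
  | cut _ P Q => P.fcn ∪ Q.fcn
  | close a => a.names
  | wait a P => a.names ∪ P.fcn
  | sendC a b P => a.names ∪ b.names ∪ P.fcn
  | recvC a P => a.names ∪ P.fcn
  | sendL a _ P => a.names ∪ P.fcn
  | caseL a _ P => a.names ∪ Finset.univ.biUnion fun l => (P l).fcn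
  | sendU a P => a.names ∪ P.fcn
  | recvU a P => a.names ∪ P.fcn
  | pvar _ => ∅
  | fix P => P.fcn

/-- Replace the bound channel with index `k` by the name `b`. -/
def openAt (b : Chan) : ℕ → Proc → Proc
  | k, fwd x y => fwd (x.openAt b k) (y.openAt b k)
  | k, cut A P Q => cut A (P.openAt b (k + 1)) (Q.openAt b (k + 1))
  | k, close x => close (x.openAt b k)
  | k, wait x P => wait (x.openAt b k) (P.openAt b k)
  | k, sendC x y P => sendC (x.openAt b k) (y.openAt b k) (P.openAt b k)
  | k, recvC x P => recvC (x.openAt b k) (P.openAt b (k + 1))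
  | k, sendL x l P => sendL (x.openAt b k) l (P.openAt b k)
  | k, caseL x L P => caseL (x.openAt b k) L fun l => (P l).openAt b k
  | k, sendU x P => sendU (x.openAt b k) (P.openAt b k)
  | k, recvU x P => recvU (x.openAt b k) (P.openAt b k)
  | _, pvar p => pvar p
  | k, fix P => fix (P.openAt b k)

/-- `P.inst b` is `[b/a]P` for the body `P` of a binder of a channel `a`. -/
def inst (P : Proc) (b : Chan) : Proc :=
  P.openAt b 0

/-- `P.rename d a` is `[d/a]P` for a free channel name `a`. -/
def rename (d a : Chan) : Proc → Proc
  | fwd x y => fwd (x.rename d a) (y.rename d a)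
  | cut A P Q => cut A (P.rename d a) (Q.rename d a)
  | close x => close (x.rename d a)
  | wait x P => wait (x.rename d a) (P.rename d a)
  | sendC x y P => sendC (x.rename d a) (y.rename d a) (P.rename d a)
  | recvC x P => recvC (x.rename d a) (P.rename d a)
  | sendL x l P => sendL (x.rename d a) l (P.rename d a)
  | caseL x L P => caseL (x.rename d a) L fun l => (P l).rename d a
  | sendU x P => sendU (x.rename d a) (P.rename d a)
  | recvU x P => recvU (x.rename d a) (P.rename d a)
  | pvar p => pvar p
  | fix P => fix (P.rename d a)

/-- Substitute `R` for the process variable with index `k`. It is only used for an `R` without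
dangling indices, which need not be shifted under binders. -/
def substVar (R : Proc) : ℕ → Proc → Proc
  | _, fwd x y => fwd x y
  | k, cut A P Q => cut A (substVar R k P) (substVar R k Q)
  | _, close x => close x
  | k, wait x P => wait x (substVar R k P)
  | k, sendC x y P => sendC x y (substVar R k P)
  | k, recvC x P => recvC x (substVar R k P)
  | k, sendL x l P => sendL x l (substVar R k P)
  | k, caseL x L P => caseL x L fun l => substVar R k (P l)
  | k, sendU x P => sendU x (substVar R k P)
  | k, recvU x P => recvU x (substVar R k P)
  | k, pvar p => if p = k then R else if k < p then pvar (p - 1) else pvar p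
  | k, fix P => fix (substVar R (k + 1) P)

/-- `[fix p.P/p]P`. -/
def unfoldFix (P : Proc) : Proc :=
  substVar (fix P) 0 P

end Proc

/-! ### Statics -/

/-- A linear context `c₁ : A₁, …, cₙ : Aₙ`. -/
abbrev Ctx := Multiset (Chan × SType)

/-- The type `{c : C ← Δ}` of a process variable. -/
structure PVarType where
  ctx : Ctx
  chan : Chan
  type : SType

open ChanRef in
/-- The typing judgment `Γ; Δ ⊢ P :: c : C`. The name given to a bound channel ranges over all
names outside a finite set, so it is fresh for `Γ`, `Δ` and `c`. -/
inductive Typed : List PVarType → Ctx → Proc → Chan → SType → Prop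
  | fwd {Γ : List PVarType} {a b : Chan} {A : SType} (hA : A.IsPositive) :
      Typed Γ {(a, A)} (.fwd (free a) (free b)) b A
  | cut {Γ : List PVarType} {Δ₁ Δ₂ : Ctx} {A : SType} {P Q : Proc} {c : Chan} {C : SType}
      (S : Finset Chan)
      (hP : ∀ a ∉ S, Typed Γ Δ₁ (P.inst a) a A)
      (hQ : ∀ a ∉ S, Typed Γ ((a, A) ::ₘ Δ₂) (Q.inst a) c C) :
      Typed Γ (Δ₁ + Δ₂) (.cut A P Q) c C
  | oneR {Γ : List PVarType} {a : Chan} :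
      Typed Γ 0 (.close (free a)) a .one
  | oneL {Γ : List PVarType} {Δ : Ctx} {a : Chan} {P : Proc} {c : Chan} {C : SType}
      (hP : Typed Γ Δ P c C) :
      Typed Γ ((a, .one) ::ₘ Δ) (.wait (free a) P) c C
  | tensorR {Γ : List PVarType} {Δ : Ctx} {a b : Chan} {A B : SType} {P : Proc}
      (hP : Typed Γ Δ P a A) :
      Typed Γ ((b, B) ::ₘ Δ) (.sendC (free a) (free b) P) a (.tensor B A)
  | tensorL {Γ : List PVarType} {Δ : Ctx} {a : Chan} {A B : SType} {P : Proc} {c : Chan}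
      {C : SType} (S : Finset Chan)
      (hP : ∀ b ∉ S, Typed Γ ((b, B) ::ₘ (a, A) ::ₘ Δ) (P.inst b) c C) :
      Typed Γ ((a, .tensor B A) ::ₘ Δ) (.recvC (free a) P) c C
  | plusR {Γ : List PVarType} {Δ : Ctx} {a : Chan} {L : Finset Label}
      {A : {l // l ∈ L} → SType} (k : {l // l ∈ L}) {P : Proc}
      (hP : Typed Γ Δ P a (A k)) :
      Typed Γ Δ (.sendL (free a) k P) a (.plus L A)
  | plusL {Γ : List PVarType} {Δ : Ctx} {a : Chan} {L : Finset Label}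
      {A : {l // l ∈ L} → SType} {P : {l // l ∈ L} → Proc} {c : Chan} {C : SType}
      (hP : ∀ l, Typed Γ ((a, A l) ::ₘ Δ) (P l) c C) :
      Typed Γ ((a, .plus L A) ::ₘ Δ) (.caseL (free a) L P) c C
  | ampR {Γ : List PVarType} {Δ : Ctx} {a : Chan} {L : Finset Label}
      {A : {l // l ∈ L} → SType} {P : {l // l ∈ L} → Proc}
      (hP : ∀ l, Typed Γ Δ (P l) a (A l)) :
      Typed Γ Δ (.caseL (free a) L P) a (.amp L A)
  | ampL {Γ : List PVarType} {Δ : Ctx} {a : Chan} {L : Finset Label}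
      {A : {l // l ∈ L} → SType} (k : {l // l ∈ L}) {P : Proc} {c : Chan} {C : SType}
      (hP : Typed Γ ((a, A k) ::ₘ Δ) P c C) :
      Typed Γ ((a, .amp L A) ::ₘ Δ) (.sendL (free a) k P) c C
  | muR {Γ : List PVarType} {Δ : Ctx} {a : Chan} {A : Ty 1} {P : Proc}
      (hP : Typed Γ Δ P a A.unfold) :
      Typed Γ Δ (.sendU (free a) P) a (.mu A)
  | muL {Γ : List PVarType} {Δ : Ctx} {a : Chan} {A : Ty 1} {P : Proc} {c : Chan} {C : SType}
      (hP : Typed Γ ((a, A.unfold) ::ₘ Δ) P c C) :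
      Typed Γ ((a, .mu A) ::ₘ Δ) (.recvU (free a) P) c C
  | pvar {Γ : List PVarType} {Δ : Ctx} {p : ℕ} {c : Chan} {C : SType}
      (hp : Γ[p]? = some ⟨Δ, c, C⟩) :
      Typed Γ Δ (.pvar p) c C
  | fix {Γ : List PVarType} {Δ : Ctx} {P : Proc} {c : Chan} {C : SType}
      (hP : Typed (⟨Δ, c, C⟩ :: Γ) Δ P c C) :
      Typed Γ Δ (.fix P) c C

/-! ### Dynamics -/

/-- The contents of messages on a channel: the close message `∗`, a channel `e`, a label `l`, or
an unfold message, where `d` is the continuation channel. -/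
inductive Msg : Type
  | star
  | chan (e d : Chan)
  | label (l : Label) (d : Chan)
  | unfold (d : Chan)

def Msg.names : Msg → Finset Chan
  | .star => ∅
  | .chan e d => {e, d}
  | .label _ d => {d}
  | .unfold d => {d}

/-- The judgments `proc(c, P)`, `msg(c, m)` and (persistent) `type(c, A)`. -/
inductive Judg : Type
  | proc (c : Chan) (P : Proc)
  | msg (c : Chan) (m : Msg)
  | type (c : Chan) (A : SType)

namespace Judg

def names : Judg → Finset Chan
  | proc c P => {c} ∪ P.fcn
  | msg c m => {c} ∪ m.names
  | type c _ => {c}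

def IsType : Judg → Prop
  | proc _ _ => False
  | msg _ _ => False
  | type _ _ => True

end Judg

inductive PRule : Type
  | fwd | cut | oneR | oneL | tensorR | tensorL | plusR | plusL | ampR | ampL | muR | muL | fix

/-- The matching substitutions of the rules. In `plusL` the provided channel `c` differs from the
channel `a` on which the process receives; `ampR` is the rule for a process that receives on the
channel it provides. -/
inductive PSub : PRule → Type
  | fwd (a b : Chan) (m : Msg) : PSub .fwd
  | cut (c : Chan) (A : SType) (P Q : Proc) : PSub .cut
  | oneR (a : Chan) : PSub .oneR
  | oneL (a c : Chan) (P : Proc) : PSub .oneL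
  | tensorR (a b : Chan) (P : Proc) (B A : SType) : PSub .tensorR
  | tensorL (a c e d : Chan) (P : Proc) : PSub .tensorL
  | plusR (a : Chan) (L : Finset Label) (A : {l // l ∈ L} → SType) (k : {l // l ∈ L})
      (P : Proc) : PSub .plusR
  | plusL (a c d : Chan) (hac : a ≠ c) (L : Finset Label) (k : {l // l ∈ L})
      (P : {l // l ∈ L} → Proc) : PSub .plusL
  | ampR (a d : Chan) (L : Finset Label) (k : {l // l ∈ L}) (P : {l // l ∈ L} → Proc) :
      PSub .ampR
  | ampL (a c : Chan) (L : Finset Label) (A : {l // l ∈ L} → SType) (k : {l // l ∈ L})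
      (P : Proc) : PSub .ampL
  | muR (a : Chan) (A : Ty 1) (P : Proc) : PSub .muR
  | muL (a c d : Chan) (P : Proc) : PSub .muL
  | fix (c : Chan) (P : Proc) : PSub .fix

namespace PRule

open ChanRef Judg

/-- The number of fresh channels that a rule generates. -/
def arity : PRule → ℕ
  | cut | tensorR | plusR | ampL | muR => 1
  | fwd | oneR | oneL | tensorL | plusL | ampR | muL | fix => 0

def lhs : (r : PRule) → PSub r → Multiset Judg
  | _, .fwd a b m => {msg a m, proc b (.fwd (free a) (free b))}
  | _, .cut c A P Q => {proc c (.cut A P Q)}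
  | _, .oneR a => {proc a (.close (free a))}
  | _, .oneL a c P => {msg a .star, proc c (.wait (free a) P)}
  | _, .tensorR a b P B A => {proc a (.sendC (free a) (free b) P), type a (.tensor B A)}
  | _, .tensorL a c e d P => {msg a (.chan e d), proc c (.recvC (free a) P)}
  | _, .plusR a L A k P => {proc a (.sendL (free a) k P), type a (.plus L A)}
  | _, .plusL a c d _ L k P => {msg a (.label k d), proc c (.caseL (free a) L P)}
  | _, .ampR a d L k P => {msg a (.label k d), proc a (.caseL (free a) L P)}
  | _, .ampL a c L A k P => {proc c (.sendL (free a) k P), type a (.amp L A)}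
  | _, .muR a A P => {proc a (.sendU (free a) P), type a (.mu A)}
  | _, .muL a c d P => {msg a (.unfold d), proc c (.recvU (free a) P)}
  | _, .fix c P => {proc c (.fix P)}

/-- The right-hand sides; `ξ 0` is the fresh channel, if there is one. The persistent judgments
of the left-hand side are repeated. -/
def rhs : (r : PRule) → PSub r → (Fin r.arity → Chan) → Multiset Judg
  | _, .fwd _ b m, _ => {msg b m}
  | _, .cut c A P Q, ξ =>
      let b := ξ (0 : Fin 1)
      {proc b (P.inst b), proc c (Q.inst b), type b A}
  | _, .oneR a, _ => {msg a .star}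
  | _, .oneL _ c P, _ => {proc c P}
  | _, .tensorR a b P B A, ξ =>
      let d := ξ (0 : Fin 1)
      {proc d (P.rename d a), msg a (.chan b d), type d A, type a (.tensor B A)}
  | _, .tensorL a c e d P, _ => {proc c ((P.rename d a).inst e)}
  | _, .plusR a L A k P, ξ =>
      let d := ξ (0 : Fin 1)
      {msg a (.label k d), proc d (P.rename d a), type d (A k), type a (.plus L A)}
  | _, .plusL a c d _ _ k P, _ => {proc c ((P k).rename d a)}
  | _, .ampR a d _ k P, _ => {proc d ((P k).rename d a)}
  | _, .ampL a c L A k P, ξ =>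
      let d := ξ (0 : Fin 1)
      {msg a (.label k d), proc c (P.rename d a), type d (A k), type a (.amp L A)}
  | _, .muR a A P, ξ =>
      let d := ξ (0 : Fin 1)
      {msg a (.unfold d), proc d (P.rename d a), type d A.unfold, type a (.mu A)}
  | _, .muL a c d P, _ => {proc c (P.rename d a)}
  | _, .fix c P, _ => {proc c P.unfoldFix}

open Classical in
theorem persistent_le (r : PRule) (θ : PSub r) (ξ : Fin r.arity → Chan) :
    (lhs r θ).filter IsType ≤ rhs r θ ξ := by
  cases θ <;>
    simp [lhs, rhs, Multiset.insert_eq_cons, ← Multiset.singleton_add, Multiset.filter_add,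
      Multiset.filter_singleton, IsType]

end PRule

/-- The multiset rewriting system of the session-typed language. -/
def procMRS : MRS Judg Chan where
  Rule := PRule
  Sub := PSub
  arity := PRule.arity
  lhs := PRule.lhs
  rhs := PRule.rhs
  consts := Judg.names
  IsPersistent := Judg.IsType
  persistent_le := PRule.persistent_le

/-- The initial configuration `proc(c₀, P), type(c₀, A₀), …, type(cₙ, Aₙ)`. -/
def initialConfig {n : ℕ} (c : Fin (n + 1) → Chan) (A : Fin (n + 1) → SType) (P : Proc) :
    Multiset Judg :=
  .proc (c 0) P ::ₘ Finset.univ.val.map fun i => .type (c i) (A i)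

/-! ### Communications and their observation -/

/-- The head symbols of communications. -/
inductive CommShape : Type
  | bot (A : SType)
  | star
  | label (k : Label)
  | pair
  | unfold

/-- The signature of communications: every head symbol with its type of argument places. -/
def commSig : PFunctor where
  A := CommShape
  B
    | .bot _ => Fin 0
    | .star => Fin 0
    | .label _ => Fin 1
    | .pair => Fin 2
    | .unfold => Fin 1

/-- Communications: the potentially infinite trees generated by
`v ::= ⊥_A | ∗ | (k, v) | (v, v') | (unfold, v)`. -/
abbrev Comm := commSig.M

namespace Comm

def bot (A : SType) : Comm := PFunctor.M.mk ⟨.bot A, ![]⟩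
def star : Comm := PFunctor.M.mk ⟨.star, ![]⟩
def label (k : Label) (v : Comm) : Comm := PFunctor.M.mk ⟨.label k, ![v]⟩
def pair (u v : Comm) : Comm := PFunctor.M.mk ⟨.pair, ![u, v]⟩
def unfold (v : Comm) : Comm := PFunctor.M.mk ⟨.unfold, ![v]⟩

end Comm

/-- One application of an observation rule over a set `𝒯` of judgments: the triple `(v, c, A)` is
the conclusion of a rule whose observation premises belong to `R`. -/
inductive ObsStep (𝒯 : Set Judg) (R : Comm → Chan → SType → Prop) : Comm → Chan → SType → Prop
  | bot {c : Chan} {A : SType} (hm : ∀ m, Judg.msg c m ∉ 𝒯) (ht : Judg.type c A ∈ 𝒯) :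
      ObsStep 𝒯 R (Comm.bot A) c A
  | one {c : Chan} (hm : Judg.msg c .star ∈ 𝒯) :
      ObsStep 𝒯 R Comm.star c .one
  | plus {c d : Chan} {L : Finset Label} {A : {l // l ∈ L} → SType} {l : {l // l ∈ L}}
      {v : Comm} (hm : Judg.msg c (.label l d) ∈ 𝒯) (hv : R v d (A l))
      (ht : Judg.type c (.plus L A) ∈ 𝒯) :
      ObsStep 𝒯 R (Comm.label l v) c (.plus L A)
  | amp {c d : Chan} {L : Finset Label} {A : {l // l ∈ L} → SType} {l : {l // l ∈ L}}
      {v : Comm} (hm : Judg.msg c (.label l d) ∈ 𝒯) (hv : R v d (A l))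
      (ht : Judg.type c (.amp L A) ∈ 𝒯) :
      ObsStep 𝒯 R (Comm.label l v) c (.amp L A)
  | tensor {c a d : Chan} {A B : SType} {u v : Comm} (hm : Judg.msg c (.chan a d) ∈ 𝒯)
      (hu : R u a A) (hv : R v d B) :
      ObsStep 𝒯 R (Comm.pair u v) c (.tensor A B)
  | mu {c d : Chan} {A : Ty 1} {v : Comm} (hm : Judg.msg c (.unfold d) ∈ 𝒯)
      (hv : R v d A.unfold) :
      ObsStep 𝒯 R (Comm.unfold v) c (.mu A)

/-- The communication `v` of type `A` is observed on the channel `c` during the trace `T`: the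
largest relation every triple of which is the conclusion of a rule with premises in the relation
(that is, the relation defined coinductively by the observation rules). -/
def Observes {M₀ : Multiset Judg} (T : procMRS.Trace M₀) (v : Comm) (c : Chan) (A : SType) :
    Prop :=
  ∃ R : Comm → Chan → SType → Prop,
    (∀ v c A, R v c A → ObsStep T.support R v c A) ∧ R v c A

/-! A fair execution is determined up to the names of generated channels and the order of
independent steps. A process has at most one possible next step; once possible, that step stays
possible until it is taken, and fairness takes it. After a canonical renaming of channels, all fair
executions therefore contain the same judgments, and observations depend only on that set of
judgments.

Canonical names: an initial channel `x` is called `2 * x`, and a channel generated in the `k`th step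
of the process providing `c` is called `freshName` of the name of `c` and `k`. Closing the initial
multiset under the rules with these names, and recording the step number of every process, gives the
predicate `Derivable`, which refers to no trace. Every judgment of a run is derivable
(`IsRun.derivable`), and every derivable judgment occurs in every fair run
(`IsRun.exists_of_derivable`). Hence two fair runs have the same judgments up to names, and
`IsRun.observes_unique` compares their observations by a bisimulation.

That steps cannot be lost or altered rests on linearity, the content of the invariant `Config.Good`,
which `Config.Good.exists_transition` preserves. Every ephemeral judgment becomes an `Entry` with
used and provided channels: a process uses its context; a message on a channel of positive type
provides that channel and uses those it carries; a message on a channel of negative type uses that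
channel and provides its continuation. Provided channels are distinct, used channels are distinct,
and a rank that is lower on used than on provided channels keeps a process from using its own
channel.

A channel that carries a message leaves the unsent provided channels (positive type) or the unsent
used channels (negative type) and never returns. So all messages on a channel in a run are equal
(`IsRun.msg_unique`), and a received message has no second reader (`IsRun.notMem_of_received`).
Since messages and types are unique, a process determines its instantiation (`PSub.eq_of_subject`).
Hence judgments seen at different times suffice for a step to be applied in a fair run
(`IsRun.exists_label`). -/

/-! ### Renaming of channel names -/

namespace ChanRef

/-- Apply `f` to the free names. -/
def map (f : Chan → Chan) : ChanRef → ChanRef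
  | free a => free (f a)
  | bound i => bound i

theorem rename_eq_map (d a : Chan) (x : ChanRef) :
    x.rename d a = x.map fun y => if y = a then d else y := by
  cases x <;> simp only [rename, map]
  split_ifs <;> rfl

theorem map_openAt (f : Chan → Chan) (b : Chan) (k : ℕ) (x : ChanRef) :
    (x.openAt b k).map f = (x.map f).openAt (f b) k := by
  cases x <;> simp only [openAt, map]
  split_ifs <;> rfl

theorem map_map (f g : Chan → Chan) (x : ChanRef) : (x.map f).map g = x.map (g ∘ f) := by
  cases x <;> rfl

theorem map_congr {f g : Chan → Chan} {x : ChanRef} (h : ∀ y ∈ x.names, f y = g y) :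
    x.map f = x.map g := by
  cases x <;> simp_all [names, map]

theorem names_map (f : Chan → Chan) (x : ChanRef) : (x.map f).names = x.names.image f := by
  cases x <;> rfl

theorem openAt_eq_self {x : ChanRef} {y b : Chan} {j k : ℕ} (hjk : j ≠ k)
    (h : (x.openAt y j).openAt b k = x.openAt y j) : x.openAt b k = x := by
  cases x with
  | free a => rfl
  | bound i =>
    simp only [openAt] at h ⊢
    by_cases hi : i = k
    · subst hi
      simp [hjk.symm] at h
    · simp [hi]

end ChanRef

namespace Proc

/-- Apply `f` to the free channel names. -/
def map (f : Chan → Chan) : Proc → Proc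
  | fwd x y => fwd (x.map f) (y.map f)
  | cut A P Q => cut A (P.map f) (Q.map f)
  | close x => close (x.map f)
  | wait x P => wait (x.map f) (P.map f)
  | sendC x y P => sendC (x.map f) (y.map f) (P.map f)
  | recvC x P => recvC (x.map f) (P.map f)
  | sendL x l P => sendL (x.map f) l (P.map f)
  | caseL x L P => caseL (x.map f) L fun l => (P l).map f
  | sendU x P => sendU (x.map f) (P.map f)
  | recvU x P => recvU (x.map f) (P.map f)
  | pvar p => pvar p
  | fix P => fix (P.map f)

theorem rename_eq_map (d a : Chan) (P : Proc) :
    P.rename d a = P.map fun y => if y = a then d else y := by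
  induction P <;> simp_all [rename, map, ChanRef.rename_eq_map]

theorem map_openAt (f : Chan → Chan) (b : Chan) (k : ℕ) (P : Proc) :
    (P.openAt b k).map f = (P.map f).openAt (f b) k := by
  induction P generalizing k <;> simp_all [openAt, map, ChanRef.map_openAt]

theorem map_inst (f : Chan → Chan) (b : Chan) (P : Proc) :
    (P.inst b).map f = (P.map f).inst (f b) :=
  map_openAt f b 0 P

theorem map_map (f g : Chan → Chan) (P : Proc) : (P.map f).map g = P.map (g ∘ f) := by
  induction P <;> simp_all [map, ChanRef.map_map]

theorem map_congr {f g : Chan → Chan} {P : Proc} (h : ∀ y ∈ P.fcn, f y = g y) :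
    P.map f = P.map g := by
  induction P with
  | caseL x L P ih =>
    simp only [fcn, Finset.mem_union, Finset.mem_biUnion, Finset.mem_univ, true_and] at h
    simp only [map, caseL.injEq, heq_eq_eq, true_and]
    exact ⟨ChanRef.map_congr fun y hy => h y (.inl hy),
      funext fun l => ih l fun y hy => h y (.inr ⟨l, hy⟩)⟩
  | _ =>
    simp only [fcn, Finset.mem_union] at h
    simp only [map]
    try congr 1 <;> first
      | exact ChanRef.map_congr fun y hy => h y (by simp [hy])
      | (apply_assumption; intro y hy; exact h y (by simp [hy]))

theorem map_eq_self {f : Chan → Chan} {P : Proc} (h : ∀ y ∈ P.fcn, f y = y) : P.map f = P := by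
  rw [map_congr (g := id) h]
  clear h
  have hx : ∀ x : ChanRef, x.map id = x := by rintro (_ | _) <;> rfl
  induction P <;> simp_all [map]

theorem fcn_map (f : Chan → Chan) (P : Proc) : (P.map f).fcn = P.fcn.image f := by
  induction P <;>
    simp_all [map, fcn, ChanRef.names_map, Finset.image_union, Finset.biUnion_image]

theorem fcn_subset_fcn_openAt (a : Chan) (k : ℕ) (P : Proc) : P.fcn ⊆ (P.openAt a k).fcn := by
  have hr (y : ChanRef) (k : ℕ) : y.names ⊆ (y.openAt a k).names := by
    cases y <;> simp [ChanRef.openAt, ChanRef.names]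
  induction P generalizing k with
  | caseL y L P ih =>
    exact Finset.union_subset_union (hr y k) (Finset.biUnion_mono fun l _ => ih l k)
  | _ =>
    simp only [openAt, fcn]
    first
      | apply_assumption
      | exact Finset.Subset.rfl
      | gcongr <;> apply_assumption

theorem map_substVar (f : Chan → Chan) (R : Proc) (k : ℕ) (P : Proc) :
    (substVar R k P).map f = substVar (R.map f) k (P.map f) := by
  induction P generalizing k with
  | pvar p =>
    simp only [substVar, map]
    split_ifs <;> rfl
  | _ => simp_all [substVar, map]

theorem map_unfoldFix (f : Chan → Chan) (P : Proc) : P.unfoldFix.map f = (P.map f).unfoldFix :=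
  map_substVar f _ 0 P

/-- If `f` sent another name of `P` to `f a`, the renaming on the right would also catch that name.
Injectivity elsewhere is not needed. -/
theorem map_rename {f : Chan → Chan} {d a : Chan} {P : Proc}
    (h : ∀ y ∈ P.fcn, f y = f a → y = a) :
    (P.rename d a).map f = (P.map f).rename (f d) (f a) := by
  rw [rename_eq_map, rename_eq_map, map_map, map_map]
  refine map_congr fun y hy => ?_
  by_cases hya : y = a
  · simp [hya]
  · have : f y ≠ f a := fun hf => hya (h y hy hf)
    simp [hya, this]

theorem rename_inst {d a x : Chan} (hx : x ≠ a) (P : Proc) :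
    (P.inst x).rename d a = (P.rename d a).inst x := by
  rw [rename_eq_map, map_inst, ← rename_eq_map]
  simp [hx]

theorem inst_rename {b x : Chan} {P : Proc} (hx : x ∉ P.fcn) :
    (P.inst x).rename b x = P.inst b := by
  rw [rename_eq_map, map_inst, map_eq_self]
  · simp
  · intro y hy
    have : y ≠ x := fun h => hx (h ▸ hy)
    simp [this]

/-- Opening index `j` leaves a dangling index `k ≠ j` in place. So the absence of dangling indices
passes from an instance of a binder's body, which is what typing speaks of, to the body itself. -/
theorem openAt_eq_self {P : Proc} {y b : Chan} {j k : ℕ} (hjk : j ≠ k)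
    (h : (P.openAt y j).openAt b k = P.openAt y j) : P.openAt b k = P := by
  induction P generalizing j k with
  | pvar p => rfl
  | caseL x L P ih =>
    simp only [openAt, caseL.injEq, heq_eq_eq, true_and] at h ⊢
    exact ⟨ChanRef.openAt_eq_self hjk h.1, funext fun l => ih l hjk (congrFun h.2 l)⟩
  | cut A P Q ihP ihQ =>
    simp only [openAt, cut.injEq, true_and] at h ⊢
    exact ⟨ihP (by omega) h.1, ihQ (by omega) h.2⟩
  | recvC x P ih =>
    simp only [openAt, recvC.injEq] at h ⊢
    exact ⟨ChanRef.openAt_eq_self hjk h.1, ih (by omega) h.2⟩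
  | fwd x y =>
    simp only [openAt, fwd.injEq] at h ⊢
    exact ⟨ChanRef.openAt_eq_self hjk h.1, ChanRef.openAt_eq_self hjk h.2⟩
  | sendC x y P ih =>
    simp only [openAt, sendC.injEq] at h ⊢
    exact ⟨ChanRef.openAt_eq_self hjk h.1, ChanRef.openAt_eq_self hjk h.2.1, ih hjk h.2.2⟩
  | close x =>
    simp only [openAt, close.injEq] at h ⊢
    exact ChanRef.openAt_eq_self hjk h
  | wait x P ih =>
    simp only [openAt, wait.injEq] at h ⊢
    exact ⟨ChanRef.openAt_eq_self hjk h.1, ih hjk h.2⟩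
  | sendL x l P ih =>
    simp only [openAt, sendL.injEq, true_and] at h ⊢
    exact ⟨ChanRef.openAt_eq_self hjk h.1, ih hjk h.2⟩
  | sendU x P ih =>
    simp only [openAt, sendU.injEq] at h ⊢
    exact ⟨ChanRef.openAt_eq_self hjk h.1, ih hjk h.2⟩
  | recvU x P ih =>
    simp only [openAt, recvU.injEq] at h ⊢
    exact ⟨ChanRef.openAt_eq_self hjk h.1, ih hjk h.2⟩
  | fix P ih =>
    simp only [openAt, fix.injEq] at h ⊢
    exact ih hjk h

theorem substVar_openAt {R : Proc} (hR : ∀ b k, R.openAt b k = R) (b : Chan) (j k : ℕ)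
    (P : Proc) : (substVar R k P).openAt b j = substVar R k (P.openAt b j) := by
  induction P generalizing j k with
  | pvar p =>
    simp only [substVar, openAt]
    split_ifs <;> simp [openAt, hR]
  | _ => simp_all [substVar, openAt]

theorem substVar_inst {R : Proc} (hR : ∀ b k, R.openAt b k = R) (b : Chan) (k : ℕ) (P : Proc) :
    (substVar R k P).inst b = substVar R k (P.inst b) :=
  substVar_openAt hR b 0 k P

end Proc

/-! ### Properties of the typing judgment -/

/-- Apply `f` to the channels of a context. -/
def Ctx.map (f : Chan → Chan) (Δ : Ctx) : Ctx :=
  Multiset.map (fun x => (f x.1, x.2)) Δ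

theorem Ctx.map_eq_self {f : Chan → Chan} {Δ : Ctx} (h : ∀ x ∈ Δ, f x.1 = x.1) :
    Ctx.map f Δ = Δ := by
  unfold Ctx.map
  conv_rhs => rw [← Multiset.map_id Δ]
  exact Multiset.map_congr rfl fun x hx => by simp [h x hx]

def PVarType.map (f : Chan → Chan) (p : PVarType) : PVarType :=
  ⟨Ctx.map f p.ctx, f p.chan, p.type⟩

namespace Typed

/-- Since `f` moves only names in `S`, a bound name chosen outside `S` is fixed and the cofinite
premises survive. Injectivity is not required, because typing does not demand distinct channels in a
context. -/
theorem map_name {Γ : List PVarType} {Δ : Ctx} {P : Proc} {c : Chan} {C : SType}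
    (h : Typed Γ Δ P c C) (f : Chan → Chan) (S : Finset Chan) (hf : ∀ x ∉ S, f x = x) :
    Typed (Γ.map (PVarType.map f)) (Ctx.map f Δ) (P.map f) (f c) C := by
  induction h with
  | fwd hA => simpa [Ctx.map, Proc.map, ChanRef.map] using Typed.fwd hA
  | cut S' hP hQ ihP ihQ =>
    simp only [Ctx.map, Multiset.map_add, Multiset.map_cons, Proc.map] at *
    refine Typed.cut (S' ∪ S) (fun a ha => ?_) (fun a ha => ?_)
    · simp only [Finset.mem_union, not_or] at ha
      have := ihP a ha.1
      rwa [Proc.map_inst, hf a ha.2] at this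
    · simp only [Finset.mem_union, not_or] at ha
      have := ihQ a ha.1
      rwa [Proc.map_inst, hf a ha.2] at this
  | oneR => simpa [Ctx.map, Proc.map, ChanRef.map] using Typed.oneR
  | oneL hP ih =>
    simp only [Ctx.map, Multiset.map_cons, Proc.map] at *
    exact Typed.oneL ih
  | tensorR hP ih =>
    simp only [Ctx.map, Multiset.map_cons, Proc.map] at *
    exact Typed.tensorR ih
  | tensorL S' hP ih =>
    simp only [Ctx.map, Multiset.map_cons, Proc.map] at *
    refine Typed.tensorL (S' ∪ S) (fun a ha => ?_)
    simp only [Finset.mem_union, not_or] at ha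
    have := ih a ha.1
    rwa [Proc.map_inst, hf a ha.2] at this
  | plusR k hP ih => exact Typed.plusR k ih
  | plusL hP ih =>
    simp only [Ctx.map, Multiset.map_cons, Proc.map] at *
    exact Typed.plusL ih
  | ampR hP ih => exact Typed.ampR ih
  | ampL k hP ih =>
    simp only [Ctx.map, Multiset.map_cons, Proc.map] at *
    exact Typed.ampL k ih
  | muR hP ih => exact Typed.muR ih
  | muL hP ih =>
    simp only [Ctx.map, Multiset.map_cons, Proc.map] at *
    exact Typed.muL ih
  | pvar hp => exact Typed.pvar (by simp [hp, PVarType.map])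
  | fix hP ih => exact Typed.fix ih

theorem rename {Δ : Ctx} {P : Proc} {c : Chan} {C : SType} (h : Typed [] Δ P c C) (d a : Chan) :
    Typed [] (Ctx.map (fun y => if y = a then d else y) Δ) (P.rename d a)
      (if c = a then d else c) C := by
  rw [Proc.rename_eq_map]
  exact h.map_name (fun y => if y = a then d else y) {a} fun x hx => by simp_all

theorem fcn_subset {Γ : List PVarType} {Δ : Ctx} {P : Proc} {c : Chan} {C : SType}
    (h : Typed Γ Δ P c C) : ∀ x ∈ P.fcn, x = c ∨ ∃ A, (x, A) ∈ Δ := by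
  have key (a x : Chan) (P : Proc) (k : ℕ) (hx : x ∈ P.fcn) : x ∈ (P.openAt a k).fcn :=
    Proc.fcn_subset_fcn_openAt a k P hx
  induction h with
  | cut S hP hQ ihP ihQ =>
    intro x hx
    simp only [Proc.fcn, Finset.mem_union] at hx
    -- The bound name differs from `x`, so `x` cannot come from the binder.
    obtain ⟨a, ha⟩ := Infinite.exists_notMem_finset (insert x S)
    simp only [Finset.mem_insert, not_or] at ha
    rcases hx with hx | hx
    · have := ihP a ha.2 x (key _ _ _ _ hx)
      grind
    · have := ihQ a ha.2 x (key _ _ _ _ hx)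
      grind
  | tensorL S hP ih =>
    intro x hx
    simp only [Proc.fcn, Finset.mem_union, ChanRef.names, Finset.mem_singleton] at hx
    obtain ⟨a, ha⟩ := Infinite.exists_notMem_finset (insert x S)
    simp only [Finset.mem_insert, not_or] at ha
    rcases hx with hx | hx
    · exact .inr ⟨_, by rw [hx]; exact Multiset.mem_cons_self _ _⟩
    · have := ih a ha.2 x (key _ _ _ _ hx)
      simp only [Multiset.mem_cons, Prod.mk.injEq] at this ⊢
      grind
  | plusL hP ih =>
    intro x hx
    simp only [Proc.fcn, Finset.mem_union, ChanRef.names, Finset.mem_singleton,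
      Finset.mem_biUnion, Finset.mem_univ, true_and] at hx
    rcases hx with hx | ⟨l, hx⟩
    · exact .inr ⟨_, by rw [hx]; exact Multiset.mem_cons_self _ _⟩
    · have := ih l x hx
      simp only [Multiset.mem_cons, Prod.mk.injEq] at this ⊢
      grind
  | ampR hP ih =>
    intro x hx
    simp only [Proc.fcn, Finset.mem_union, ChanRef.names, Finset.mem_singleton,
      Finset.mem_biUnion, Finset.mem_univ, true_and] at hx
    rcases hx with hx | ⟨l, hx⟩
    · exact .inl hx
    · exact ih l x hx
  | _ =>
    intro x hx
    simp only [Proc.fcn, Finset.mem_union, ChanRef.names, Finset.mem_singleton,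
      Multiset.mem_cons, Multiset.mem_singleton, Prod.mk.injEq, Finset.notMem_empty] at *
    try grind

/-- Typed processes have no dangling bound channels. -/
theorem openAt_eq_self {Γ : List PVarType} {Δ : Ctx} {P : Proc} {c : Chan} {C : SType}
    (h : Typed Γ Δ P c C) (b : Chan) (k : ℕ) : P.openAt b k = P := by
  induction h generalizing k with
  | cut S hP hQ ihP ihQ =>
    obtain ⟨a, ha⟩ := Infinite.exists_notMem_finset S
    simp only [Proc.openAt, Proc.cut.injEq, true_and]
    exact ⟨Proc.openAt_eq_self (by omega) (ihP a ha (k + 1)),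
      Proc.openAt_eq_self (by omega) (ihQ a ha (k + 1))⟩
  | tensorL S hP ih =>
    obtain ⟨a, ha⟩ := Infinite.exists_notMem_finset S
    simp only [Proc.openAt, Proc.recvC.injEq]
    exact ⟨rfl, Proc.openAt_eq_self (by omega) (ih a ha (k + 1))⟩
  | _ => simp_all [Proc.openAt, ChanRef.openAt]

theorem weaken {Γ : List PVarType} {Δ : Ctx} {P : Proc} {c : Chan} {C : SType}
    (h : Typed Γ Δ P c C) (Γ' : List PVarType) : Typed (Γ ++ Γ') Δ P c C := by
  induction h with
  | fwd hA => exact .fwd hA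
  | cut S hP hQ ihP ihQ => exact .cut S ihP ihQ
  | oneR => exact .oneR
  | oneL hP ih => exact .oneL ih
  | tensorR hP ih => exact .tensorR ih
  | tensorL S hP ih => exact .tensorL S ih
  | plusR k hP ih => exact .plusR k ih
  | plusL hP ih => exact .plusL ih
  | ampR hP ih => exact .ampR ih
  | ampL k hP ih => exact .ampL k ih
  | muR hP ih => exact .muR ih
  | muL hP ih => exact .muL ih
  | pvar hp =>
    refine .pvar ?_
    rw [List.getElem?_append_left (List.getElem?_eq_some_iff.mp hp).1, hp]
  | fix hP ih => exact .fix ih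

/-- The replaced variable is the last of the list, so its index is the length of `Γ`. Passing under
`fix` extends `Γ` at the front and keeps this form, which makes the induction go through. -/
theorem substVar {Γ : List PVarType} {Δ Δ' : Ctx} {P R : Proc} {c c' : Chan} {C C' : SType}
    (h : Typed (Γ ++ [⟨Δ', c', C'⟩]) Δ P c C) (hR : Typed [] Δ' R c' C') :
    Typed Γ Δ (Proc.substVar R Γ.length P) c C := by
  generalize hΓ : Γ ++ [⟨Δ', c', C'⟩] = Γ₀ at h
  induction h generalizing Γ with
  | fwd hA => exact .fwd hA
  | cut S hP hQ ihP ihQ =>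
    refine .cut S (fun a ha => ?_) (fun a ha => ?_)
    · rw [Proc.substVar_inst hR.openAt_eq_self]
      exact ihP a ha hΓ
    · rw [Proc.substVar_inst hR.openAt_eq_self]
      exact ihQ a ha hΓ
  | oneR => exact .oneR
  | oneL hP ih => exact .oneL (ih hΓ)
  | tensorR hP ih => exact .tensorR (ih hΓ)
  | tensorL S hP ih =>
    refine .tensorL S (fun a ha => ?_)
    rw [Proc.substVar_inst hR.openAt_eq_self]
    exact ih a ha hΓ
  | plusR k hP ih => exact .plusR k (ih hΓ)
  | plusL hP ih => exact .plusL fun l => ih l hΓ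
  | ampR hP ih => exact .ampR fun l => ih l hΓ
  | ampL k hP ih => exact .ampL k (ih hΓ)
  | muR hP ih => exact .muR (ih hΓ)
  | muL hP ih => exact .muL (ih hΓ)
  | @pvar _ _ p _ _ hp =>
    subst hΓ
    simp only [Proc.substVar]
    have hlt := (List.getElem?_eq_some_iff.mp hp).1
    simp only [List.length_append, List.length_singleton] at hlt
    split_ifs with h1 h2
    · subst h1
      simp only [List.getElem?_concat_length, Option.some.injEq, PVarType.mk.injEq] at hp
      obtain ⟨rfl, rfl, rfl⟩ := hp
      simpa using hR.weaken Γ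
    -- An index beyond the replaced variable would exceed the length of the context.
    · omega
    · rw [List.getElem?_append_left (by omega)] at hp
      exact .pvar hp
  | fix hP ih =>
    subst hΓ
    exact .fix (ih (Γ := _ :: Γ) rfl)

theorem unfoldFix {Δ : Ctx} {P : Proc} {c : Chan} {C : SType} (h : Typed [] Δ (.fix P) c C) :
    Typed [] Δ P.unfoldFix c C := by
  cases h with
  | fix hP => exact Typed.substVar (Γ := []) hP (.fix hP)

/-- If the body of a binder is typed for all but finitely many names of the bound channel, then
it is typed for every instance that is used linearly. -/
theorem inst_of_cofinite {Δ : Ctx} {P : Proc} {c : Chan} {C A : SType} {S : Finset Chan}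
    (h : ∀ a ∉ S, Typed [] ((a, A) ::ₘ Δ) (P.inst a) c C) (b : Chan) :
    Typed [] ((b, A) ::ₘ Δ) (P.inst b) c C := by
  -- For a name `a` that occurs nowhere else, renaming `a` to `b` changes only the instance and the
  -- head of the context. The name `b` itself need not be fresh.
  obtain ⟨a, ha⟩ := Infinite.exists_notMem_finset
    (S ∪ P.fcn ∪ {c} ∪ (Multiset.map Prod.fst Δ).toFinset)
  simp only [Finset.mem_union, Finset.mem_singleton, Multiset.mem_toFinset, Multiset.mem_map,
    not_or, not_exists, not_and] at ha
  have := (h a ha.1.1.1).rename b a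
  rw [Proc.inst_rename ha.1.1.2, if_neg (Ne.symm ha.1.2)] at this
  have h2 : Ctx.map (fun y => if y = a then b else y) Δ = Δ :=
    Ctx.map_eq_self fun x hx => if_neg (ha.2 x hx)
  unfold Ctx.map at this h2
  rw [Multiset.map_cons, h2] at this
  simpa using this

theorem inst_provider_of_cofinite {Δ : Ctx} {P : Proc} {A : SType} {S : Finset Chan}
    (h : ∀ a ∉ S, Typed [] Δ (P.inst a) a A) (b : Chan) : Typed [] Δ (P.inst b) b A := by
  obtain ⟨a, ha⟩ := Infinite.exists_notMem_finset
    (S ∪ P.fcn ∪ (Multiset.map Prod.fst Δ).toFinset)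
  simp only [Finset.mem_union, Multiset.mem_toFinset, Multiset.mem_map,
    not_or, not_exists, not_and] at ha
  have := (h a ha.1.1).rename b a
  rw [Proc.inst_rename ha.1.2, Ctx.map_eq_self fun x hx => if_neg (ha.2 x hx)] at this
  simpa using this

/-- Rename a channel that is used linearly. -/
theorem rename_client {Δ : Ctx} {P : Proc} {a c : Chan} {A C : SType}
    (h : Typed [] ((a, A) ::ₘ Δ) P c C) (d : Chan) (hc : c ≠ a) (hΔ : ∀ x ∈ Δ, x.1 ≠ a) :
    Typed [] ((d, A) ::ₘ Δ) (P.rename d a) c C := by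
  have := h.rename d a
  have h2 : Ctx.map (fun y => if y = a then d else y) Δ = Δ :=
    Ctx.map_eq_self fun x hx => if_neg (hΔ x hx)
  unfold Ctx.map at this h2
  rw [if_neg hc, Multiset.map_cons, h2] at this
  simpa using this

theorem rename_provider {Δ : Ctx} {P : Proc} {a : Chan} {A : SType}
    (h : Typed [] Δ P a A) (d : Chan) (hΔ : ∀ x ∈ Δ, x.1 ≠ a) :
    Typed [] Δ (P.rename d a) d A := by
  have := h.rename d a
  rw [if_pos rfl, Ctx.map_eq_self fun x hx => if_neg (hΔ x hx)] at this
  exact this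

end Typed

/-! ### Renaming of judgments and equivariance of the rules -/

def Msg.map (f : Chan → Chan) : Msg → Msg
  | .star => .star
  | .chan e d => .chan (f e) (f d)
  | .label l d => .label l (f d)
  | .unfold d => .unfold (f d)

namespace Judg

def map (f : Chan → Chan) : Judg → Judg
  | proc c P => proc (f c) (P.map f)
  | msg c m => msg (f c) (m.map f)
  | type c A => type (f c) A

theorem map_congr {f g : Chan → Chan} {J : Judg} (h : ∀ y ∈ J.names, f y = g y) :
    J.map f = J.map g := by
  cases J with
  | proc c P =>
    simp only [names, Finset.mem_union, Finset.mem_singleton] at h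
    simp only [map]
    rw [h c (.inl rfl), Proc.map_congr fun y hy => h y (.inr hy)]
  | msg c m => cases m <;> simp_all [names, map, Msg.map, Msg.names]
  | type c A => simp_all [names, map]

theorem map_map (f g : Chan → Chan) (J : Judg) : (J.map f).map g = J.map (g ∘ f) := by
  cases J with
  | proc c P => simp [map, Proc.map_map]
  | msg c m => cases m <;> simp [map, Msg.map]
  | type c A => simp [map]

theorem map_eq_self {f : Chan → Chan} {J : Judg} (h : ∀ y ∈ J.names, f y = y) :
    J.map f = J := by
  cases J with
  | proc c P =>
    simp only [names, Finset.mem_union, Finset.mem_singleton] at h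
    simp only [map]
    rw [h c (.inl rfl), Proc.map_eq_self fun y hy => h y (.inr hy)]
  | msg c m => cases m <;> simp_all [names, map, Msg.map, Msg.names]
  | type c A => simp_all [names, map]

theorem names_map (f : Chan → Chan) (J : Judg) : (J.map f).names = J.names.image f := by
  cases J with
  | proc c P => simp [names, map, Proc.fcn_map, Finset.image_insert]
  | msg c m => cases m <;> simp [names, map, Msg.map, Msg.names, Finset.image_insert]
  | type c A => simp [names, map]

/-- The number that `cnt` gives to the channel of a process; `0` for other judgments. -/
def count (cnt : Chan → ℕ) : Judg → ℕ
  | proc c _ => cnt c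
  | msg _ _ => 0
  | type _ _ => 0

instance decidableIsType : DecidablePred IsType
  | proc _ _ => isFalse id
  | msg _ _ => isFalse id
  | type _ _ => isTrue trivial

end Judg

/-- The ephemeral judgments of a multiset. -/
def ephemeral (M : Multiset Judg) : Multiset Judg :=
  M.filter fun J => ¬ J.IsType

theorem ephemeral_add (M N : Multiset Judg) :
    ephemeral (M + N) = ephemeral M + ephemeral N :=
  Multiset.filter_add _ _ _

namespace PSub

open Judg ChanRef

/-- The channel provided by the process to which a rule applies. -/
def subj : {r : PRule} → PSub r → Chan
  | _, fwd _ b _ => b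
  | _, cut c _ _ _ => c
  | _, oneR a => a
  | _, oneL _ c _ => c
  | _, tensorR a _ _ _ _ => a
  | _, tensorL _ c _ _ _ => c
  | _, plusR a _ _ _ _ => a
  | _, plusL _ c _ _ _ _ _ => c
  | _, ampR a _ _ _ _ => a
  | _, ampL _ c _ _ _ _ => c
  | _, muR a _ _ => a
  | _, muL _ c _ _ => c
  | _, fix c _ => c

/-- The process to which a rule applies. -/
def body : {r : PRule} → PSub r → Proc
  | _, fwd a b _ => .fwd (free a) (free b)
  | _, cut _ A P Q => .cut A P Q
  | _, oneR a => .close (free a)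
  | _, oneL a _ P => .wait (free a) P
  | _, tensorR a b P _ _ => .sendC (free a) (free b) P
  | _, tensorL a _ _ _ P => .recvC (free a) P
  | _, plusR a _ _ k P => .sendL (free a) k P
  | _, plusL a _ _ _ L _ P => .caseL (free a) L P
  | _, ampR a _ L _ P => .caseL (free a) L P
  | _, ampL a _ _ _ k P => .sendL (free a) k P
  | _, muR a _ P => .sendU (free a) P
  | _, muL a _ _ P => .recvU (free a) P
  | _, fix _ P => .fix P

/-- The message or type to which a rule applies besides a process. -/
def side : {r : PRule} → PSub r → Option Judg
  | _, fwd a _ m => some (msg a m)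
  | _, cut _ _ _ _ => none
  | _, oneR _ => none
  | _, oneL a _ _ => some (msg a .star)
  | _, tensorR a _ _ B A => some (type a (.tensor B A))
  | _, tensorL a _ e d _ => some (msg a (.chan e d))
  | _, plusR a L A _ _ => some (type a (.plus L A))
  | _, plusL a _ d _ _ k _ => some (msg a (.label k d))
  | _, ampR a d _ k _ => some (msg a (.label k d))
  | _, ampL a _ L A _ _ => some (type a (.amp L A))
  | _, muR a A _ => some (type a (.mu A))
  | _, muL a _ d _ => some (msg a (.unfold d))
  | _, fix _ _ => none

/-- The right-hand side with `b` for the fresh channel, if there is one. -/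
def rhs {r : PRule} (θ : PSub r) (b : Chan) : Multiset Judg :=
  PRule.rhs r θ fun _ => b

theorem lhs_eq {r : PRule} (θ : PSub r) :
    PRule.lhs r θ = proc θ.subj θ.body ::ₘ θ.side.elim 0 singleton := by
  cases θ <;>
    simp only [PRule.lhs, subj, body, side, Option.elim_none, Option.elim_some] <;>
    first
      | rfl
      | exact Multiset.cons_swap _ _ _

theorem mem_lhs {r : PRule} (θ : PSub r) (J : Judg) :
    J ∈ PRule.lhs r θ ↔ J = proc θ.subj θ.body ∨ θ.side = some J := by
  rw [lhs_eq]
  cases θ.side <;> simp [eq_comm]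

/-- An instantiation is determined by its subject, if messages and types are. -/
theorem eq_of_subject {S : Set Judg}
    (hm : ∀ a m m', msg a m ∈ S → msg a m' ∈ S → m = m')
    (ht : ∀ a A A', type a A ∈ S → type a A' ∈ S → A = A')
    {r r' : PRule} (θ : PSub r) (θ' : PSub r')
    (hs : θ.subj = θ'.subj) (hb : θ.body = θ'.body)
    (h : ∀ J, θ.side = some J → J ∈ S) (h' : ∀ J, θ'.side = some J → J ∈ S) :
    (⟨r, θ⟩ : Σ r, PSub r) = ⟨r', θ'⟩ := by
  cases θ <;> cases θ' <;>
    simp only [subj, body, side, reduceCtorEq, Proc.fwd.injEq, Proc.cut.injEq, Proc.close.injEq,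
      Proc.wait.injEq, Proc.sendC.injEq, Proc.recvC.injEq, Proc.sendL.injEq, Proc.caseL.injEq,
      Proc.sendU.injEq, Proc.recvU.injEq, Proc.fix.injEq, ChanRef.free.injEq, Option.some.injEq,
      forall_eq', false_imp_iff, implies_true] at hs hb h h'
  case fwd.fwd =>
    obtain ⟨rfl, rfl⟩ := hb
    cases hm _ _ _ h h'
    rfl
  case cut.cut => obtain ⟨rfl, rfl, rfl⟩ := hb; subst hs; rfl
  case oneR.oneR => subst hs; rfl
  case oneL.oneL => obtain ⟨rfl, rfl⟩ := hb; subst hs; rfl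
  case tensorR.tensorR =>
    obtain ⟨rfl, rfl, rfl⟩ := hb
    cases ht _ _ _ h h'
    rfl
  case tensorL.tensorL =>
    obtain ⟨rfl, rfl⟩ := hb
    subst hs
    cases hm _ _ _ h h'
    rfl
  case plusR.plusR =>
    obtain ⟨rfl, hk, rfl⟩ := hb
    cases ht _ _ _ h h'
    cases Subtype.ext hk
    rfl
  -- These two rules apply to the same process term; the unique type of the channel decides between
  -- them.
  case plusR.ampL =>
    obtain ⟨rfl, hk, rfl⟩ := hb
    cases ht _ _ _ h h'
  case ampL.plusR =>
    obtain ⟨rfl, hk, rfl⟩ := hb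
    cases ht _ _ _ h h'
  case ampL.ampL =>
    obtain ⟨rfl, hk, rfl⟩ := hb
    subst hs
    cases ht _ _ _ h h'
    cases Subtype.ext hk
    rfl
  case plusL.plusL =>
    obtain ⟨rfl, rfl, hP⟩ := hb
    cases hP
    subst hs
    have := hm _ _ _ h h'
    simp only [Msg.label.injEq] at this
    cases Subtype.ext this.1
    cases this.2
    rfl
  -- Here the side condition of `plusL` decides: the receiving channel is not the provided one.
  case plusL.ampR => exact absurd (hb.1.trans hs.symm) ‹_›
  case ampR.plusL => exact absurd (hb.1.symm.trans hs) ‹_›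
  case ampR.ampR =>
    obtain ⟨rfl, rfl, hP⟩ := hb
    cases hP
    have := hm _ _ _ h h'
    simp only [Msg.label.injEq] at this
    cases Subtype.ext this.1
    cases this.2
    rfl
  case muR.muR =>
    obtain ⟨rfl, rfl⟩ := hb
    cases ht _ _ _ h h'
    rfl
  case muL.muL =>
    obtain ⟨rfl, rfl⟩ := hb
    subst hs
    cases hm _ _ _ h h'
    rfl
  case fix.fix => subst hs; subst hb; rfl

/-- A left-hand side has exactly one process and at most one other judgment, so both can be read off
from the multiset. This turns the equivalence in the definition of fairness into equality of
instantiations. -/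
theorem eq_of_lhs_eq {r r' : PRule} (θ : PSub r) (θ' : PSub r')
    (h : PRule.lhs r θ = PRule.lhs r' θ') : (⟨r, θ⟩ : Σ r, PSub r) = ⟨r', θ'⟩ := by
  have hJ (J : Judg) :=
    (mem_lhs θ J).symm.trans ((Iff.of_eq (congrArg (J ∈ ·) h)).trans (mem_lhs θ' J))
  have hside : ∀ J, θ.side = some J → ∀ c P, J ≠ proc c P := by
    intro J hJ c P
    cases θ <;> simp only [side, Option.some.injEq, reduceCtorEq] at hJ <;> subst hJ <;> simp
  have hside' : ∀ J, θ'.side = some J → ∀ c P, J ≠ proc c P := by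
    intro J hJ c P
    cases θ' <;> simp only [side, Option.some.injEq, reduceCtorEq] at hJ <;> subst hJ <;> simp
  have h1 : proc θ.subj θ.body = proc θ'.subj θ'.body :=
    ((hJ _).1 (.inl rfl)).resolve_right fun hs => hside' _ hs _ _ rfl
  have h2 : ∀ J, θ.side = some J → θ'.side = some J := fun J h =>
    ((hJ J).1 (.inr h)).resolve_left fun hs => hside _ h _ _ hs
  have h3 : ∀ J, θ'.side = some J → θ.side = some J := fun J h =>
    ((hJ J).2 (.inr h)).resolve_left fun hs => hside' _ h _ _ hs
  simp only [proc.injEq] at h1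
  refine eq_of_subject (S := {J | θ.side = some J}) ?_ ?_ θ θ' h1.1 h1.2 (fun J h => h) h3
  · intro a m m' h h'
    simpa using h.symm.trans h'
  · intro a m m' h h'
    simpa using h.symm.trans h'

/-- Rules commute with renaming. Injectivity on the names of the left-hand side is needed where a
rule substitutes for a channel in a continuation, and for the side condition of `plusL`; nothing is
asked of the fresh channel. -/
theorem exists_map (f : Chan → Chan) {r : PRule} (θ : PSub r)
    (hf : Set.InjOn f {y | ∃ J ∈ PRule.lhs r θ, y ∈ J.names}) :
    ∃ θ' : PSub r, PRule.lhs r θ' = (PRule.lhs r θ).map (Judg.map f) ∧ θ'.subj = f θ.subj ∧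
      ∀ b, (θ.rhs b).map (Judg.map f) = θ'.rhs (f b) := by
  cases θ with
  | fwd a b m =>
    exact ⟨.fwd (f a) (f b) (m.map f), by simp [PRule.lhs, Judg.map, Proc.map, ChanRef.map], rfl,
      fun z => by simp [rhs, PRule.rhs, Judg.map]⟩
  | cut c A P Q =>
    exact ⟨.cut (f c) A (P.map f) (Q.map f), by simp [PRule.lhs, Judg.map, Proc.map], rfl,
      fun z => by simp [rhs, PRule.rhs, Judg.map, Proc.map_inst]⟩
  | oneR a =>
    exact ⟨.oneR (f a), by simp [PRule.lhs, Judg.map, Proc.map, ChanRef.map], rfl,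
      fun z => by simp [rhs, PRule.rhs, Judg.map, Msg.map]⟩
  | oneL a c P =>
    exact ⟨.oneL (f a) (f c) (P.map f),
      by simp [PRule.lhs, Judg.map, Proc.map, ChanRef.map, Msg.map], rfl,
      fun z => by simp [rhs, PRule.rhs, Judg.map]⟩
  | tensorR a b P B A =>
    have h : ∀ y ∈ P.fcn, f y = f a → y = a := fun y hy he =>
      hf (by simp [PRule.lhs, Judg.names, Proc.fcn, hy])
        (by simp [PRule.lhs, Judg.names]) he
    exact ⟨.tensorR (f a) (f b) (P.map f) B A,
      by simp [PRule.lhs, Judg.map, Proc.map, ChanRef.map], rfl,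
      fun z => by simp [rhs, PRule.rhs, Judg.map, Msg.map, Proc.map_rename h]⟩
  | tensorL a c e d P =>
    have h : ∀ y ∈ P.fcn, f y = f a → y = a := fun y hy he =>
      hf (by simp [PRule.lhs, Judg.names, Proc.fcn, hy])
        (by simp [PRule.lhs, Judg.names]) he
    exact ⟨.tensorL (f a) (f c) (f e) (f d) (P.map f),
      by simp [PRule.lhs, Judg.map, Proc.map, ChanRef.map, Msg.map], rfl,
      fun z => by simp [rhs, PRule.rhs, Judg.map, Proc.map_inst, Proc.map_rename h]⟩
  | plusR a L A k P =>
    have h : ∀ y ∈ P.fcn, f y = f a → y = a := fun y hy he =>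
      hf (by simp [PRule.lhs, Judg.names, Proc.fcn, hy])
        (by simp [PRule.lhs, Judg.names]) he
    exact ⟨.plusR (f a) L A k (P.map f),
      by simp [PRule.lhs, Judg.map, Proc.map, ChanRef.map], rfl,
      fun z => by simp [rhs, PRule.rhs, Judg.map, Msg.map, Proc.map_rename h]⟩
  | plusL a c d hac L k P =>
    have hP {y} (hy : y ∈ (P k).fcn) : y ∈ (Proc.caseL (free a) L P).fcn :=
      Finset.mem_union_right _ (Finset.mem_biUnion.2 ⟨k, Finset.mem_univ _, hy⟩)
    have h : ∀ y ∈ (P k).fcn, f y = f a → y = a := fun y hy he =>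
      hf (by simp [PRule.lhs, Judg.names, hP hy])
        (by simp [PRule.lhs, Judg.names]) he
    have hac' : f a ≠ f c := fun he => hac
      (hf (by simp [PRule.lhs, Judg.names]) (by simp [PRule.lhs, Judg.names]) he)
    exact ⟨.plusL (f a) (f c) (f d) hac' L k fun l => (P l).map f,
      by simp [PRule.lhs, Judg.map, Proc.map, ChanRef.map, Msg.map], rfl,
      fun z => by simp [rhs, PRule.rhs, Judg.map, Proc.map_rename h]⟩
  | ampR a d L k P =>
    have hP {y} (hy : y ∈ (P k).fcn) : y ∈ (Proc.caseL (free a) L P).fcn :=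
      Finset.mem_union_right _ (Finset.mem_biUnion.2 ⟨k, Finset.mem_univ _, hy⟩)
    have h : ∀ y ∈ (P k).fcn, f y = f a → y = a := fun y hy he =>
      hf (by simp [PRule.lhs, Judg.names, hP hy])
        (by simp [PRule.lhs, Judg.names]) he
    exact ⟨.ampR (f a) (f d) L k fun l => (P l).map f,
      by simp [PRule.lhs, Judg.map, Proc.map, ChanRef.map, Msg.map], rfl,
      fun z => by simp [rhs, PRule.rhs, Judg.map, Proc.map_rename h]⟩
  | ampL a c L A k P =>
    have h : ∀ y ∈ P.fcn, f y = f a → y = a := fun y hy he =>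
      hf (by simp [PRule.lhs, Judg.names, Proc.fcn, hy])
        (by simp [PRule.lhs, Judg.names]) he
    exact ⟨.ampL (f a) (f c) L A k (P.map f),
      by simp [PRule.lhs, Judg.map, Proc.map, ChanRef.map], rfl,
      fun z => by simp [rhs, PRule.rhs, Judg.map, Msg.map, Proc.map_rename h]⟩
  | muR a A P =>
    have h : ∀ y ∈ P.fcn, f y = f a → y = a := fun y hy he =>
      hf (by simp [PRule.lhs, Judg.names, Proc.fcn, hy])
        (by simp [PRule.lhs, Judg.names]) he
    exact ⟨.muR (f a) A (P.map f),
      by simp [PRule.lhs, Judg.map, Proc.map, ChanRef.map], rfl,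
      fun z => by simp [rhs, PRule.rhs, Judg.map, Msg.map, Proc.map_rename h]⟩
  | muL a c d P =>
    have h : ∀ y ∈ P.fcn, f y = f a → y = a := fun y hy he =>
      hf (by simp [PRule.lhs, Judg.names, Proc.fcn, hy])
        (by simp [PRule.lhs, Judg.names]) he
    exact ⟨.muL (f a) (f c) (f d) (P.map f),
      by simp [PRule.lhs, Judg.map, Proc.map, ChanRef.map, Msg.map], rfl,
      fun z => by simp [rhs, PRule.rhs, Judg.map, Proc.map_rename h]⟩
  | fix c P =>
    exact ⟨.fix (f c) (P.map f), by simp [PRule.lhs, Judg.map, Proc.map], rfl,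
      fun z => by simp [rhs, PRule.rhs, Judg.map, Proc.map_unfoldFix]⟩

/-- New types are those of the fresh channel. -/
theorem type_mem_rhs {r : PRule} {θ : PSub r} {b x : Chan} {A : SType}
    (h : type x A ∈ θ.rhs b) :
    type x A ∈ PRule.lhs r θ ∨ x = b ∧ ∀ A', type b A' ∈ θ.rhs b → type b A' ∉ PRule.lhs r θ →
      A' = A := by
  cases θ <;>
    simp only [rhs, PRule.rhs, PRule.lhs, Multiset.insert_eq_cons, Multiset.mem_cons,
      Multiset.mem_singleton, reduceCtorEq, type.injEq, false_or] at h ⊢ <;> grind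

end PSub

/-! ### Linearity of configurations -/

/-- The channels carried by a message. -/
def Msg.uses : Msg → Multiset Chan
  | .star => 0
  | .chan e d => {e, d}
  | .label _ d => {d}
  | .unfold d => {d}

/-- An ephemeral judgment together with the channels that it uses and provides: a process with a
typing derivation, or a message on a channel of positive or of negative type. -/
inductive Entry : Type
  | proc (c : Chan) (P : Proc) (Δ : Ctx) (C : SType)
  | pos (a : Chan) (m : Msg)
  | neg (a : Chan) (k : Label) (d : Chan)

namespace Entry

def judg : Entry → Judg
  | proc c P _ _ => .proc c P
  | pos a m => .msg a m
  | neg a k d => .msg a (.label k d)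

/-- The provided channel. -/
def prov : Entry → Chan
  | proc c _ _ _ => c
  | pos a _ => a
  | neg _ _ d => d

/-- The used channels. -/
def uses : Entry → Multiset Chan
  | proc _ _ Δ _ => Multiset.map Prod.fst Δ
  | pos _ m => m.uses
  | neg a _ _ => {a}

/-- The provided channel, unless it carries the message. -/
def unsentProv : Entry → Multiset Chan
  | proc c _ _ _ => {c}
  | pos _ _ => 0
  | neg _ _ d => {d}

/-- The used channels other than the one that carries the message. -/
def unsentUses : Entry → Multiset Chan
  | proc _ _ Δ _ => Multiset.map Prod.fst Δ
  | pos _ m => m.uses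
  | neg _ _ _ => 0

/-- An entry is well-typed when channels have the types given by `Ty`. -/
def WellTyped (Ty : Chan → SType → Prop) : Entry → Prop
  | proc c P Δ C => Typed [] Δ P c C ∧ Ty c C ∧ ∀ x ∈ Δ, Ty x.1 x.2
  | pos a .star => Ty a .one
  | pos a (.chan e d) => ∃ B A, Ty a (.tensor B A) ∧ Ty e B ∧ Ty d A
  | pos a (.label k d) => ∃ L A, ∃ h : k ∈ L, Ty a (.plus L A) ∧ Ty d (A ⟨k, h⟩)
  | pos a (.unfold d) => ∃ A, Ty a (.mu A) ∧ Ty d A.unfold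
  | neg a k d => ∃ L A, ∃ h : k ∈ L, Ty a (.amp L A) ∧ Ty d (A ⟨k, h⟩)

theorem WellTyped.mono {Ty Ty' : Chan → SType → Prop} (h : ∀ x A, Ty x A → Ty' x A) {e : Entry}
    (he : e.WellTyped Ty) : e.WellTyped Ty' := by
  rcases e with _ | ⟨a, _ | _ | _ | _⟩ | _ <;> simp only [WellTyped] at he ⊢ <;> grind

theorem WellTyped.fwd {Ty : Chan → SType → Prop} (hTy : ∀ x A A', Ty x A → Ty x A' → A = A')
    {a b : Chan} {m : Msg} {A : SType} (ha : Ty a A) (hb : Ty b A)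
    (h : (pos a m).WellTyped Ty) : (pos b m).WellTyped Ty := by
  cases m with
  | star =>
    cases hTy _ _ _ ha h
    exact hb
  | chan e d =>
    obtain ⟨B, A', h1, h2, h3⟩ := h
    exact ⟨B, A', hTy _ _ _ ha h1 ▸ hb, h2, h3⟩
  | label k d =>
    obtain ⟨L, A', hk, h1, h2⟩ := h
    exact ⟨L, A', hk, hTy _ _ _ ha h1 ▸ hb, h2⟩
  | unfold d =>
    obtain ⟨A', h1, h2⟩ := h
    exact ⟨A', hTy _ _ _ ha h1 ▸ hb, h2⟩

/-- Used channels have lower rank than the provided one. -/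
def Ranked (ρ : Chan → ℚ) (e : Entry) : Prop :=
  ∀ x ∈ e.uses, ρ x < ρ e.prov

theorem eq_proc {e : Entry} {c : Chan} {P : Proc} (h : e.judg = .proc c P) :
    ∃ Δ C, e = proc c P Δ C := by
  cases e <;> simp_all [judg]

theorem eq_msg {e : Entry} {a : Chan} {m : Msg} (h : e.judg = .msg a m) :
    e = pos a m ∨ ∃ k d, m = .label k d ∧ e = neg a k d := by
  cases e <;> simp_all [judg]

end Entry

/-! ### Computing ephemeral parts. -/

section Ephemeral

variable {M : Multiset Judg}

@[simp] theorem ephemeral_cons_proc (c : Chan) (P : Proc) :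
    ephemeral (.proc c P ::ₘ M) = .proc c P ::ₘ ephemeral M :=
  Multiset.filter_cons_of_pos _ id

@[simp] theorem ephemeral_cons_msg (c : Chan) (m : Msg) :
    ephemeral (.msg c m ::ₘ M) = .msg c m ::ₘ ephemeral M :=
  Multiset.filter_cons_of_pos _ id

@[simp] theorem ephemeral_cons_type (c : Chan) (A : SType) :
    ephemeral (.type c A ::ₘ M) = ephemeral M :=
  Multiset.filter_cons_of_neg _ fun h => h trivial

@[simp] theorem ephemeral_proc (c : Chan) (P : Proc) :
    ephemeral {.proc c P} = {.proc c P} :=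
  ephemeral_cons_proc c P (M := 0)

@[simp] theorem ephemeral_msg (c : Chan) (m : Msg) : ephemeral {.msg c m} = {.msg c m} :=
  ephemeral_cons_msg c m (M := 0)

@[simp] theorem ephemeral_type (c : Chan) (A : SType) : ephemeral {.type c A} = 0 :=
  ephemeral_cons_type c A (M := 0)

end Ephemeral

open Entry

/-- The entries `Enew` that replace `Eold` when the rule instance `θ` is applied. -/
structure LocalStep (Ty : Chan → SType → Prop) (ρ : Chan → ℚ) {r : PRule} (θ : PSub r) (b : Chan)
    (Eold Enew : Multiset Entry) : Prop where
  judg_eq : Enew.map judg = ephemeral (θ.rhs b)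
  wellTyped : ∀ e ∈ Enew, e.WellTyped fun x A => Ty x A ∨ .type x A ∈ θ.rhs b
  -- Provided channels come, with multiplicity, from old unsent ones or from `b`. The slack `s`
  -- holds the channels of consumed negative messages, which thereby lose their provider for good.
  -- The next field is the dual for used channels and positive messages.
  prov_le : ∃ s, Enew.map prov + s ≤ Eold.bind unsentProv + {b} ∧
    ∀ a k d, neg a k d ∈ Eold → a ∈ s
  uses_le : ∃ s, Enew.bind uses + s ≤ Eold.bind unsentUses + {b} ∧ ∀ a m, pos a m ∈ Eold → a ∈ s
  ranked : ∃ q, ∀ e ∈ Enew, e.Ranked (Function.update ρ b q)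
  -- The continuation of a new negative message is fresh, so no step has yet been counted for it.
  neg_eq : ∀ a k d, neg a k d ∈ Enew → d = b

/-- Ranks are rational so that a fresh channel can always be inserted below a provided channel and
above finitely many used ones, without changing other ranks. -/
theorem exists_between_multiset (s : Multiset ℚ) (r : ℚ) (h : ∀ x ∈ s, x < r) :
    ∃ q, (∀ x ∈ s, x < q) ∧ q < r := by
  induction s using Multiset.induction with
  | empty => exact ⟨r - 1, by simp, by linarith⟩
  | cons a s ih =>
    obtain ⟨q, h1, h2⟩ := ih fun x hx => h x (Multiset.mem_cons_of_mem hx)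
    obtain ⟨q', h3, h4⟩ := exists_between (max_lt h2 (h a (Multiset.mem_cons_self a s)))
    refine ⟨q', fun x hx => ?_, h4⟩
    rcases Multiset.mem_cons.1 hx with rfl | hx
    · exact (le_max_right _ _).trans_lt h3
    · exact (h1 x hx).trans ((le_max_left _ _).trans_lt h3)

theorem exists_rank_between (ρ : Chan → ℚ) (s : Multiset Chan) (c : Chan)
    (h : ∀ x ∈ s, ρ x < ρ c) : ∃ q, (∀ x ∈ s, ρ x < q) ∧ q < ρ c := by
  obtain ⟨q, h1, h2⟩ := exists_between_multiset (s.map ρ) (ρ c) (by simpa using h)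
  exact ⟨q, by simpa using h1, h2⟩

theorem eq_singleton_of_map_judg {E : Multiset Entry} {J : Judg} (h : E.map judg = {J}) :
    ∃ e, E = {e} ∧ e.judg = J := by
  obtain ⟨e, rfl, he⟩ := Multiset.map_eq_singleton.1 h
  exact ⟨e, rfl, he⟩

theorem eq_pair_of_map_judg {E : Multiset Entry} {J J' : Judg}
    (h : E.map judg = {J, J'}) : ∃ e e', E = {e, e'} ∧ e.judg = J ∧ e'.judg = J' := by
  classical
  obtain ⟨e, he, h1, h2⟩ := (Multiset.map_eq_cons _ _ _ _).2 h
  obtain ⟨e', h3, h4⟩ := eq_singleton_of_map_judg h2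
  exact ⟨e, e', by rw [← Multiset.cons_erase he, h3]; rfl, h1, h4⟩

/-! ### Preservation of typing, linearity and ranks, rule by rule. -/

section Steps

variable {Ty : Chan → SType → Prop} {ρ : Chan → ℚ} {b : Chan} {q : ℚ} {x y : Chan}

theorem update_lt_update (hx : b ≠ x) (hy : b ≠ y) (h : ρ x < ρ y) :
    Function.update ρ b q x < Function.update ρ b q y := by
  rwa [Function.update_of_ne hx.symm, Function.update_of_ne hy.symm]

theorem update_lt_update_self (hx : b ≠ x) (h : ρ x < q) :
    Function.update ρ b q x < Function.update ρ b q b := by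
  rwa [Function.update_of_ne hx.symm, Function.update_self]

theorem update_self_lt_update (hy : b ≠ y) (h : q < ρ y) :
    Function.update ρ b q b < Function.update ρ b q y := by
  rwa [Function.update_of_ne hy.symm, Function.update_self]

theorem Entry.Ranked.update {e : Entry} (h : e.Ranked ρ) (hb : b ≠ e.prov ∧ b ∉ e.uses) :
    e.Ranked (Function.update ρ b q) := fun x hx =>
  update_lt_update (fun hbx => hb.2 (hbx ▸ hx)) hb.1 (h x hx)

theorem exists_localStep_fwd {a c : Chan} {m : Msg} {Δ : Ctx} {C : SType}
    (hTy : ∀ x A A', Ty x A → Ty x A' → A = A') {e : Entry} (he : e.judg = .msg a m)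
    (hwt : e.WellTyped Ty)
    (hwt' : (Entry.proc c (.fwd (.free a) (.free c)) Δ C).WellTyped Ty)
    (hρ : e.Ranked ρ) (hρ' : (Entry.proc c (.fwd (.free a) (.free c)) Δ C).Ranked ρ) :
    ∃ E', LocalStep Ty ρ (PSub.fwd a c m) b {e, .proc c (.fwd (.free a) (.free c)) Δ C} E' := by
  obtain ⟨hT, hc, hΔ⟩ := hwt'
  cases hT with
  | fwd hA =>
    simp only [Multiset.mem_singleton, forall_eq] at hΔ
    rcases eq_msg he with rfl | ⟨k, d, rfl, rfl⟩
    -- Forwarding generates no channel, and the value `ρ b` leaves the rank unchanged. What `m`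
    -- carries ranks below `a`, hence below `c`.
    · refine ⟨{pos c m}, ?_, ?_, ⟨0, ?_, ?_⟩, ⟨{a}, ?_, ?_⟩, ⟨ρ b, ?_⟩, ?_⟩
      · simp [PSub.rhs, PRule.rhs, judg]
      · simp only [Multiset.mem_singleton, forall_eq]
        exact (WellTyped.fwd hTy hΔ hc hwt).mono fun x A h => .inl h
      · refine Multiset.le_iff_count.2 fun z => ?_
        simp [unsentProv, prov, Multiset.count_singleton, Multiset.count_cons]
      · simp
      · refine Multiset.le_iff_count.2 fun z => ?_
        simp [unsentUses, Entry.uses]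
      · simp
      · simp only [Multiset.mem_singleton, forall_eq, Function.update_eq_self]
        exact fun x hx => (hρ x hx).trans (hρ' a (by simp [Entry.uses]))
      · simp
    -- A negative message would give `a` a negative type, but forwarding is typed at positive types
    -- only.
    · obtain ⟨L, A', hk, h1, h2⟩ := hwt
      cases hTy _ _ _ h1 hΔ
      exact hA.elim

theorem exists_localStep_cut {c : Chan} {A C : SType} {P Q : Proc} {Δ : Ctx}
    (hwt : (Entry.proc c (.cut A P Q) Δ C).WellTyped Ty)
    (hρ : (Entry.proc c (.cut A P Q) Δ C).Ranked ρ)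
    (hb : b ≠ c ∧ b ∉ Multiset.map Prod.fst Δ) :
    ∃ E', LocalStep Ty ρ (PSub.cut c A P Q) b {.proc c (.cut A P Q) Δ C} E' := by
  obtain ⟨hT, hc, hΔ⟩ := hwt
  cases hT with
  | @cut _ Δ₁ Δ₂ _ _ _ _ _ S hP hQ =>
    simp only [Multiset.map_add, Multiset.mem_add, not_or] at hb
    simp only [Ranked, Entry.uses, prov, Multiset.map_add, Multiset.mem_add] at hρ
    -- The new channel is provided from `Δ₁` and used by the provider of `c`, so its rank goes in
    -- between.
    obtain ⟨q, hq, hqc⟩ := exists_rank_between ρ (Multiset.map Prod.fst Δ₁) c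
      fun x hx => hρ x (.inl hx)
    refine ⟨{.proc b (P.inst b) Δ₁ A, .proc c (Q.inst b) ((b, A) ::ₘ Δ₂) C}, ?_, ?_,
      ⟨0, ?_, ?_⟩, ⟨0, ?_, ?_⟩, ⟨q, ?_⟩, ?_⟩
    · simp [PSub.rhs, PRule.rhs, judg]
    · simp only [Multiset.insert_eq_cons, Multiset.mem_cons, Multiset.mem_singleton,
        forall_eq_or_imp, forall_eq, WellTyped, PSub.rhs, PRule.rhs, Judg.type.injEq,
        reduceCtorEq, false_or]
      refine ⟨⟨.inst_provider_of_cofinite hP b, .inr (by simp), fun x hx => .inl ?_⟩,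
        .inst_of_cofinite hQ b, .inl hc, .inr (by simp), fun x hx => .inl ?_⟩
      · exact hΔ x (Multiset.mem_add.2 (.inl hx))
      · exact hΔ x (Multiset.mem_add.2 (.inr hx))
    · refine Multiset.le_iff_count.2 fun z => ?_
      simp only [Multiset.insert_eq_cons, Multiset.map_cons, Multiset.map_singleton, prov,
        Multiset.singleton_bind, unsentProv, Multiset.count_add, Multiset.count_cons,
        Multiset.count_singleton, Multiset.count_zero]
      omega
    · simp
    · refine Multiset.le_iff_count.2 fun z => ?_
      simp only [Multiset.insert_eq_cons, Multiset.map_cons, Multiset.cons_bind, Entry.uses,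
        Multiset.singleton_bind, unsentUses, Multiset.count_add, Multiset.count_cons,
        Multiset.count_singleton, Multiset.count_zero, Multiset.map_add]
      omega
    · simp
    · simp only [Multiset.insert_eq_cons, Multiset.mem_cons, Multiset.mem_singleton,
        forall_eq_or_imp, forall_eq, Ranked, Entry.uses, prov, Multiset.map_cons]
      exact ⟨fun x hx => update_lt_update_self (fun h => hb.2.1 (h ▸ hx)) (hq x hx),
        update_self_lt_update hb.1 hqc,
        fun x hx => update_lt_update (fun h => hb.2.2 (h ▸ hx)) hb.1 (hρ x (.inr hx))⟩
    · simp

theorem exists_localStep_oneR {a : Chan} {Δ : Ctx} {C : SType}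
    (hwt : (Entry.proc a (.close (.free a)) Δ C).WellTyped Ty) :
    ∃ E', LocalStep Ty ρ (PSub.oneR a) b {.proc a (.close (.free a)) Δ C} E' := by
  obtain ⟨hT, hc, hΔ⟩ := hwt
  cases hT with
  | oneR =>
    refine ⟨{pos a .star}, ?_, ?_, ⟨0, ?_, ?_⟩, ⟨0, ?_, ?_⟩, ⟨0, ?_⟩, ?_⟩
    · simp [PSub.rhs, PRule.rhs, judg]
    · simp only [Multiset.mem_singleton, forall_eq, WellTyped]
      exact .inl hc
    · refine Multiset.le_iff_count.2 fun z => ?_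
      simp [unsentProv, prov, Multiset.count_cons, Multiset.count_singleton]
    · simp
    · simp [Entry.uses, Msg.uses]
    · simp
    · simp [Ranked, Entry.uses, Msg.uses]
    · simp

theorem exists_localStep_oneL {a c : Chan} {P : Proc} {Δ : Ctx} {C : SType} {e : Entry}
    (he : e.judg = .msg a .star)
    (hwt : (Entry.proc c (.wait (.free a) P) Δ C).WellTyped Ty)
    (hρ : (Entry.proc c (.wait (.free a) P) Δ C).Ranked ρ)
    (hb : b ≠ c ∧ b ∉ Multiset.map Prod.fst Δ) :
    ∃ E', LocalStep Ty ρ (PSub.oneL a c P) b {e, .proc c (.wait (.free a) P) Δ C} E' := by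
  obtain ⟨hT, hc, hΔ⟩ := hwt
  obtain rfl | ⟨_, _, h, _⟩ := eq_msg he
  swap
  · cases h
  cases hT with
  | @oneL _ Δ _ _ _ _ hP =>
    simp only [Multiset.map_cons, Multiset.mem_cons, not_or] at hb
    refine ⟨{.proc c P Δ C}, ?_, ?_, ⟨0, ?_, ?_⟩, ⟨{a}, ?_, ?_⟩, ⟨0, ?_⟩, ?_⟩
    · simp [PSub.rhs, PRule.rhs, judg]
    · simp only [Multiset.mem_singleton, forall_eq, WellTyped]
      exact ⟨hP, .inl hc, fun x hx => .inl (hΔ x (Multiset.mem_cons_of_mem hx))⟩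
    · refine Multiset.le_iff_count.2 fun z => ?_
      simp [unsentProv, prov, Multiset.count_cons, Multiset.count_singleton]
    · simp
    · refine Multiset.le_iff_count.2 fun z => ?_
      simp only [Multiset.insert_eq_cons, Multiset.map_cons, Multiset.cons_bind, Entry.uses,
        Multiset.singleton_bind, unsentUses, Multiset.count_add, Multiset.count_cons,
        Multiset.count_singleton, Msg.uses, Multiset.count_zero]
      omega
    · simp
    · simp only [Multiset.mem_singleton, forall_eq, Ranked, Entry.uses, prov]
      exact fun x hx => update_lt_update (fun h => hb.2.2 (h ▸ hx)) hb.1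
        (hρ x (by simp only [Entry.uses, Multiset.map_cons]; exact Multiset.mem_cons_of_mem hx))
    · simp

theorem exists_localStep_tensorR {a c : Chan} {P : Proc} {A B C : SType} {Δ : Ctx}
    (hTy : ∀ x A A', Ty x A → Ty x A' → A = A') (hlhs : Ty a (.tensor B A))
    (hwt : (Entry.proc a (.sendC (.free a) (.free c) P) Δ C).WellTyped Ty)
    (hρ : (Entry.proc a (.sendC (.free a) (.free c) P) Δ C).Ranked ρ)
    (hb : b ≠ a ∧ b ∉ Multiset.map Prod.fst Δ) :
    ∃ E', LocalStep Ty ρ (PSub.tensorR a c P B A) b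
      {.proc a (.sendC (.free a) (.free c) P) Δ C} E' := by
  obtain ⟨hT, hc, hΔ⟩ := hwt
  cases hT with
  | @tensorR _ Δ _ _ A' B' _ hP =>
    cases hTy _ _ _ hlhs hc
    simp only [Multiset.map_cons, Multiset.mem_cons, not_or] at hb
    simp only [Ranked, Entry.uses, prov, Multiset.map_cons, Multiset.mem_cons, forall_eq_or_imp]
      at hρ
    -- The continuation is provided from `Δ` and carried by the message on `a`.
    obtain ⟨q, hq, hqc⟩ := exists_rank_between ρ (Multiset.map Prod.fst Δ) a hρ.2
    refine ⟨{pos a (.chan c b), .proc b (P.rename b a) Δ A}, ?_, ?_, ⟨0, ?_, ?_⟩, ⟨0, ?_, ?_⟩,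
      ⟨q, ?_⟩, ?_⟩
    · simp [PSub.rhs, PRule.rhs, judg, Multiset.cons_swap, Multiset.insert_eq_cons]
    · simp only [Multiset.insert_eq_cons, Multiset.mem_cons, Multiset.mem_singleton,
        forall_eq_or_imp, forall_eq, WellTyped, PSub.rhs, PRule.rhs, Judg.type.injEq,
        reduceCtorEq, false_or]
      refine ⟨⟨B, A, .inl hc, .inl (hΔ _ (Multiset.mem_cons_self _ _)),
        .inr (by simp)⟩, hP.rename_provider b fun x hx hxa => ?_,
        .inr (by simp), fun x hx => .inl (hΔ x (Multiset.mem_cons_of_mem hx))⟩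
      exact lt_irrefl _ (hρ.2 a (Multiset.mem_map.2 ⟨x, hx, hxa⟩))
    · refine Multiset.le_iff_count.2 fun z => ?_
      simp only [Multiset.insert_eq_cons, Multiset.map_cons, Multiset.map_singleton, prov,
        Multiset.singleton_bind, unsentProv, Multiset.count_add, Multiset.count_cons,
        Multiset.count_singleton, Multiset.count_zero]
      omega
    · simp
    · refine Multiset.le_iff_count.2 fun z => ?_
      simp only [Multiset.insert_eq_cons, Multiset.map_cons, Multiset.cons_bind, Entry.uses,
        Multiset.singleton_bind, unsentUses, Multiset.count_add, Multiset.count_cons,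
        Multiset.count_singleton, Multiset.count_zero, Msg.uses]
      omega
    · simp
    · simp only [Multiset.insert_eq_cons, Multiset.mem_cons, Multiset.mem_singleton,
        forall_eq_or_imp, forall_eq, Ranked, Entry.uses, prov, Msg.uses]
      exact ⟨⟨update_lt_update hb.2.1 hb.1 hρ.1, update_self_lt_update hb.1 hqc⟩,
        fun x hx => update_lt_update_self (fun h => hb.2.2 (h ▸ hx)) (hq x hx)⟩
    · simp

theorem exists_localStep_tensorL {a c e d : Chan} {P : Proc} {C : SType} {Δ : Ctx} {e₀ : Entry}
    (hTy : ∀ x A A', Ty x A → Ty x A' → A = A') (he : e₀.judg = .msg a (.chan e d))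
    (hwt₀ : e₀.WellTyped Ty) (hρ₀ : e₀.Ranked ρ) (hb₀ : b ∉ e₀.uses)
    (hwt : (Entry.proc c (.recvC (.free a) P) Δ C).WellTyped Ty)
    (hρ : (Entry.proc c (.recvC (.free a) P) Δ C).Ranked ρ)
    (hb : b ≠ c ∧ b ∉ Multiset.map Prod.fst Δ) (hu : (Multiset.map Prod.fst Δ).Nodup) :
    ∃ E', LocalStep Ty ρ (PSub.tensorL a c e d P) b
      {e₀, .proc c (.recvC (.free a) P) Δ C} E' := by
  obtain ⟨hT, hc, hΔ⟩ := hwt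
  obtain rfl | ⟨_, _, h, _⟩ := eq_msg he
  swap
  · cases h
  cases hT with
  | @tensorL _ Δ _ A B _ _ _ S hP =>
    simp only [Multiset.map_cons, Multiset.mem_cons, not_or] at hb
    simp only [Multiset.map_cons, Multiset.nodup_cons] at hu
    simp only [Ranked, Entry.uses, prov, Multiset.map_cons, Multiset.mem_cons, forall_eq_or_imp]
      at hρ
    simp only [Ranked, Entry.uses, prov, Msg.uses, Multiset.insert_eq_cons, Multiset.mem_cons,
      Multiset.mem_singleton, forall_eq_or_imp, forall_eq] at hρ₀
    simp only [Entry.uses, Msg.uses, Multiset.insert_eq_cons, Multiset.mem_cons,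
      Multiset.mem_singleton, not_or] at hb₀
    obtain ⟨B', A', h1, h2, h3⟩ := hwt₀
    cases hTy _ _ _ h1 (hΔ _ (Multiset.mem_cons_self _ _))
    -- The renaming of `a` is done at a generic name of the bound channel, which differs from `a`;
    -- only then is the received channel `e` put in.
    have hP' : ∀ x ∉ insert a S, Typed [] ((x, B) ::ₘ (d, A) ::ₘ Δ)
        ((P.rename d a).inst x) c C := by
      intro x hx
      simp only [Finset.mem_insert, not_or] at hx
      have := hP x hx.2
      rw [Multiset.cons_swap] at this
      rw [← Proc.rename_inst hx.1, Multiset.cons_swap]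
      refine this.rename_client d (fun h => ?_) fun y hy hya => ?_
      · subst h
        exact lt_irrefl _ hρ.1
      · rcases Multiset.mem_cons.1 hy with rfl | hy
        · exact hx.1 hya
        · exact hu.1 (Multiset.mem_map.2 ⟨y, hy, hya⟩)
    refine ⟨{.proc c ((P.rename d a).inst e) ((e, B) ::ₘ (d, A) ::ₘ Δ) C}, ?_, ?_, ⟨0, ?_, ?_⟩,
      ⟨{a}, ?_, ?_⟩, ⟨0, ?_⟩, ?_⟩
    · simp [PSub.rhs, PRule.rhs, judg]
    · simp only [Multiset.mem_singleton, forall_eq, WellTyped, Multiset.mem_cons,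
        forall_eq_or_imp]
      exact ⟨.inst_of_cofinite hP' e, .inl hc, .inl h2, .inl h3,
        fun x hx => .inl (hΔ x (Multiset.mem_cons_of_mem hx))⟩
    · refine Multiset.le_iff_count.2 fun z => ?_
      simp [unsentProv, prov, Multiset.count_cons, Multiset.count_singleton]
    · simp
    · refine Multiset.le_iff_count.2 fun z => ?_
      simp only [Multiset.insert_eq_cons, Multiset.map_cons, Multiset.cons_bind, Entry.uses,
        Multiset.singleton_bind, unsentUses, Multiset.count_add, Multiset.count_cons,
        Multiset.count_singleton, Msg.uses]
      omega
    · simp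
    · simp only [Multiset.mem_singleton, forall_eq, Ranked, Entry.uses, prov, Multiset.map_cons,
        Multiset.mem_cons, forall_eq_or_imp]
      exact ⟨update_lt_update hb₀.1 hb.1 (hρ₀.1.trans hρ.1),
        update_lt_update hb₀.2 hb.1 (hρ₀.2.trans hρ.1),
        fun x hx => update_lt_update (fun h => hb.2.2 (h ▸ hx)) hb.1 (hρ.2 x hx)⟩
    · simp

theorem exists_localStep_plusR {a : Chan} {L : Finset Label} {A : {l // l ∈ L} → SType}
    {k : {l // l ∈ L}} {P : Proc} {C : SType} {Δ : Ctx}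
    (hTy : ∀ x A A', Ty x A → Ty x A' → A = A') (hlhs : Ty a (.plus L A))
    (hwt : (Entry.proc a (.sendL (.free a) k P) Δ C).WellTyped Ty)
    (hρ : (Entry.proc a (.sendL (.free a) k P) Δ C).Ranked ρ)
    (hb : b ≠ a ∧ b ∉ Multiset.map Prod.fst Δ) :
    ∃ E', LocalStep Ty ρ (PSub.plusR a L A k P) b
      {.proc a (.sendL (.free a) k P) Δ C} E' := by
  obtain ⟨hT, hc, hΔ⟩ := hwt
  simp only [Ranked, Entry.uses, prov] at hρ
  generalize hk : (k : Label) = k₀ at hT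
  cases hT with
  | @plusR _ _ _ L' A' k' _ hP =>
    cases hTy _ _ _ hlhs hc
    cases Subtype.ext hk
    obtain ⟨q, hq, hqc⟩ := exists_rank_between ρ (Multiset.map Prod.fst Δ) a hρ
    refine ⟨{pos a (.label k b), .proc b (P.rename b a) Δ (A k)}, ?_, ?_, ⟨0, ?_, ?_⟩,
      ⟨0, ?_, ?_⟩, ⟨q, ?_⟩, ?_⟩
    · simp [PSub.rhs, PRule.rhs, judg]
    · simp only [Multiset.insert_eq_cons, Multiset.mem_cons, Multiset.mem_singleton,
        forall_eq_or_imp, forall_eq, WellTyped, PSub.rhs, PRule.rhs, Judg.type.injEq,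
        reduceCtorEq, false_or]
      refine ⟨⟨L, A, k.2, .inl hc, .inr (by simp)⟩,
        hP.rename_provider b fun x hx hxa => ?_,
        .inr (by simp), fun x hx => .inl (hΔ x hx)⟩
      exact lt_irrefl _ (hρ a (Multiset.mem_map.2 ⟨x, hx, hxa⟩))
    · refine Multiset.le_iff_count.2 fun z => ?_
      simp only [Multiset.insert_eq_cons, Multiset.map_cons, Multiset.map_singleton, prov,
        Multiset.singleton_bind, unsentProv, Multiset.count_add, Multiset.count_cons,
        Multiset.count_singleton, Multiset.count_zero]
      omega
    · simp
    · refine Multiset.le_iff_count.2 fun z => ?_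
      simp only [Multiset.insert_eq_cons, Multiset.cons_bind, Entry.uses,
        Multiset.singleton_bind, unsentUses, Multiset.count_add,
        Multiset.count_singleton, Multiset.count_zero, Msg.uses]
      omega
    · simp
    · simp only [Multiset.insert_eq_cons, Multiset.mem_cons, Multiset.mem_singleton,
        forall_eq_or_imp, forall_eq, Ranked, Entry.uses, prov, Msg.uses]
      exact ⟨update_self_lt_update hb.1 hqc,
        fun x hx => update_lt_update_self (fun h => hb.2 (h ▸ hx)) (hq x hx)⟩
    · simp
  -- Typing alone would allow a process to use the channel that it provides; the rank excludes it.
  | ampL k' hP => exact absurd (hρ a (by simp)) (lt_irrefl _)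

theorem exists_localStep_plusL {a c d : Chan} (hac : a ≠ c) {L : Finset Label}
    {k : {l // l ∈ L}} {P : {l // l ∈ L} → Proc} {C : SType} {Δ : Ctx} {e : Entry}
    (hTy : ∀ x A A', Ty x A → Ty x A' → A = A') (he : e.judg = .msg a (.label k d))
    (hwt₀ : e.WellTyped Ty) (hρ₀ : e.Ranked ρ) (hb₀ : b ∉ e.uses)
    (hwt : (Entry.proc c (.caseL (.free a) L P) Δ C).WellTyped Ty)
    (hρ : (Entry.proc c (.caseL (.free a) L P) Δ C).Ranked ρ)
    (hb : b ≠ c ∧ b ∉ Multiset.map Prod.fst Δ) (hu : (Multiset.map Prod.fst Δ).Nodup) :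
    ∃ E', LocalStep Ty ρ (PSub.plusL a c d hac L k P) b
      {e, .proc c (.caseL (.free a) L P) Δ C} E' := by
  obtain ⟨hT, hc, hΔ⟩ := hwt
  cases hT with
  | ampR => exact absurd rfl hac
  | @plusL _ Δ _ _ A _ _ _ hP =>
    have ha := hΔ _ (Multiset.mem_cons_self _ _)
    obtain rfl | ⟨k', d', hk', rfl⟩ := eq_msg he
    swap
    · obtain ⟨L', A', h1, h2, h3⟩ := hwt₀
      cases hTy _ _ _ h2 ha
    obtain ⟨L', A', h1, h2, h3⟩ := hwt₀
    cases hTy _ _ _ h2 ha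
    simp only [Multiset.map_cons, Multiset.mem_cons, not_or] at hb
    simp only [Multiset.map_cons, Multiset.nodup_cons] at hu
    simp only [Ranked, Entry.uses, prov, Multiset.map_cons, Multiset.mem_cons, forall_eq_or_imp]
      at hρ
    simp only [Ranked, Entry.uses, prov, Msg.uses, Multiset.mem_singleton, forall_eq] at hρ₀
    simp only [Entry.uses, Msg.uses, Multiset.mem_singleton] at hb₀
    refine ⟨{.proc c ((P k).rename d a) ((d, A k) ::ₘ Δ) C}, ?_, ?_, ⟨0, ?_, ?_⟩,
      ⟨{a}, ?_, ?_⟩, ⟨0, ?_⟩, ?_⟩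
    · simp [PSub.rhs, PRule.rhs, judg]
    · simp only [Multiset.mem_singleton, forall_eq, WellTyped, Multiset.mem_cons,
        forall_eq_or_imp]
      exact ⟨(hP k).rename_client d hac.symm fun y hy hya =>
        hu.1 (Multiset.mem_map.2 ⟨y, hy, hya⟩), .inl hc, .inl h3,
        fun x hx => .inl (hΔ x (Multiset.mem_cons_of_mem hx))⟩
    · refine Multiset.le_iff_count.2 fun z => ?_
      simp [unsentProv, prov, Multiset.count_cons, Multiset.count_singleton]
    · simp
    · refine Multiset.le_iff_count.2 fun z => ?_
      simp only [Multiset.insert_eq_cons, Multiset.map_cons, Multiset.cons_bind, Entry.uses,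
        Multiset.singleton_bind, unsentUses, Multiset.count_add, Multiset.count_cons,
        Multiset.count_singleton, Msg.uses]
      omega
    · simp
    · simp only [Multiset.mem_singleton, forall_eq, Ranked, Entry.uses, prov, Multiset.map_cons,
        Multiset.mem_cons, forall_eq_or_imp]
      exact ⟨update_lt_update hb₀ hb.1 (hρ₀.trans hρ.1),
        fun x hx => update_lt_update (fun h => hb.2.2 (h ▸ hx)) hb.1 (hρ.2 x hx)⟩
    · simp

/-- Here a process moves to a provided channel `d` that is not fresh: `d` was provided by the
negative message. The channel `a` loses its provider and goes into the slack. -/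
theorem exists_localStep_ampR {a d : Chan} {L : Finset Label}
    {k : {l // l ∈ L}} {P : {l // l ∈ L} → Proc} {C : SType} {Δ : Ctx} {e : Entry}
    (hTy : ∀ x A A', Ty x A → Ty x A' → A = A') (he : e.judg = .msg a (.label k d))
    (hwt₀ : e.WellTyped Ty) (hρ₀ : e.Ranked ρ) (hb₀ : b ≠ e.prov)
    (hwt : (Entry.proc a (.caseL (.free a) L P) Δ C).WellTyped Ty)
    (hρ : (Entry.proc a (.caseL (.free a) L P) Δ C).Ranked ρ)
    (hb : b ≠ a ∧ b ∉ Multiset.map Prod.fst Δ) :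
    ∃ E', LocalStep Ty ρ (PSub.ampR a d L k P) b
      {e, .proc a (.caseL (.free a) L P) Δ C} E' := by
  obtain ⟨hT, hc, hΔ⟩ := hwt
  simp only [Ranked, Entry.uses, prov] at hρ
  cases hT with
  | plusL hP => exact absurd (hρ a (by simp)) (lt_irrefl _)
  | @ampR _ _ _ _ A _ hP =>
    obtain rfl | ⟨k', d', hk', rfl⟩ := eq_msg he
    · obtain ⟨L', A', h1, h2, h3⟩ := hwt₀
      cases hTy _ _ _ h2 hc
    simp only [Msg.label.injEq] at hk'
    obtain ⟨rfl, rfl⟩ := hk'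
    obtain ⟨L', A', h1, h2, h3⟩ := hwt₀
    cases hTy _ _ _ h2 hc
    simp only [Ranked, Entry.uses, prov, Multiset.mem_singleton, forall_eq] at hρ₀
    refine ⟨{.proc d ((P k).rename d a) Δ (A k)}, ?_, ?_, ⟨{a}, ?_, ?_⟩,
      ⟨0, ?_, ?_⟩, ⟨0, ?_⟩, ?_⟩
    · simp [PSub.rhs, PRule.rhs, judg]
    · simp only [Multiset.mem_singleton, forall_eq, WellTyped]
      exact ⟨(hP k).rename_provider d fun y hy hya =>
        lt_irrefl _ (hρ a (Multiset.mem_map.2 ⟨y, hy, hya⟩)), .inl h3,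
        fun x hx => .inl (hΔ x hx)⟩
    · refine Multiset.le_iff_count.2 fun z => ?_
      simp only [Multiset.insert_eq_cons, Multiset.map_singleton, prov, Multiset.cons_bind,
        Multiset.singleton_bind, unsentProv, Multiset.count_add, Multiset.count_singleton]
      omega
    · simp +contextual
    · refine Multiset.le_iff_count.2 fun z => ?_
      simp only [Multiset.insert_eq_cons, Multiset.cons_bind, Entry.uses,
        Multiset.singleton_bind, unsentUses, Multiset.count_add, Multiset.count_zero]
      omega
    · simp
    · simp only [Multiset.mem_singleton, forall_eq, Ranked, Entry.uses, prov]
      exact fun x hx => update_lt_update (fun h => hb.2 (h ▸ hx)) hb₀ ((hρ x hx).trans hρ₀)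
    · simp

theorem exists_localStep_ampL {a c : Chan} {L : Finset Label} {A : {l // l ∈ L} → SType}
    {k : {l // l ∈ L}} {P : Proc} {C : SType} {Δ : Ctx}
    (hTy : ∀ x A A', Ty x A → Ty x A' → A = A') (hlhs : Ty a (.amp L A))
    (hwt : (Entry.proc c (.sendL (.free a) k P) Δ C).WellTyped Ty)
    (hρ : (Entry.proc c (.sendL (.free a) k P) Δ C).Ranked ρ)
    (hb : b ≠ c ∧ b ∉ Multiset.map Prod.fst Δ) (hu : (Multiset.map Prod.fst Δ).Nodup) :
    ∃ E', LocalStep Ty ρ (PSub.ampL a c L A k P) b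
      {.proc c (.sendL (.free a) k P) Δ C} E' := by
  obtain ⟨hT, hc, hΔ⟩ := hwt
  generalize hk : (k : Label) = k₀ at hT
  cases hT with
  | plusR k' hP => cases hTy _ _ _ hlhs hc
  | @ampL _ Δ _ L' A' k' _ _ _ hP =>
    have ha := hΔ _ (Multiset.mem_cons_self _ _)
    cases hTy _ _ _ hlhs ha
    cases Subtype.ext hk
    simp only [Multiset.map_cons, Multiset.mem_cons, not_or] at hb
    simp only [Multiset.map_cons, Multiset.nodup_cons] at hu
    simp only [Ranked, Entry.uses, prov, Multiset.map_cons, Multiset.mem_cons, forall_eq_or_imp]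
      at hρ
    -- The negative message uses `a` and provides `b`, and the provider of `c` uses `b`: the rank of
    -- `b` lies between those of `a` and `c`.
    obtain ⟨q, hq, hqc⟩ := exists_between hρ.1
    have hca : c ≠ a := fun h => lt_irrefl _ (h ▸ hρ.1)
    refine ⟨{neg a k b, .proc c (P.rename b a) ((b, A k) ::ₘ Δ) C}, ?_, ?_, ⟨0, ?_, ?_⟩,
      ⟨0, ?_, ?_⟩, ⟨q, ?_⟩, ?_⟩
    · simp [PSub.rhs, PRule.rhs, judg]
    · simp only [Multiset.insert_eq_cons, Multiset.mem_cons, Multiset.mem_singleton,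
        forall_eq_or_imp, forall_eq, WellTyped, PSub.rhs, PRule.rhs, Judg.type.injEq,
        reduceCtorEq, false_or]
      exact ⟨⟨L, A, k.2, .inl ha, .inr (by simp)⟩,
        hP.rename_client b hca fun x hx hxa => hu.1 (Multiset.mem_map.2 ⟨x, hx, hxa⟩),
        .inl hc, .inr (by simp),
        fun x hx => .inl (hΔ x (Multiset.mem_cons_of_mem hx))⟩
    · refine Multiset.le_iff_count.2 fun z => ?_
      simp only [Multiset.insert_eq_cons, Multiset.map_cons, Multiset.map_singleton, prov,
        Multiset.singleton_bind, unsentProv, Multiset.count_add, Multiset.count_cons,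
        Multiset.count_singleton, Multiset.count_zero]
      omega
    · simp
    · refine Multiset.le_iff_count.2 fun z => ?_
      simp only [Multiset.insert_eq_cons, Multiset.cons_bind, Entry.uses, Multiset.map_cons,
        Multiset.singleton_bind, unsentUses, Multiset.count_add, Multiset.count_cons,
        Multiset.count_singleton, Multiset.count_zero]
      omega
    · simp
    · simp only [Multiset.insert_eq_cons, Multiset.mem_cons, Multiset.mem_singleton,
        forall_eq_or_imp, forall_eq, Ranked, Entry.uses, prov, Multiset.map_cons]
      exact ⟨update_lt_update_self hb.2.1 hq, update_self_lt_update hb.1 hqc,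
        fun x hx => update_lt_update (fun h => hb.2.2 (h ▸ hx)) hb.1 (hρ.2 x hx)⟩
    · simp

theorem exists_localStep_muR {a : Chan} {A : _root_.Ty 1} {P : Proc} {C : SType} {Δ : Ctx}
    (hTy : ∀ x A A', Ty x A → Ty x A' → A = A') (hlhs : Ty a (.mu A))
    (hwt : (Entry.proc a (.sendU (.free a) P) Δ C).WellTyped Ty)
    (hρ : (Entry.proc a (.sendU (.free a) P) Δ C).Ranked ρ)
    (hb : b ≠ a ∧ b ∉ Multiset.map Prod.fst Δ) :
    ∃ E', LocalStep Ty ρ (PSub.muR a A P) b {.proc a (.sendU (.free a) P) Δ C} E' := by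
  obtain ⟨hT, hc, hΔ⟩ := hwt
  simp only [Ranked, Entry.uses, prov] at hρ
  cases hT with
  | @muR _ _ _ A' _ hP =>
    cases hTy _ _ _ hlhs hc
    obtain ⟨q, hq, hqc⟩ := exists_rank_between ρ (Multiset.map Prod.fst Δ) a hρ
    refine ⟨{pos a (.unfold b), .proc b (P.rename b a) Δ A.unfold}, ?_, ?_, ⟨0, ?_, ?_⟩,
      ⟨0, ?_, ?_⟩, ⟨q, ?_⟩, ?_⟩
    · simp [PSub.rhs, PRule.rhs, judg]
    · simp only [Multiset.insert_eq_cons, Multiset.mem_cons, Multiset.mem_singleton,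
        forall_eq_or_imp, forall_eq, WellTyped, PSub.rhs, PRule.rhs, Judg.type.injEq,
        reduceCtorEq, false_or]
      refine ⟨⟨A, .inl hc, .inr (by simp)⟩,
        hP.rename_provider b fun x hx hxa => ?_,
        .inr (by simp), fun x hx => .inl (hΔ x hx)⟩
      exact lt_irrefl _ (hρ a (Multiset.mem_map.2 ⟨x, hx, hxa⟩))
    · refine Multiset.le_iff_count.2 fun z => ?_
      simp only [Multiset.insert_eq_cons, Multiset.map_cons, Multiset.map_singleton, prov,
        Multiset.singleton_bind, unsentProv, Multiset.count_add, Multiset.count_cons,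
        Multiset.count_singleton, Multiset.count_zero]
      omega
    · simp
    · refine Multiset.le_iff_count.2 fun z => ?_
      simp only [Multiset.insert_eq_cons, Multiset.cons_bind, Entry.uses,
        Multiset.singleton_bind, unsentUses, Multiset.count_add,
        Multiset.count_singleton, Multiset.count_zero, Msg.uses]
      omega
    · simp
    · simp only [Multiset.insert_eq_cons, Multiset.mem_cons, Multiset.mem_singleton,
        forall_eq_or_imp, forall_eq, Ranked, Entry.uses, prov, Msg.uses]
      exact ⟨update_self_lt_update hb.1 hqc,
        fun x hx => update_lt_update_self (fun h => hb.2 (h ▸ hx)) (hq x hx)⟩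
    · simp

theorem exists_localStep_muL {a c d : Chan} {P : Proc} {C : SType} {Δ : Ctx} {e : Entry}
    (hTy : ∀ x A A', Ty x A → Ty x A' → A = A') (he : e.judg = .msg a (.unfold d))
    (hwt₀ : e.WellTyped Ty) (hρ₀ : e.Ranked ρ) (hb₀ : b ∉ e.uses)
    (hwt : (Entry.proc c (.recvU (.free a) P) Δ C).WellTyped Ty)
    (hρ : (Entry.proc c (.recvU (.free a) P) Δ C).Ranked ρ)
    (hb : b ≠ c ∧ b ∉ Multiset.map Prod.fst Δ) (hu : (Multiset.map Prod.fst Δ).Nodup) :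
    ∃ E', LocalStep Ty ρ (PSub.muL a c d P) b {e, .proc c (.recvU (.free a) P) Δ C} E' := by
  obtain ⟨hT, hc, hΔ⟩ := hwt
  obtain rfl | ⟨_, _, h, _⟩ := eq_msg he
  swap
  · cases h
  cases hT with
  | @muL _ Δ _ A _ _ _ hP =>
    obtain ⟨A', h1, h2⟩ := hwt₀
    cases hTy _ _ _ h1 (hΔ _ (Multiset.mem_cons_self _ _))
    simp only [Multiset.map_cons, Multiset.mem_cons, not_or] at hb
    simp only [Multiset.map_cons, Multiset.nodup_cons] at hu
    simp only [Ranked, Entry.uses, prov, Multiset.map_cons, Multiset.mem_cons, forall_eq_or_imp]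
      at hρ
    simp only [Ranked, Entry.uses, prov, Msg.uses, Multiset.mem_singleton, forall_eq] at hρ₀
    simp only [Entry.uses, Msg.uses, Multiset.mem_singleton] at hb₀
    have hca : c ≠ a := fun h => lt_irrefl _ (h ▸ hρ.1)
    refine ⟨{.proc c (P.rename d a) ((d, A.unfold) ::ₘ Δ) C}, ?_, ?_, ⟨0, ?_, ?_⟩,
      ⟨{a}, ?_, ?_⟩, ⟨0, ?_⟩, ?_⟩
    · simp [PSub.rhs, PRule.rhs, judg]
    · simp only [Multiset.mem_singleton, forall_eq, WellTyped, Multiset.mem_cons,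
        forall_eq_or_imp]
      exact ⟨hP.rename_client d hca fun y hy hya =>
        hu.1 (Multiset.mem_map.2 ⟨y, hy, hya⟩), .inl hc, .inl h2,
        fun x hx => .inl (hΔ x (Multiset.mem_cons_of_mem hx))⟩
    · refine Multiset.le_iff_count.2 fun z => ?_
      simp [unsentProv, prov, Multiset.count_cons, Multiset.count_singleton]
    · simp
    · refine Multiset.le_iff_count.2 fun z => ?_
      simp only [Multiset.insert_eq_cons, Multiset.map_cons, Multiset.cons_bind, Entry.uses,
        Multiset.singleton_bind, unsentUses, Multiset.count_add, Multiset.count_cons,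
        Multiset.count_singleton, Msg.uses]
      omega
    · simp
    · simp only [Multiset.mem_singleton, forall_eq, Ranked, Entry.uses, prov, Multiset.map_cons,
        Multiset.mem_cons, forall_eq_or_imp]
      exact ⟨update_lt_update hb₀ hb.1 (hρ₀.trans hρ.1),
        fun x hx => update_lt_update (fun h => hb.2.2 (h ▸ hx)) hb.1 (hρ.2 x hx)⟩
    · simp

theorem exists_localStep_fix {c : Chan} {P : Proc} {Δ : Ctx} {C : SType}
    (hwt : (Entry.proc c (.fix P) Δ C).WellTyped Ty)
    (hρ : (Entry.proc c (.fix P) Δ C).Ranked ρ)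
    (hb : b ≠ c ∧ b ∉ Multiset.map Prod.fst Δ) :
    ∃ E', LocalStep Ty ρ (PSub.fix c P) b {.proc c (.fix P) Δ C} E' := by
  obtain ⟨hT, hc, hΔ⟩ := hwt
  refine ⟨{.proc c P.unfoldFix Δ C}, ?_, ?_, ⟨0, ?_, ?_⟩, ⟨0, ?_, ?_⟩, ⟨0, ?_⟩, ?_⟩
  · simp [PSub.rhs, PRule.rhs, judg]
  · simp only [Multiset.mem_singleton, forall_eq, WellTyped]
    exact ⟨hT.unfoldFix, .inl hc, fun x hx => .inl (hΔ x hx)⟩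
  · refine Multiset.le_iff_count.2 fun z => ?_
    simp [unsentProv, prov, Multiset.count_cons, Multiset.count_singleton]
  · simp
  · refine Multiset.le_iff_count.2 fun z => ?_
    simp [Entry.uses, unsentUses]
  · simp
  · simp only [Multiset.mem_singleton, forall_eq]
    exact hρ.update hb
  · simp

theorem exists_localStep {E : Multiset Entry} {r : PRule} (θ : PSub r)
    (hTy : ∀ x A A', Ty x A → Ty x A' → A = A')
    (hlhs : ∀ x A, Judg.type x A ∈ PRule.lhs r θ → Ty x A)
    (hE : E.map judg = ephemeral (PRule.lhs r θ))
    (hwt : ∀ e ∈ E, e.WellTyped Ty) (hρ : ∀ e ∈ E, e.Ranked ρ) (hu : ∀ e ∈ E, e.uses.Nodup)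
    (hb : ∀ e ∈ E, b ≠ e.prov ∧ b ∉ e.uses) :
    ∃ E', LocalStep Ty ρ θ b E E' := by
  cases θ <;>
    simp only [PRule.lhs, Multiset.insert_eq_cons, ephemeral_cons_msg, ephemeral_cons_proc,
      ephemeral_proc, ephemeral_type] at hE
  case fwd | oneL | tensorL | plusL | ampR | muL =>
    obtain ⟨e, e', rfl, he, he'⟩ := eq_pair_of_map_judg hE
    obtain ⟨Δ, C, rfl⟩ := eq_proc he'
    simp only [Multiset.insert_eq_cons, Multiset.mem_cons, Multiset.mem_singleton,
      forall_eq_or_imp, forall_eq] at hwt hρ hb hu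
    first
      | exact exists_localStep_fwd hTy he hwt.1 hwt.2 hρ.1 hρ.2
      | exact exists_localStep_oneL he hwt.2 hρ.2 hb.2
      | exact exists_localStep_tensorL hTy he hwt.1 hρ.1 hb.1.2 hwt.2 hρ.2 hb.2 hu.2
      | exact exists_localStep_plusL _ hTy he hwt.1 hρ.1 hb.1.2 hwt.2 hρ.2 hb.2 hu.2
      | exact exists_localStep_ampR hTy he hwt.1 hρ.1 hb.1.1 hwt.2 hρ.2 hb.2
      | exact exists_localStep_muL hTy he hwt.1 hρ.1 hb.1.2 hwt.2 hρ.2 hb.2 hu.2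
  all_goals
    obtain ⟨e, rfl, he⟩ := eq_singleton_of_map_judg hE
    obtain ⟨Δ, C, rfl⟩ := eq_proc he
    simp only [Multiset.mem_singleton, forall_eq] at hwt hρ hb hu
    first
      | exact exists_localStep_cut hwt hρ hb
      | exact exists_localStep_oneR hwt
      | exact exists_localStep_tensorR hTy (hlhs _ _ (by simp [PRule.lhs])) hwt hρ hb
      | exact exists_localStep_plusR hTy (hlhs _ _ (by simp [PRule.lhs])) hwt hρ hb
      | exact exists_localStep_ampL hTy (hlhs _ _ (by simp [PRule.lhs])) hwt hρ hb hu
      | exact exists_localStep_muR hTy (hlhs _ _ (by simp [PRule.lhs])) hwt hρ hb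
      | exact exists_localStep_fix hwt hρ hb

end Steps

/-! ### Reachable configurations -/

/-- Channels that occur in a configuration have a type. -/
def Known (M : Multiset Judg) (x : Chan) : Prop :=
  ∃ A, .type x A ∈ M

/-- The canonical name of the channel that the process providing `c` generates in its `k`th
step. -/
def freshName (c : Chan) (k : ℕ) : Chan :=
  2 * Nat.pair c k + 1

theorem freshName_inj {c c' : Chan} {k k' : ℕ} (h : freshName c k = freshName c' k') :
    c = c' ∧ k = k' := by
  have h : 2 * Nat.pair c k + 1 = 2 * Nat.pair c' k' + 1 := h
  exact Nat.pair_eq_pair.1 (by omega)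

theorem freshName_ne (c : Chan) (k n : ℕ) : freshName c k ≠ 2 * n := fun h => by
  have h : 2 * Nat.pair c k + 1 = 2 * n := h
  omega

/-- A multiset of judgments together with the entries of its ephemeral judgments, the number of
steps that the process providing a channel has made, and canonical names of channels. -/
structure Config where
  state : Multiset Judg
  entries : Multiset Entry
  count : Chan → ℕ
  name : Chan → Chan

/-- The invariants of configurations. -/
structure Config.Good (X : Config) : Prop where
  judg_eq : X.entries.map judg = ephemeral X.state
  wellTyped : ∀ e ∈ X.entries, e.WellTyped fun x A => .type x A ∈ X.state
  type_unique : ∀ x A A', Judg.type x A ∈ X.state → Judg.type x A' ∈ X.state → A = A'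
  prov_nodup : (X.entries.map prov).Nodup
  uses_nodup : (X.entries.bind uses).Nodup
  ranked : ∃ ρ, ∀ e ∈ X.entries, e.Ranked ρ
  known_of_count : ∀ x, X.count x ≠ 0 → Known X.state x
  -- A process that takes over `d` later thus starts with step number `0`, as `Derivable`
  -- prescribes.
  count_eq_zero : ∀ a k d, neg a k d ∈ X.entries → X.count d = 0
  name_inj : ∀ x y, Known X.state x → Known X.state y → X.name x = X.name y → x = y
  -- Only pairs with a step number below the current count have been used up, so the name for the
  -- next step is new. Even names belong to initial channels.
  name_form : ∀ x, Known X.state x → (∃ n, X.name x = 2 * n) ∨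
    ∃ c j, Known X.state c ∧ j < X.count c ∧ X.name x = freshName (X.name c) j

/-- A step from `X` to `Y` that applies `θ` with fresh channel `b`. -/
structure Config.Transition (X Y : Config) {r : PRule} (θ : PSub r) (b : Chan) : Prop where
  fresh : ¬ Known X.state b
  state_eq : ∃ M, X.state = PRule.lhs r θ + M ∧ Y.state = θ.rhs b + M
  count_eq : Y.count = Function.update X.count θ.subj (X.count θ.subj + 1)
  name_eq : Y.name = Function.update X.name b (freshName (X.name θ.subj) (X.count θ.subj))
  entries_eq : ∃ Eold Enew E ρ, X.entries = Eold + E ∧ Y.entries = Enew + E ∧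
    Eold.map judg = ephemeral (PRule.lhs r θ) ∧
    LocalStep (fun x A => .type x A ∈ X.state) ρ θ b Eold Enew

theorem exists_add_of_map_eq_add {α β : Type*} {f : α → β} {s : Multiset α} {t u : Multiset β}
    (h : s.map f = t + u) : ∃ s₁ s₂, s = s₁ + s₂ ∧ s₁.map f = t ∧ s₂.map f = u := by
  classical
  induction t using Multiset.induction generalizing s with
  | empty => exact ⟨0, s, by simp, by simp, by simpa using h⟩
  | cons a t ih =>
    rw [Multiset.cons_add] at h
    obtain ⟨x, hx, rfl, h'⟩ := (Multiset.map_eq_cons _ _ _ _).2 h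
    obtain ⟨s₁, s₂, hs, h1, h2⟩ := ih h'
    exact ⟨x ::ₘ s₁, s₂, by rw [Multiset.cons_add, ← hs, Multiset.cons_erase hx], by simp [h1], h2⟩

theorem bind_unsentProv_le (E : Multiset Entry) : E.bind unsentProv ≤ E.map prov := by
  induction E using Multiset.induction with
  | empty => simp
  | cons e E ih =>
    rw [Multiset.cons_bind, Multiset.map_cons, ← Multiset.singleton_add]
    exact add_le_add (by cases e <;> simp [unsentProv, prov]) ih

theorem bind_unsentUses_le (E : Multiset Entry) : E.bind unsentUses ≤ E.bind uses := by
  induction E using Multiset.induction with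
  | empty => simp
  | cons e E ih =>
    rw [Multiset.cons_bind, Multiset.cons_bind]
    exact add_le_add (by cases e <;> simp [unsentUses, uses]) ih

theorem Entry.WellTyped.known {M : Multiset Judg} {e : Entry}
    (h : e.WellTyped fun x A => .type x A ∈ M) :
    Known M e.prov ∧ (∀ x ∈ e.uses, Known M x) ∧ ∀ x ∈ e.judg.names, Known M x := by
  cases e with
  | proc c P Δ C =>
    obtain ⟨hT, hc, hΔ⟩ := h
    have hu : ∀ x ∈ Multiset.map Prod.fst Δ, Known M x := by
      intro x hx
      obtain ⟨y, hy, rfl⟩ := Multiset.mem_map.1 hx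
      exact ⟨_, hΔ y hy⟩
    refine ⟨⟨C, hc⟩, hu, fun x hx => ?_⟩
    simp only [judg, Judg.names, Finset.mem_union, Finset.mem_singleton] at hx
    rcases hx with rfl | hx
    · exact ⟨C, hc⟩
    · rcases hT.fcn_subset x hx with rfl | ⟨A, hA⟩
      · exact ⟨C, hc⟩
      · exact ⟨A, hΔ _ hA⟩
  | pos a m =>
    cases m <;>
      simp only [WellTyped, prov, uses, judg, Judg.names, Msg.uses, Msg.names, Known,
        Multiset.insert_eq_cons, Multiset.mem_cons, Multiset.mem_singleton, Finset.mem_union,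
        Finset.mem_insert, Finset.mem_singleton, Multiset.notMem_zero,
        Finset.notMem_empty] at h ⊢ <;> grind
  | neg a k d =>
    simp only [WellTyped, prov, uses, judg, Judg.names, Msg.names, Known,
      Multiset.mem_singleton, Finset.mem_union, Finset.mem_singleton] at h ⊢
    grind

namespace Config

variable {X Y : Config} {r : PRule} {θ : PSub r} {b : Chan}

theorem Good.exists_entry (hX : X.Good) {J : Judg} (hJ : J ∈ X.state) (hJ' : ¬ J.IsType) :
    ∃ e ∈ X.entries, e.judg = J := by
  have : J ∈ ephemeral X.state := Multiset.mem_filter.2 ⟨hJ, hJ'⟩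
  rwa [← hX.judg_eq, Multiset.mem_map] at this

theorem Good.known (hX : X.Good) {J : Judg} (hJ : J ∈ X.state) {x : Chan} (hx : x ∈ J.names) :
    Known X.state x := by
  by_cases h : J.IsType
  · cases J with
    | type c A =>
      simp only [Judg.names, Finset.mem_singleton] at hx
      exact ⟨A, hx ▸ hJ⟩
    | _ => exact h.elim
  · obtain ⟨e, he, rfl⟩ := hX.exists_entry hJ h
    exact (hX.wellTyped e he).known.2.2 x hx

theorem Transition.subj_mem (h : X.Transition Y θ b) : .proc θ.subj θ.body ∈ X.state := by
  obtain ⟨M, h1, -⟩ := h.state_eq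
  rw [h1, Multiset.mem_add, PSub.mem_lhs]
  exact .inl (.inl rfl)

theorem Transition.side_mem (h : X.Transition Y θ b) {J : Judg} (hJ : θ.side = some J) :
    J ∈ X.state := by
  obtain ⟨M, h1, -⟩ := h.state_eq
  rw [h1, Multiset.mem_add, PSub.mem_lhs]
  exact .inl (.inr hJ)

theorem Transition.type_mem (h : X.Transition Y θ b) {x : Chan} {A : SType}
    (hx : .type x A ∈ X.state) : .type x A ∈ Y.state := by
  classical
  obtain ⟨M, h1, h2⟩ := h.state_eq
  rw [h1, Multiset.mem_add] at hx
  rw [h2, Multiset.mem_add]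
  refine hx.imp_left fun hx => ?_
  exact Multiset.mem_of_le (PRule.persistent_le r θ fun _ => b)
    ((@Multiset.mem_filter _ _ (_) _ _).2 ⟨hx, trivial⟩)

theorem Transition.known (h : X.Transition Y θ b) {x : Chan} (hx : Known X.state x) :
    Known Y.state x :=
  hx.imp fun _ hA => h.type_mem hA

/-- The channel `b` had no type before, and a rule gives it at most one; this keeps types unique. -/
theorem Transition.type_mem_or (h : X.Transition Y θ b) {x : Chan} {A : SType}
    (hx : .type x A ∈ Y.state) : .type x A ∈ X.state ∨ x = b ∧ .type x A ∈ θ.rhs b ∧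
      ∀ A', .type b A' ∈ Y.state → A' = A := by
  obtain ⟨M, h1, h2⟩ := h.state_eq
  have hb : ∀ A, Judg.type b A ∉ PRule.lhs r θ ∧ Judg.type b A ∉ M := fun A =>
    ⟨fun hA => h.fresh ⟨A, by rw [h1]; exact Multiset.mem_add.2 (.inl hA)⟩,
      fun hA => h.fresh ⟨A, by rw [h1]; exact Multiset.mem_add.2 (.inr hA)⟩⟩
  rw [h2] at hx ⊢
  rw [h1]
  simp only [Multiset.mem_add] at hx ⊢
  rcases hx with hx | hx
  · rcases PSub.type_mem_rhs hx with h3 | ⟨rfl, h3⟩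
    · exact .inl (.inl h3)
    · exact .inr ⟨rfl, hx, fun A' hA' => h3 A' (hA'.resolve_right (hb A').2) (hb A').1⟩
  · exact .inl (.inr hx)

theorem Transition.known_or (h : X.Transition Y θ b) {x : Chan} (hx : Known Y.state x) :
    Known X.state x ∨ x = b := by
  obtain ⟨A, hA⟩ := hx
  rcases h.type_mem_or hA with h | h
  · exact .inl ⟨A, h⟩
  · exact .inr h.1

theorem Good.notMem_of_not_known (hX : X.Good) (hb : ¬ Known X.state b) :
    b ∉ X.entries.map prov ∧ b ∉ X.entries.bind uses := by
  constructor
  · intro h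
    obtain ⟨e, he, rfl⟩ := Multiset.mem_map.1 h
    exact hb (hX.wellTyped e he).known.1
  · intro h
    obtain ⟨e, he, h⟩ := Multiset.mem_bind.1 h
    exact hb ((hX.wellTyped e he).known.2.1 b h)

theorem Good.known_subj (hX : X.Good) (h : X.Transition Y θ b) : Known X.state θ.subj :=
  hX.known h.subj_mem (by simp [Judg.names])

theorem count_add_le_of_le {α : Type*} [DecidableEq α] {s t u u' v : Multiset α} {b : α}
    (h : s + t ≤ u + {b}) (hu : u ≤ u') (x : α) :
    (s + v).count x + t.count x ≤ (u' + v).count x + if x = b then 1 else 0 := by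
  have h1 := Multiset.le_iff_count.1 h x
  have h2 := Multiset.le_iff_count.1 hu x
  simp only [Multiset.count_add, Multiset.count_singleton] at *
  omega

/-- Only `b` can gain multiplicity, and it was absent. An element of the slack `t` other than `b`
uses up its single old occurrence, so none is left. -/
theorem nodup_of_le {α : Type*} [DecidableEq α] {s t u u' v : Multiset α} {b : α}
    (h : s + t ≤ u + {b}) (hu : u ≤ u') (hb : b ∉ u' + v) (hn : (u' + v).Nodup) :
    (s + v).Nodup ∧ ∀ a ∈ t, a ≠ b → a ∉ s + v := by
  have key := count_add_le_of_le (v := v) h hu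
  rw [← Multiset.count_eq_zero] at hb
  rw [Multiset.nodup_iff_count_le_one] at hn
  constructor
  · rw [Multiset.nodup_iff_count_le_one]
    intro x
    have h1 := key x
    have h2 := hn x
    split_ifs at h1 with hx
    · subst hx
      omega
    · omega
  · intro a ha hab
    rw [← Multiset.count_eq_zero]
    have h1 := key a
    have h2 := hn a
    have h3 := Multiset.count_pos.2 ha
    rw [if_neg hab] at h1
    omega

/-- Preservation of the invariants: the entries matched by the left-hand side are replaced by those
of the local step, and all others stay. -/
theorem Good.exists_transition (hX : X.Good) {M : Multiset Judg}
    (hM : X.state = PRule.lhs r θ + M) (hb : ¬ Known X.state b) :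
    ∃ Y : Config, Y.state = θ.rhs b + M ∧ Y.Good ∧ X.Transition Y θ b := by
  obtain ⟨Eold, E, hE, hold, hrest⟩ := exists_add_of_map_eq_add (f := judg) (s := X.entries)
    (t := ephemeral (PRule.lhs r θ)) (u := ephemeral M) (by
      rw [← ephemeral_add, ← hM, hX.judg_eq])
  have hsub : ∀ e ∈ Eold, e ∈ X.entries := fun e he => by
    rw [hE]; exact Multiset.mem_add.2 (.inl he)
  have hsub' : ∀ e ∈ E, e ∈ X.entries := fun e he => by
    rw [hE]; exact Multiset.mem_add.2 (.inr he)
  have hbn := hX.notMem_of_not_known hb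
  have hbe : ∀ e ∈ X.entries, b ≠ e.prov ∧ b ∉ e.uses := fun e he =>
    ⟨fun h => hbn.1 (Multiset.mem_map.2 ⟨e, he, h.symm⟩),
      fun h => hbn.2 (Multiset.mem_bind.2 ⟨e, he, h⟩)⟩
  obtain ⟨ρ, hρ⟩ := hX.ranked
  obtain ⟨Enew, hL⟩ := exists_localStep (b := b) (ρ := ρ) θ hX.type_unique
    (fun x A h => by rw [hM]; exact Multiset.mem_add.2 (.inl h)) hold
    (fun e he => hX.wellTyped e (hsub e he)) (fun e he => hρ e (hsub e he))
    (fun e he => Multiset.nodup_of_le (Multiset.le_bind _ (hsub e he)) hX.uses_nodup)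
    (fun e he => hbe e (hsub e he))
  let Y : Config := ⟨θ.rhs b + M, Enew + E,
    Function.update X.count θ.subj (X.count θ.subj + 1),
    Function.update X.name b (freshName (X.name θ.subj) (X.count θ.subj))⟩
  have hXY : X.Transition Y θ b := ⟨hb, ⟨M, hM, rfl⟩, rfl, rfl, Eold, Enew, E, ρ, hE, rfl, hold, hL⟩
  have hsubj : Known X.state θ.subj := hX.known_subj hXY
  have hbsubj : b ≠ θ.subj := fun h => hb (h ▸ hsubj)
  refine ⟨Y, rfl, ⟨?_, ?_, ?_, ?_, ?_, ?_, ?_, ?_, ?_, ?_⟩, hXY⟩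
  · rw [Multiset.map_add, hrest, hL.judg_eq, ← ephemeral_add]
  · intro e he
    rcases Multiset.mem_add.1 he with he | he
    · refine (hL.wellTyped e he).mono fun x A h => ?_
      rcases h with h | h
      · exact hXY.type_mem h
      · exact Multiset.mem_add.2 (.inl h)
    · exact (hX.wellTyped e (hsub' e he)).mono fun x A h => hXY.type_mem h
  · intro x A A' hA hA'
    rcases hXY.type_mem_or hA with h1 | ⟨rfl, -, h1⟩
    · rcases hXY.type_mem_or hA' with h2 | ⟨rfl, -, h2⟩
      · exact hX.type_unique x A A' h1 h2
      · exact h2 A hA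
    · exact (h1 A' hA').symm
  · obtain ⟨s, hs, -⟩ := hL.prov_le
    rw [Multiset.map_add]
    have h1 := hbn.1
    have h2 := hX.prov_nodup
    rw [hE, Multiset.map_add] at h1 h2
    exact (nodup_of_le hs (bind_unsentProv_le Eold) h1 h2).1
  · obtain ⟨s, hs, -⟩ := hL.uses_le
    rw [Multiset.add_bind]
    have h1 := hbn.2
    have h2 := hX.uses_nodup
    rw [hE, Multiset.add_bind] at h1 h2
    exact (nodup_of_le hs (bind_unsentUses_le Eold) h1 h2).1
  · obtain ⟨q, hq⟩ := hL.ranked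
    refine ⟨Function.update ρ b q, fun e he => ?_⟩
    rcases Multiset.mem_add.1 he with he | he
    · exact hq e he
    · exact (hρ e (hsub' e he)).update (hbe e (hsub' e he))
  · intro x hx
    by_cases hxs : x = θ.subj
    · exact hxs ▸ hXY.known hsubj
    · refine hXY.known (hX.known_of_count x ?_)
      simpa [Y, Function.update_of_ne hxs] using hx
  · intro a k d he
    rcases Multiset.mem_add.1 he with he | he
    · cases hL.neg_eq a k d he
      simp only [Y, Function.update_of_ne hbsubj]
      by_contra h
      exact hb (hX.known_of_count _ h)
    -- Providers are distinct, so the continuation of a surviving negative message is not the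
    -- channel whose count increases.
    · have hd : d ≠ θ.subj := by
        intro hd
        have h1 : Judg.proc θ.subj θ.body ∈ ephemeral (PRule.lhs r θ) :=
          Multiset.mem_filter.2 ⟨(PSub.mem_lhs _ _).2 (.inl rfl), id⟩
        rw [← hold] at h1
        obtain ⟨e, he', hje⟩ := Multiset.mem_map.1 h1
        obtain ⟨Δ, C, rfl⟩ := eq_proc hje
        have h2 := hX.prov_nodup
        rw [hE, Multiset.map_add] at h2
        exact (Multiset.disjoint_left.1 (Multiset.nodup_add.1 h2).2.2)
          (Multiset.mem_map.2 ⟨_, he', rfl⟩) (Multiset.mem_map.2 ⟨_, he, hd⟩)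
      simp only [Y, Function.update_of_ne hd]
      exact hX.count_eq_zero a k d (hsub' _ he)
  -- The name given to `b` is odd and carries the current step number, whereas names already given
  -- are even or carry a smaller step number for the same channel.
  · have key : ∀ x, Known X.state x →
        X.name x ≠ freshName (X.name θ.subj) (X.count θ.subj) := by
      intro x hx h
      rcases hX.name_form x hx with ⟨n, hn⟩ | ⟨c, j, hc, hj, hn⟩
      · exact freshName_ne _ _ _ (h.symm.trans hn)
      · obtain ⟨h1, rfl⟩ := freshName_inj (hn.symm.trans h)
        cases hX.name_inj _ _ hc hsubj h1
        exact lt_irrefl _ hj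
    intro x y hx hy h
    by_cases hxb : x = b <;> by_cases hyb : y = b
    · rw [hxb, hyb]
    · subst hxb
      simp only [Y, Function.update_self, Function.update_of_ne hyb] at h
      exact absurd h.symm (key y ((hXY.known_or hy).resolve_right hyb))
    · subst hyb
      simp only [Y, Function.update_self, Function.update_of_ne hxb] at h
      exact absurd h (key x ((hXY.known_or hx).resolve_right hxb))
    · simp only [Y, Function.update_of_ne hxb, Function.update_of_ne hyb] at h
      exact hX.name_inj x y ((hXY.known_or hx).resolve_right hxb)
        ((hXY.known_or hy).resolve_right hyb) h
  · intro x hx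
    by_cases hxb : x = b
    · refine .inr ⟨θ.subj, X.count θ.subj, hXY.known hsubj, ?_, ?_⟩
      · simp [Y]
      · simp [Y, hxb, Function.update_of_ne hbsubj.symm]
    · rcases hX.name_form x ((hXY.known_or hx).resolve_right hxb) with ⟨n, hn⟩ | ⟨c, j, hc, hj, hn⟩
      · exact .inl ⟨n, by simpa [Y, Function.update_of_ne hxb] using hn⟩
      · have hcb : c ≠ b := fun h => hb (h ▸ hc)
        refine .inr ⟨c, j, hXY.known hc, ?_, ?_⟩
        · by_cases hcs : c = θ.subj
          · simp only [Y, hcs, Function.update_self]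
            exact (hcs ▸ hj).trans (Nat.lt_succ_self _)
          · simpa only [Y, Function.update_of_ne hcs] using hj
        · simpa only [Y, Function.update_of_ne hxb, Function.update_of_ne hcb] using hn

/-! ### Consequences of the invariants for a step -/

theorem Transition.proc_mem (h : X.Transition Y θ b) {c : Chan} {P : Proc}
    (hc : .proc c P ∈ X.state) (hcs : c ≠ θ.subj) : .proc c P ∈ Y.state := by
  obtain ⟨M, h1, h2⟩ := h.state_eq
  rw [h1, Multiset.mem_add, PSub.mem_lhs] at hc
  rw [h2, Multiset.mem_add]
  refine .inr (hc.resolve_left ?_)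
  rintro (h | h)
  · cases h; exact hcs rfl
  · cases θ <;> simp [PSub.side] at h

theorem Transition.msg_mem (h : X.Transition Y θ b) {a : Chan} {m : Msg}
    (ha : .msg a m ∈ X.state) (hs : θ.side ≠ some (.msg a m)) : .msg a m ∈ Y.state := by
  obtain ⟨M, h1, h2⟩ := h.state_eq
  rw [h1, Multiset.mem_add, PSub.mem_lhs] at ha
  rw [h2, Multiset.mem_add]
  refine .inr (ha.resolve_left ?_)
  rintro (h | h)
  · cases h
  · exact hs h

theorem Good.proc_unique (hX : X.Good) {c : Chan} {P Q : Proc} (hP : .proc c P ∈ X.state)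
    (hQ : .proc c Q ∈ X.state) : P = Q := by
  obtain ⟨e, he, h1⟩ := hX.exists_entry hP id
  obtain ⟨e', he', h2⟩ := hX.exists_entry hQ id
  obtain ⟨Δ, C, rfl⟩ := eq_proc h1
  obtain ⟨Δ', C', rfl⟩ := eq_proc h2
  have := Multiset.inj_on_of_nodup_map hX.prov_nodup _ he _ he' rfl
  simp only [Entry.proc.injEq] at this
  exact this.2.1

/-- Read contrapositively: a known channel that has left the unsent provided channels never comes
back, since only the unknown `b` is added. -/
theorem Transition.mem_unsentProv (h : X.Transition Y θ b) {x : Chan} (hx : Known X.state x)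
    (hY : x ∈ Y.entries.bind unsentProv) : x ∈ X.entries.bind unsentProv := by
  have hxb : x ≠ b := fun hxb => h.fresh (hxb ▸ hx)
  obtain ⟨Eold, Enew, E, ρ, hE, hE', -, hL⟩ := h.entries_eq
  rw [hE', Multiset.add_bind, Multiset.mem_add] at hY
  rw [hE, Multiset.add_bind, Multiset.mem_add]
  refine hY.imp_left fun hY => ?_
  obtain ⟨s, hs, -⟩ := hL.prov_le
  have := Multiset.mem_of_le ((Multiset.le_add_right _ s).trans hs)
    (Multiset.mem_of_le (bind_unsentProv_le Enew) hY)
  simpa [hxb] using this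

theorem Transition.mem_unsentUses (h : X.Transition Y θ b) {x : Chan} (hx : Known X.state x)
    (hY : x ∈ Y.entries.bind unsentUses) : x ∈ X.entries.bind unsentUses := by
  have hxb : x ≠ b := fun hxb => h.fresh (hxb ▸ hx)
  obtain ⟨Eold, Enew, E, ρ, hE, hE', -, hL⟩ := h.entries_eq
  rw [hE', Multiset.add_bind, Multiset.mem_add] at hY
  rw [hE, Multiset.add_bind, Multiset.mem_add]
  refine hY.imp_left fun hY => ?_
  obtain ⟨s, hs, -⟩ := hL.uses_le
  have := Multiset.mem_of_le ((Multiset.le_add_right _ s).trans hs)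
    (Multiset.mem_of_le (bind_unsentUses_le Enew) hY)
  rw [Multiset.mem_add, Multiset.mem_singleton] at this
  exact this.resolve_right hxb

/-- A new positive message takes its channel from the unsent provided ones, so it cannot appear on a
channel that has left them. `neg_mem` is the dual for used channels. -/
theorem Transition.pos_mem (h : X.Transition Y θ b) {a : Chan} {m : Msg} (ha : Known X.state a)
    (hY : pos a m ∈ Y.entries) : pos a m ∈ X.entries ∨ a ∈ X.entries.bind unsentProv := by
  have hab : a ≠ b := fun hab => h.fresh (hab ▸ ha)
  obtain ⟨Eold, Enew, E, ρ, hE, hE', -, hL⟩ := h.entries_eq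
  rw [hE', Multiset.mem_add] at hY
  rw [hE, Multiset.add_bind, Multiset.mem_add, Multiset.mem_add]
  rcases hY with hY | hY
  · obtain ⟨s, hs, -⟩ := hL.prov_le
    have := Multiset.mem_of_le ((Multiset.le_add_right _ s).trans hs)
      (Multiset.mem_map_of_mem prov hY)
    rw [Multiset.mem_add, Multiset.mem_singleton] at this
    exact .inr (.inl (this.resolve_right hab))
  · exact .inl (.inr hY)

theorem Transition.neg_mem (h : X.Transition Y θ b) {a : Chan} {k : Label} {d : Chan}
    (ha : Known X.state a) (hY : neg a k d ∈ Y.entries) :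
    neg a k d ∈ X.entries ∨ a ∈ X.entries.bind unsentUses := by
  have hab : a ≠ b := fun hab => h.fresh (hab ▸ ha)
  obtain ⟨Eold, Enew, E, ρ, hE, hE', -, hL⟩ := h.entries_eq
  rw [hE', Multiset.mem_add] at hY
  rw [hE, Multiset.add_bind, Multiset.mem_add, Multiset.mem_add]
  rcases hY with hY | hY
  · obtain ⟨s, hs, -⟩ := hL.uses_le
    have := Multiset.mem_of_le ((Multiset.le_add_right _ s).trans hs)
      (Multiset.mem_bind.2 ⟨_, hY, Multiset.mem_singleton_self a⟩)
    rw [Multiset.mem_add, Multiset.mem_singleton] at this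
    exact .inr (.inl (this.resolve_right hab))
  · exact .inl (.inr hY)

/-- After a message has been received, its channel has no reader. -/
theorem Good.notMem_of_side (hX : X.Good) (h : X.Transition Y θ b) {a : Chan} {m : Msg}
    (hs : θ.side = some (.msg a m)) :
    pos a m ∈ X.entries ∧ a ∉ Y.entries.bind unsentUses ∨
      (∃ k d, neg a k d ∈ X.entries) ∧ a ∉ Y.entries.bind unsentProv := by
  have hab : a ≠ b := fun hab =>
    h.fresh (hab ▸ hX.known (h.side_mem hs) (by simp [Judg.names]))
  have hbn := hX.notMem_of_not_known h.fresh
  obtain ⟨Eold, Enew, E, ρ, hE, hE', hold, hL⟩ := h.entries_eq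
  have h1 : Judg.msg a m ∈ ephemeral (PRule.lhs r θ) :=
    Multiset.mem_filter.2 ⟨(PSub.mem_lhs _ _).2 (.inr hs), id⟩
  rw [← hold] at h1
  obtain ⟨e, he, hje⟩ := Multiset.mem_map.1 h1
  rcases eq_msg hje with rfl | ⟨k, d, -, rfl⟩
  · refine .inl ⟨by rw [hE]; exact Multiset.mem_add.2 (.inl he), fun ha => ?_⟩
    obtain ⟨s, hs, hs'⟩ := hL.uses_le
    have h2 := hbn.2
    have h3 := hX.uses_nodup
    rw [hE, Multiset.add_bind] at h2 h3
    refine (nodup_of_le hs (bind_unsentUses_le Eold) h2 h3).2 a (hs' _ _ he) hab ?_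
    rw [← Multiset.add_bind, ← hE']
    exact Multiset.mem_of_le (bind_unsentUses_le _) ha
  · refine .inr ⟨⟨k, d, by rw [hE]; exact Multiset.mem_add.2 (.inl he)⟩, fun ha => ?_⟩
    obtain ⟨s, hs, hs'⟩ := hL.prov_le
    have h2 := hbn.1
    have h3 := hX.prov_nodup
    rw [hE, Multiset.map_add] at h2 h3
    refine (nodup_of_le hs (bind_unsentProv_le Eold) h2 h3).2 a (hs' _ _ _ he) hab ?_
    rw [← Multiset.map_add, ← hE']
    exact Multiset.mem_of_le (bind_unsentProv_le _) ha

/-- A resulting process provides the subject, the fresh channel, or the continuation of a consumed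
negative message, and no step has been counted for the last two. This justifies the index in
`Derivable.step`. -/
theorem Good.count_of_mem_rhs (hX : X.Good) (h : X.Transition Y θ b) {c : Chan} {P : Proc}
    (hc : .proc c P ∈ θ.rhs b) : c = θ.subj ∨ X.count c = 0 := by
  have hb0 : X.count b = 0 := by
    by_contra hb
    exact h.fresh (hX.known_of_count b hb)
  obtain ⟨Eold, Enew, E, ρ, hE, hE', hold, hL⟩ := h.entries_eq
  have h1 : Judg.proc c P ∈ ephemeral (θ.rhs b) := Multiset.mem_filter.2 ⟨hc, id⟩
  rw [← hL.judg_eq] at h1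
  obtain ⟨e, he, hje⟩ := Multiset.mem_map.1 h1
  obtain ⟨Δ, C, rfl⟩ := eq_proc hje
  obtain ⟨s, hs, -⟩ := hL.prov_le
  have := Multiset.mem_of_le ((Multiset.le_add_right _ s).trans hs)
    (Multiset.mem_map_of_mem prov he)
  rw [Multiset.mem_add, Multiset.mem_singleton] at this
  rcases this with h2 | rfl
  · obtain ⟨e, he, h3⟩ := Multiset.mem_bind.1 h2
    have h4 := Multiset.mem_map_of_mem judg he
    rw [hold] at h4
    cases e with
    | proc c' P' Δ' C' =>
      simp only [unsentProv, prov, Multiset.mem_singleton] at h3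
      rcases (PSub.mem_lhs _ _).1 (Multiset.mem_filter.1 h4).1 with h5 | h5
      · simp only [judg, Judg.proc.injEq] at h5
        exact .inl (h3.trans h5.1)
      · cases θ <;> simp [PSub.side, judg] at h5
    | pos a m => simp [unsentProv] at h3
    | neg a k d =>
      simp only [unsentProv, prov, Multiset.mem_singleton] at h3
      rw [h3]
      exact .inr (hX.count_eq_zero a k d (by rw [hE]; exact Multiset.mem_add.2 (.inl he)))
  · exact .inr hb0

end Config

namespace PSub

theorem side_eq {r : PRule} {θ : PSub r} {J : Judg} (h : θ.side = some J) :
    (∃ a m, J = .msg a m) ∨ ∃ a A, J = .type a A := by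
  cases θ <;> simp only [side, Option.some.injEq, reduceCtorEq] at h <;> subst h <;> simp

/-- A rule generates a fresh channel or does not depend on it. -/
theorem type_mem_rhs_or (r : PRule) :
    (∀ (θ : PSub r) b, ∃ A, .type b A ∈ θ.rhs b) ∨ ∀ (θ : PSub r) b z, θ.rhs b = θ.rhs z := by
  cases r
  case cut | tensorR | plusR | ampL | muR =>
    left
    intro θ b
    cases θ
    simp [rhs, PRule.rhs]
  all_goals
    right
    intro θ b z
    cases θ
    rfl

end PSub

/-- Rules that generate no channel receive an arbitrary unknown `b` as a dummy, so that all steps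
have one form. -/
theorem exists_fresh {M : Multiset Judg} (r : PRule) (θ : PSub r) (ξ : Fin r.arity → Chan)
    (hξ : ∀ J ∈ M, ∀ k, ξ k ∉ J.names) : ∃ b, ¬ Known M b ∧ PRule.rhs r θ ξ = θ.rhs b := by
  have h1 : ∃ b, ¬ Known M b := by
    obtain ⟨b, hb⟩ := Infinite.exists_notMem_finset (M.bind fun J => J.names.val).toFinset
    refine ⟨b, fun ⟨A, hA⟩ => hb ?_⟩
    rw [Multiset.mem_toFinset, Multiset.mem_bind]
    exact ⟨_, hA, by simp [Judg.names]⟩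
  have h2 : ∀ k, ¬ Known M (ξ k) := fun k ⟨A, hA⟩ => hξ _ hA k (by simp [Judg.names])
  cases θ
  case cut | tensorR | plusR | ampL | muR => exact ⟨ξ (0 : Fin 1), h2 _, rfl⟩
  all_goals
    obtain ⟨b, hb⟩ := h1
    exact ⟨b, hb, rfl⟩

/-! ### Messages and their readers, by polarity. -/

namespace Config

theorem Good.pos_notMem {X : Config} (hX : X.Good) {a : Chan} {m : Msg}
    (h : pos a m ∈ X.entries) : a ∉ X.entries.bind unsentProv := by
  obtain ⟨E, hE⟩ := Multiset.exists_cons_of_mem h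
  have := hX.prov_nodup
  rw [hE, Multiset.map_cons, Multiset.nodup_cons] at this
  rw [hE, Multiset.cons_bind]
  intro ha
  refine this.1 (Multiset.mem_of_le (bind_unsentProv_le E) (?_ : a ∈ _))
  simpa only [unsentProv, zero_add, Multiset.zero_bind] using ha

theorem Good.neg_notMem {X : Config} (hX : X.Good) {a : Chan} {k : Label} {d : Chan}
    (h : neg a k d ∈ X.entries) : a ∉ X.entries.bind unsentUses := by
  obtain ⟨E, hE⟩ := Multiset.exists_cons_of_mem h
  have := hX.uses_nodup
  rw [hE, Multiset.cons_bind] at this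
  simp only [uses, Multiset.singleton_add, Multiset.nodup_cons] at this
  rw [hE, Multiset.cons_bind]
  intro ha
  refine this.1 (Multiset.mem_of_le (bind_unsentUses_le E) ?_)
  simpa [unsentUses] using ha

theorem Good.neg_unique {X : Config} (hX : X.Good) {a : Chan} {k k' : Label} {d d' : Chan}
    (h : neg a k d ∈ X.entries) (h' : neg a k' d' ∈ X.entries) : k = k' ∧ d = d' := by
  obtain ⟨E, hE⟩ := Multiset.exists_cons_of_mem h
  have := hX.uses_nodup
  rw [hE, Multiset.cons_bind] at this
  simp only [uses, Multiset.singleton_add, Multiset.nodup_cons] at this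
  rw [hE, Multiset.mem_cons] at h'
  rcases h' with h' | h'
  · cases h'
    exact ⟨rfl, rfl⟩
  · exact absurd (Multiset.mem_bind.2 ⟨_, h', Multiset.mem_singleton_self a⟩) this.1

theorem Good.pos_type {X : Config} (hX : X.Good) {a : Chan} {m : Msg}
    (h : pos a m ∈ X.entries) : ∃ A : SType, A.IsPositive ∧ .type a A ∈ X.state := by
  have := hX.wellTyped _ h
  cases m with
  | star => exact ⟨_, by trivial, this⟩
  | chan e d =>
    obtain ⟨B, A, h, -⟩ := this
    exact ⟨_, by trivial, h⟩
  | label k d =>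
    obtain ⟨L, A, -, h, -⟩ := this
    exact ⟨_, by trivial, h⟩
  | unfold d =>
    obtain ⟨A, h, -⟩ := this
    exact ⟨_, by trivial, h⟩

theorem Good.neg_type {X : Config} (hX : X.Good) {a : Chan} {k : Label} {d : Chan}
    (h : neg a k d ∈ X.entries) : ∃ A : SType, ¬ A.IsPositive ∧ .type a A ∈ X.state := by
  obtain ⟨L, A, -, h, -⟩ := hX.wellTyped _ h
  exact ⟨_, id, h⟩

/-- A process that receives on a channel uses it, or provides it if its type is negative. -/
theorem Good.reader {X : Config} (hX : X.Good) {r : PRule} {θ : PSub r} {a : Chan} {m : Msg}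
    (hs : θ.side = some (.msg a m)) (hp : .proc θ.subj θ.body ∈ X.state) :
    (∃ A : SType, A.IsPositive ∧ .type a A ∈ X.state) ∧ a ∈ X.entries.bind unsentUses ∨
      (∃ A : SType, ¬ A.IsPositive ∧ .type a A ∈ X.state) ∧ a ∈ X.entries.bind unsentProv := by
  obtain ⟨e, he, hje⟩ := hX.exists_entry hp id
  obtain ⟨Δ, C, rfl⟩ := eq_proc hje
  obtain ⟨hT, hc, hΔ⟩ := hX.wellTyped _ he
  have key (A : SType) (hA : A.IsPositive) (h : (a, A) ∈ Δ) :
      (∃ A : SType, A.IsPositive ∧ .type a A ∈ X.state) ∧ a ∈ X.entries.bind unsentUses :=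
    ⟨⟨A, hA, hΔ _ h⟩, Multiset.mem_bind.2 ⟨_, he, Multiset.mem_map.2 ⟨_, h, rfl⟩⟩⟩
  cases θ <;> simp only [PSub.side, Option.some.injEq, Judg.msg.injEq, reduceCtorEq] at hs <;>
    obtain ⟨rfl, -⟩ := hs <;> simp only [PSub.body, PSub.subj] at hT hc he
  case fwd =>
    cases hT with
    | fwd hA => exact .inl (key _ hA (Multiset.mem_singleton_self _))
  case oneL =>
    cases hT
    exact .inl (key _ (by trivial) (Multiset.mem_cons_self _ _))
  case tensorL =>
    cases hT
    exact .inl (key _ (by trivial) (Multiset.mem_cons_self _ _))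
  case plusL hac _ _ _ =>
    cases hT with
    | plusL => exact .inl (key _ (by trivial) (Multiset.mem_cons_self _ _))
    | ampR => exact absurd rfl hac
  case ampR =>
    cases hT with
    | plusL => exact .inl (key _ (by trivial) (Multiset.mem_cons_self _ _))
    | ampR =>
      exact .inr ⟨⟨_, id, hc⟩, Multiset.mem_bind.2 ⟨_, he, Multiset.mem_singleton_self _⟩⟩
  case muL =>
    cases hT
    exact .inl (key _ (by trivial) (Multiset.mem_cons_self _ _))

end Config

/-! ### Traces -/

theorem exists_seq_of_forall_exists {α : Type*} {p : ℕ → α → Prop} {R : ℕ → α → α → Prop} {x₀ : α}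
    (h₀ : p 0 x₀) (h : ∀ n x, p n x → ∃ y, p (n + 1) y ∧ R n x y) :
    ∃ f : ℕ → α, f 0 = x₀ ∧ ∀ n, p n (f n) ∧ R n (f n) (f (n + 1)) := by
  choose! g hg hR using h
  let f : (n : ℕ) → α := fun n => Nat.rec x₀ g n
  have hf : ∀ n, p n (f n) := fun n => by
    induction n with
    | zero => exact h₀
    | succ n ih => exact hg n _ ih
  exact ⟨f, rfl, fun n => ⟨hf n, hR n _ (hf n)⟩⟩

/-- The configurations `X i` run through the states of the trace `T`. -/
structure IsRun {M₀ : Multiset Judg} (T : procMRS.Trace M₀) (X : ℕ → Config) : Prop where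
  good : ∀ t, (X t).Good
  state_eq : ∀ t, (X t).state = T.state t
  count_zero : (X 0).count = fun _ => 0
  name_zero : (X 0).name = fun x => 2 * x
  idle : ∀ t, T.label t = none → X (t + 1) = X t
  step : ∀ t s, T.label t = some s → ∃ b, (X t).Transition (X (t + 1)) (r := s.rule) s.sub b

theorem exists_isRun {M₀ : Multiset Judg} (T : procMRS.Trace M₀) {X₀ : Config} (hX : X₀.Good)
    (hM : X₀.state = M₀) (hc : X₀.count = fun _ => 0) (hn : X₀.name = fun x => 2 * x) :
    ∃ X, IsRun T X := by
  obtain ⟨X, h0, hX⟩ := exists_seq_of_forall_exists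
    (p := fun t X => X.Good ∧ X.state = T.state t)
    (R := fun t X Y => (T.label t = none → Y = X) ∧
      ∀ s, T.label t = some s → ∃ b, X.Transition Y (r := s.rule) s.sub b)
    (x₀ := X₀) ⟨hX, hM.trans T.state_zero.symm⟩ (by
      rintro t X ⟨hX, hXt⟩
      cases hl : T.label t with
      | none => exact ⟨X, ⟨hX, hXt.trans (T.state_idle t hl).symm⟩, fun _ => rfl, by simp⟩
      | some s =>
        obtain ⟨M, h1, h2⟩ := T.state_step t s hl
        obtain ⟨b, hb, hr⟩ := exists_fresh (M := X.state) s.rule s.sub s.fresh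
          fun J hJ k => T.fresh_disjoint t t s le_rfl hl J (hXt ▸ hJ) k
        obtain ⟨Y, hY, hYg, hXY⟩ := hX.exists_transition (hXt.trans h1) hb
        refine ⟨Y, ⟨hYg, hY.trans (hr ▸ h2.symm)⟩, by simp, ?_⟩
        rintro _ ⟨⟩
        exact ⟨b, hXY⟩)
  exact ⟨X, fun t => (hX t).1.1, fun t => (hX t).1.2, h0 ▸ hc, h0 ▸ hn,
    fun t => (hX t).2.1, fun t => (hX t).2.2⟩

namespace IsRun

variable {M₀ : Multiset Judg} {T : procMRS.Trace M₀} {X : ℕ → Config}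

/-- Induction along a run. -/
theorem le_induction (h : IsRun T X) {p : Config → Prop} {t s : ℕ} (hts : t ≤ s) (ht : p (X t))
    (hp : ∀ u, t ≤ u → p (X u) → ∀ r (θ : PSub r) b, (X u).Transition (X (u + 1)) θ b →
      p (X (u + 1))) : p (X s) := by
  induction s, hts using Nat.le_induction with
  | base => exact ht
  | succ s hts ih =>
    cases hl : T.label s with
    | none => rwa [h.idle s hl]
    | some a =>
      obtain ⟨b, hb⟩ := h.step s a hl
      exact hp s hts ih _ _ b hb

theorem type_mem (h : IsRun T X) {t s : ℕ} (hts : t ≤ s) {x : Chan} {A : SType}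
    (hx : .type x A ∈ (X t).state) : .type x A ∈ (X s).state :=
  h.le_induction (p := fun Y => .type x A ∈ Y.state) hts hx fun _ _ hu _ _ _ hs => hs.type_mem hu

theorem known (h : IsRun T X) {t s : ℕ} (hts : t ≤ s) {x : Chan} (hx : Known (X t).state x) :
    Known (X s).state x :=
  hx.imp fun _ hA => h.type_mem hts hA

theorem name_eq (h : IsRun T X) {t s : ℕ} (hts : t ≤ s) {x : Chan} (hx : Known (X t).state x) :
    (X s).name x = (X t).name x :=
  h.le_induction (p := fun Y => Y.name x = (X t).name x) hts rfl fun u htu hu _ _ b hs => by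
    have hxb : x ≠ b := fun hxb => hs.fresh (hxb ▸ h.known htu hx)
    rw [hs.name_eq, Function.update_of_ne hxb, hu]

theorem mem_support (h : IsRun T X) {J : Judg} : J ∈ T.support ↔ ∃ t, J ∈ (X t).state := by
  simp only [h.state_eq]
  rfl

theorem type_unique (h : IsRun T X) {x : Chan} {A A' : SType} (hA : .type x A ∈ T.support)
    (hA' : .type x A' ∈ T.support) : A = A' := by
  obtain ⟨t, ht⟩ := h.mem_support.1 hA
  obtain ⟨s, hs⟩ := h.mem_support.1 hA'
  exact (h.good (max t s)).type_unique x A A' (h.type_mem (le_max_left t s) ht)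
    (h.type_mem (le_max_right t s) hs)

theorem mem_unsentProv (h : IsRun T X) {t s : ℕ} (hts : t ≤ s) {x : Chan}
    (hx : Known (X t).state x) (hs : x ∈ (X s).entries.bind unsentProv) :
    x ∈ (X t).entries.bind unsentProv :=
  h.le_induction (p := fun Y => x ∈ Y.entries.bind unsentProv → x ∈ (X t).entries.bind unsentProv)
    hts id (fun _ htu hu _ _ _ hs hx' => hu (hs.mem_unsentProv (h.known htu hx) hx')) hs

theorem mem_unsentUses (h : IsRun T X) {t s : ℕ} (hts : t ≤ s) {x : Chan}
    (hx : Known (X t).state x) (hs : x ∈ (X s).entries.bind unsentUses) :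
    x ∈ (X t).entries.bind unsentUses :=
  h.le_induction (p := fun Y => x ∈ Y.entries.bind unsentUses → x ∈ (X t).entries.bind unsentUses)
    hts id (fun _ htu hu _ _ _ hs hx' => hu (hs.mem_unsentUses (h.known htu hx) hx')) hs

/-- The messages sent on a channel during a run are equal. -/
theorem msg_unique (h : IsRun T X) {a : Chan} {m m' : Msg} (hm : .msg a m ∈ T.support)
    (hm' : .msg a m' ∈ T.support) : m = m' := by
  obtain ⟨t, ht⟩ := h.mem_support.1 hm
  obtain ⟨s, hs⟩ := h.mem_support.1 hm'
  wlog hts : t ≤ s generalizing m m' t s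
  · exact (this hm' hm s hs t ht (le_of_not_ge hts)).symm
  have ha : Known (X t).state a := (h.good t).known ht (by simp [Judg.names])
  obtain ⟨e, he, hje⟩ := (h.good t).exists_entry ht id
  obtain ⟨e', he', hje'⟩ := (h.good s).exists_entry hs id
  rcases eq_msg hje with rfl | ⟨k, d, rfl, rfl⟩ <;>
    rcases eq_msg hje' with rfl | ⟨k', d', rfl, rfl⟩
  -- From time `t` on, `a` is not an unsent provided channel, so no further positive message on it
  -- can arise; at time `t` providers are distinct.
  · refine (h.le_induction (p := fun Y => pos a m' ∈ Y.entries → m = m') hts (fun hp => ?_)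
      (fun u htu hu _ _ _ hst hp => ?_) he')
    · have := Multiset.inj_on_of_nodup_map (h.good t).prov_nodup _ he _ hp rfl
      simpa using this
    · rcases hst.pos_mem (h.known htu ha) hp with h1 | h1
      · exact hu h1
      · exact absurd (h.mem_unsentProv htu ha h1) ((h.good t).pos_notMem he)
  -- Messages of opposite polarity would give `a` two types.
  · obtain ⟨A, hA, h1⟩ := (h.good t).pos_type he
    obtain ⟨A', hA', h2⟩ := (h.good s).neg_type he'
    cases h.type_unique (h.mem_support.2 ⟨t, h1⟩) (h.mem_support.2 ⟨s, h2⟩)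
    exact absurd hA hA'
  · obtain ⟨A, hA, h1⟩ := (h.good t).neg_type he
    obtain ⟨A', hA', h2⟩ := (h.good s).pos_type he'
    cases h.type_unique (h.mem_support.2 ⟨t, h1⟩) (h.mem_support.2 ⟨s, h2⟩)
    exact absurd hA' hA
  · refine (h.le_induction (p := fun Y => neg a k' d' ∈ Y.entries → Msg.label k d = .label k' d')
      hts (fun hp => ?_) (fun u htu hu _ _ _ hst hp => ?_) he')
    · obtain ⟨rfl, rfl⟩ := (h.good t).neg_unique he hp
      rfl
    · rcases hst.neg_mem (h.known htu ha) hp with h1 | h1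
      · exact hu h1
      · exact absurd (h.mem_unsentUses htu ha h1) ((h.good t).neg_notMem he)

/-- A process cannot receive on a channel whose message has already been received. -/
theorem notMem_of_received (h : IsRun T X) {j t : ℕ} (hjt : j < t) {r r' : PRule} {θ : PSub r}
    {b : Chan} (hst : (X j).Transition (X (j + 1)) θ b) {a : Chan} {m m' : Msg}
    (hs : θ.side = some (.msg a m)) {θ' : PSub r'} (hs' : θ'.side = some (.msg a m')) :
    .proc θ'.subj θ'.body ∉ (X t).state := by
  intro hp
  have ha : Known (X (j + 1)).state a :=
    hst.known ((h.good j).known (hst.side_mem hs) (by simp [Judg.names]))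
  rcases (h.good j).notMem_of_side hst hs with ⟨h1, h2⟩ | ⟨⟨k, d, h1⟩, h2⟩ <;>
    rcases (h.good t).reader hs' hp with ⟨⟨A', hA', h3⟩, h4⟩ | ⟨⟨A', hA', h3⟩, h4⟩
  · exact h2 (h.mem_unsentUses hjt ha h4)
  · obtain ⟨A, hA, h5⟩ := (h.good j).pos_type h1
    cases h.type_unique (h.mem_support.2 ⟨t, h3⟩) (h.mem_support.2 ⟨j, h5⟩)
    exact hA' hA
  · obtain ⟨A, hA, h5⟩ := (h.good j).neg_type h1
    cases h.type_unique (h.mem_support.2 ⟨t, h3⟩) (h.mem_support.2 ⟨j, h5⟩)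
    exact hA hA'
  · exact h2 (h.mem_unsentProv hjt ha h4)

theorem proc_mem (h : IsRun T X) {t u : ℕ} (htu : t ≤ u) {c : Chan} {P : Proc}
    (ht : .proc c P ∈ (X t).state)
    (hc : ∀ j s, t ≤ j → j < u → T.label j = some s → PSub.subj (r := s.rule) s.sub ≠ c) :
    .proc c P ∈ (X u).state ∧ (X u).count c = (X t).count c := by
  induction u, htu using Nat.le_induction with
  | base => exact ⟨ht, rfl⟩
  | succ u htu ih =>
    obtain ⟨h1, h2⟩ := ih fun j s h1 h2 => hc j s h1 (h2.trans (Nat.lt_succ_self u))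
    cases hl : T.label u with
    | none => rw [h.idle u hl]; exact ⟨h1, h2⟩
    | some s =>
      obtain ⟨b, hb⟩ := h.step u s hl
      have hne := (hc u s htu (Nat.lt_succ_self u) hl).symm
      refine ⟨hb.proc_mem h1 hne, ?_⟩
      rw [hb.count_eq, Function.update_of_ne hne, h2]

/-- In a fair run, an instantiation is applied when the judgments on its left-hand side occur,
even if they occur at different times. -/
theorem exists_label (h : IsRun T X) (hT : T.IsFair) {r : PRule} {θ : PSub r} {t : ℕ}
    (ht : .proc θ.subj θ.body ∈ (X t).state) (hside : ∀ J, θ.side = some J → J ∈ T.support) :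
    ∃ j s, T.label j = some s ∧ (⟨s.rule, s.sub⟩ : Σ r, PSub r) = ⟨r, θ⟩ ∧
      (X j).count θ.subj = (X t).count θ.subj := by
  -- It suffices that some step acts on this process. Otherwise it waits forever; then the whole
  -- left-hand side is eventually present and fairness yields such a step after all.
  have hex : ∃ j, t ≤ j ∧ ∃ s, T.label j = some s ∧ PSub.subj (r := s.rule) s.sub = θ.subj := by
    by_contra hno
    push Not at hno
    have hproc : ∀ u, t ≤ u → .proc θ.subj θ.body ∈ (X u).state := fun u htu =>
      (h.proc_mem htu ht fun j s h1 _ h3 => hno j h1 s h3).1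
    have hle : ∃ u, t ≤ u ∧ PRule.lhs r θ ≤ (X u).state := by
      cases hs : θ.side with
      | none =>
        refine ⟨t, le_rfl, ?_⟩
        rw [PSub.lhs_eq, hs]
        exact Multiset.singleton_le.2 ht
      | some J =>
        -- Types persist. A message disappears only by being received, and after that the waiting
        -- process, which would be a second reader, could not be present.
        have hJp : ∃ v, ∀ u, v ≤ u → J ∈ (X u).state := by
          obtain ⟨v, hv⟩ := h.mem_support.1 (hside J hs)
          refine ⟨v, fun u hvu => ?_⟩
          rcases PSub.side_eq hs with ⟨a, m, rfl⟩ | ⟨a, A, rfl⟩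
          · refine h.le_induction (p := fun Y => .msg a m ∈ Y.state) hvu hv
              fun w hvw hw r' θ' b hst => hst.msg_mem hw fun hs' => ?_
            exact h.notMem_of_received (t := max (w + 1) t) (le_max_left (w + 1) t) hst hs' hs
              (hproc _ (le_max_right _ _))
          · exact h.type_mem hvu hv
        obtain ⟨v, hv⟩ := hJp
        refine ⟨max t v, le_max_left _ _, ?_⟩
        rw [PSub.lhs_eq, hs]
        refine (Multiset.cons_le_of_notMem ?_).2 ⟨hproc _ (le_max_left _ _),
          Multiset.singleton_le.2 (hv _ (le_max_right _ _))⟩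
        rcases PSub.side_eq hs with ⟨a, m, rfl⟩ | ⟨a, A, rfl⟩ <;> simp
    obtain ⟨u, htu, hle⟩ := hle
    rw [h.state_eq] at hle
    obtain ⟨M, hM⟩ := Multiset.le_iff_exists_add.1 hle
    obtain ⟨j, s, huj, hl, heq, -⟩ := hT u ⟨r, θ⟩ ⟨M, hM⟩
    have := PSub.eq_of_lhs_eq (r := s.rule) (r' := r) s.sub θ heq
    refine hno j (htu.trans huj) s hl ?_
    exact congrArg (fun x : Σ r, PSub r => x.2.subj) this
  classical
  -- Up to the first step on this channel, the process and its count are unchanged. That step then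
  -- applies the same process, and messages and types are unique over the whole run, so its
  -- instantiation is `θ`.
  obtain ⟨htj, s, hl, hsubj⟩ := Nat.find_spec hex
  set j := Nat.find hex with hj
  obtain ⟨h1, h2⟩ := h.proc_mem htj ht fun i s' hti hij hl' hs' =>
    Nat.find_min hex hij ⟨hti, s', hl', hs'⟩
  refine ⟨j, s, hl, ?_, h2⟩
  obtain ⟨b, hb⟩ := h.step j s hl
  refine PSub.eq_of_subject (S := T.support) (fun a m m' => h.msg_unique)
    (fun a A A' => h.type_unique) (r := s.rule) s.sub θ hsubj ?_ ?_ hside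
  · have := hb.subj_mem
    rw [hsubj] at this
    exact (h.good j).proc_unique this h1
  · exact fun J hJ => h.mem_support.2 ⟨j, hb.side_mem hJ⟩

end IsRun

/-! ### Judgments derivable with canonical names -/

/-- The closure of `M₀` under the rules, applied with canonical names for the fresh channels. The
index of a process counts the steps of the process providing its channel. -/
inductive Derivable (M₀ : Multiset Judg) : ℕ → Judg → Prop
  | init {J : Judg} (hJ : J ∈ M₀) : Derivable M₀ 0 (J.map fun x => 2 * x)
  | step {r : PRule} (θ : PSub r) (k : ℕ)
      (h : ∀ J ∈ PRule.lhs r θ, Derivable M₀ (J.count fun _ => k) J) {J : Judg}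
      (hJ : J ∈ θ.rhs (freshName θ.subj k)) :
      Derivable M₀ (J.count fun c => if c = θ.subj then k + 1 else 0) J

theorem Judg.count_lhs {r : PRule} {θ : PSub r} {J : Judg} (hJ : J ∈ PRule.lhs r θ)
    (cnt : Chan → ℕ) (f : Chan → Chan) :
    (J.map f).count (fun _ => cnt θ.subj) = J.count cnt := by
  rcases (PSub.mem_lhs θ J).1 hJ with rfl | hJ
  · rfl
  · rcases PSub.side_eq hJ with ⟨a, m, rfl⟩ | ⟨a, A, rfl⟩ <;> rfl

/-- Providers are distinct, so processes not involved in the step keep their step numbers. -/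
theorem Config.Transition.subj_ne {X Y : Config} {r : PRule} {θ : PSub r} {b : Chan}
    (h : X.Transition Y θ b) (hX : X.Good) :
    ∃ M, X.state = PRule.lhs r θ + M ∧ Y.state = θ.rhs b + M ∧
      ∀ c P, .proc c P ∈ M → c ≠ θ.subj := by
  obtain ⟨M, h1, h2⟩ := h.state_eq
  refine ⟨M, h1, h2, fun c P hc hcs => ?_⟩
  obtain ⟨Eold, Enew, E, ρ, hE, -, hold, -⟩ := h.entries_eq
  have h3 := hX.judg_eq
  rw [hE, h1, Multiset.map_add, ephemeral_add, hold, add_right_inj] at h3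
  have h4 : Judg.proc c P ∈ ephemeral M := Multiset.mem_filter.2 ⟨hc, id⟩
  have h5 : Judg.proc θ.subj θ.body ∈ ephemeral (PRule.lhs r θ) :=
    Multiset.mem_filter.2 ⟨(PSub.mem_lhs _ _).2 (.inl rfl), id⟩
  rw [← h3] at h4
  rw [← hold] at h5
  obtain ⟨e, he, hje⟩ := Multiset.mem_map.1 h4
  obtain ⟨e', he', hje'⟩ := Multiset.mem_map.1 h5
  obtain ⟨Δ, C, rfl⟩ := eq_proc hje
  obtain ⟨Δ', C', rfl⟩ := eq_proc hje'
  have h6 := hX.prov_nodup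
  rw [hE, Multiset.map_add] at h6
  exact Multiset.disjoint_left.1 (Multiset.nodup_add.1 h6).2.2
    (Multiset.mem_map.2 ⟨_, he', rfl⟩) (Multiset.mem_map.2 ⟨_, he, hcs⟩)

/-- `ν` gives the canonical names of the channels of a run. -/
def IsNaming (X : ℕ → Config) (ν : Chan → Chan) : Prop :=
  ∀ t x, Known (X t).state x → ν x = (X t).name x

namespace IsRun

variable {M₀ : Multiset Judg} {T : procMRS.Trace M₀} {X : ℕ → Config} {ν : Chan → Chan}

/-- The name of a channel is fixed once the channel is known, so the names at all times glue to one
function. -/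
theorem exists_isNaming (h : IsRun T X) : ∃ ν, IsNaming X ν := by
  classical
  refine ⟨fun x => if hx : ∃ t, Known (X t).state x then (X hx.choose).name x else 0,
    fun t x hx => ?_⟩
  have hex : ∃ t, Known (X t).state x := ⟨t, hx⟩
  simp only [dif_pos hex]
  rcases le_total t hex.choose with hle | hle
  · exact h.name_eq hle hx
  · exact (h.name_eq hle hex.choose_spec).symm

theorem naming_inj (h : IsRun T X) (hν : IsNaming X ν) {t s : ℕ} {x y : Chan}
    (hx : Known (X t).state x) (hy : Known (X s).state y) (hxy : ν x = ν y) : x = y := by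
  have hx' := h.known (le_max_left t s) hx
  have hy' := h.known (le_max_right t s) hy
  rw [hν _ _ hx', hν _ _ hy'] at hxy
  exact (h.good _).name_inj _ _ hx' hy' hxy

/-- The image of a step under the canonical naming. -/
theorem exists_image (h : IsRun T X) (hν : IsNaming X ν) {t : ℕ} {r : PRule} {θ : PSub r}
    {b : Chan} (hst : (X t).Transition (X (t + 1)) θ b) :
    ∃ θ' : PSub r, PRule.lhs r θ' = (PRule.lhs r θ).map (Judg.map ν) ∧
      (θ.rhs b).map (Judg.map ν) = θ'.rhs (freshName θ'.subj ((X t).count θ.subj)) ∧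
      ∀ J ∈ θ.rhs b, (J.map ν).count
        (fun c => if c = θ'.subj then (X t).count θ.subj + 1 else 0) = J.count (X (t + 1)).count := by
  obtain ⟨M, hM, hM'⟩ := hst.state_eq
  have hsubj := (h.good t).known_subj hst
  obtain ⟨θ', h1, h2, h3⟩ := PSub.exists_map ν θ (by
    rintro x ⟨J, hJ, hx⟩ y ⟨J', hJ', hy⟩ hxy
    refine h.naming_inj hν (t := t) (s := t) ((h.good t).known (J := J) ?_ hx)
      ((h.good t).known (J := J') ?_ hy) hxy
    · rw [hM]; exact Multiset.mem_add.2 (.inl hJ)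
    · rw [hM]; exact Multiset.mem_add.2 (.inl hJ'))
  refine ⟨θ', h1, ?_, ?_⟩
  · rw [h3 b]
    -- Either `b` is really generated, hence known and canonically named, or the right-hand side
    -- ignores it.
    rcases PSub.type_mem_rhs_or r with hr | hr
    · obtain ⟨A, hA⟩ := hr θ b
      have hb : Known (X (t + 1)).state b := ⟨A, by rw [hM']; exact Multiset.mem_add.2 (.inl hA)⟩
      rw [hν _ _ hb, hst.name_eq, Function.update_self, h2, hν _ _ hsubj]
    · exact hr θ' _ _
  · intro J hJ
    cases J with
    | msg a m => rfl
    | type a A => rfl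
    | proc c P =>
      have hc : Known (X (t + 1)).state c := (h.good (t + 1)).known (J := .proc c P)
        (by rw [hM']; exact Multiset.mem_add.2 (.inl hJ)) (by simp [Judg.names])
      simp only [Judg.map, Judg.count, hst.count_eq, h2]
      by_cases hcs : c = θ.subj
      · simp [hcs]
      · rw [if_neg fun hcs' => hcs (h.naming_inj hν hc hsubj hcs'), Function.update_of_ne hcs]
        exact (((h.good t).count_of_mem_rhs hst hJ).resolve_left hcs).symm

/-- Each step of a run is carried by the naming to a canonical step, so induction on time applies;
fairness plays no role in this direction. -/
theorem derivable (h : IsRun T X) (hν : IsNaming X ν) (t : ℕ) {J : Judg}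
    (hJ : J ∈ (X t).state) : Derivable M₀ (J.count (X t).count) (J.map ν) := by
  induction t generalizing J with
  | zero =>
    have h1 : J.map ν = J.map fun x => 2 * x := Judg.map_congr fun y hy => by
      rw [hν 0 y ((h.good 0).known hJ hy), h.name_zero]
    have h2 : J.count (X 0).count = 0 := by
      rw [h.count_zero]
      cases J <;> rfl
    rw [h.state_eq, T.state_zero] at hJ
    rw [h1, h2]
    exact .init hJ
  | succ t ih =>
    cases hl : T.label t with
    | none =>
      rw [h.idle t hl] at hJ ⊢
      exact ih hJ
    | some s =>
      obtain ⟨b, hst⟩ := h.step t s hl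
      obtain ⟨M, hM, hM', hne⟩ := hst.subj_ne (h.good t)
      obtain ⟨θ', h1, h2, h3⟩ := h.exists_image hν hst
      rw [hM', Multiset.mem_add] at hJ
      rcases hJ with hJ | hJ
      · rw [← h3 J hJ]
        refine .step θ' _ (fun J' hJ' => ?_) (h2 ▸ Multiset.mem_map_of_mem _ hJ)
        rw [h1] at hJ'
        obtain ⟨J₀, hJ₀, rfl⟩ := Multiset.mem_map.1 hJ'
        rw [Judg.count_lhs hJ₀]
        exact ih (by rw [hM]; exact Multiset.mem_add.2 (.inl hJ₀))
      · have h4 : J.count (X (t + 1)).count = J.count (X t).count := by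
          cases J with
          | proc c P => simp only [Judg.count, hst.count_eq, Function.update_of_ne (hne c P hJ)]
          | _ => rfl
        rw [h4]
        exact ih (by rw [hM]; exact Multiset.mem_add.2 (.inr hJ))

/-- Induction on the derivation. The premises of a canonical step occur in the run, possibly at
different times, and `exists_label` shows that the corresponding step is nevertheless made. -/
theorem exists_of_derivable (h : IsRun T X) (hν : IsNaming X ν) (hT : T.IsFair) {k : ℕ} {J : Judg}
    (hJ : Derivable M₀ k J) :
    ∃ t, ∃ J₀ ∈ (X t).state, J₀.map ν = J ∧ J₀.count (X t).count = k := by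
  induction hJ with
  | @init J hJ =>
    rw [← T.state_zero, ← h.state_eq] at hJ
    refine ⟨0, J, hJ, Judg.map_congr fun y hy => ?_, ?_⟩
    · rw [hν 0 y ((h.good 0).known hJ hy), h.name_zero]
    · rw [h.count_zero]
      cases J <;> rfl
  | @step r θ k _ J hJ ih =>
    let K : Set Chan := {x | ∃ t, Known (X t).state x}
    -- The inverse of the naming carries the canonical instantiation back to the channels of this
    -- run.
    let g := Function.invFunOn ν K
    have hinj : Set.InjOn ν K := fun x ⟨t, hx⟩ y ⟨s, hy⟩ hxy => h.naming_inj hν hx hy hxy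
    have hg : ∀ x ∈ K, g (ν x) = x := fun x hx => hinj.leftInvOn_invFunOn hx
    have hgJ : ∀ J ∈ PRule.lhs r θ, ∃ t, J.map g ∈ (X t).state ∧ (J.map g).map ν = J ∧
        (J.map g).count (X t).count = J.count fun _ => k := by
      intro J hJ
      obtain ⟨t, J₀, h1, rfl, h2⟩ := ih J hJ
      have h3 : (J₀.map ν).map g = J₀ := by
        rw [Judg.map_map]
        exact Judg.map_eq_self fun y hy => hg y ⟨t, (h.good t).known h1 hy⟩
      exact ⟨t, by rwa [h3], by rw [h3], by rw [h3, h2]⟩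
    have hgν : ∀ y, (∃ J ∈ PRule.lhs r θ, y ∈ J.names) → ν (g y) = y := by
      rintro y ⟨J, hJ, hy⟩
      obtain ⟨t, J₀, h1, rfl, -⟩ := ih J hJ
      rw [Judg.names_map, Finset.mem_image] at hy
      obtain ⟨x, hx, rfl⟩ := hy
      rw [hg x ⟨t, (h.good t).known h1 hx⟩]
    obtain ⟨θ', h1, h2, -⟩ := PSub.exists_map g θ (by
      intro x hx y hy hxy
      rw [← hgν x hx, ← hgν y hy, hxy])
    have hlhs : ∀ J' ∈ PRule.lhs r θ', ∃ t, J' ∈ (X t).state ∧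
        J'.count (X t).count = J'.count fun _ => k := by
      intro J' hJ'
      rw [h1] at hJ'
      obtain ⟨J, hJ, rfl⟩ := Multiset.mem_map.1 hJ'
      obtain ⟨t, h3, -, h4⟩ := hgJ J hJ
      refine ⟨t, h3, h4.trans ?_⟩
      cases J <;> rfl
    obtain ⟨t, ht, hcount⟩ := hlhs _ ((PSub.mem_lhs θ' _).2 (.inl rfl))
    obtain ⟨j, s, hl, heq, hj⟩ := h.exists_label hT ht fun J hJ => by
      obtain ⟨t, h3, -⟩ := hlhs J ((PSub.mem_lhs θ' _).2 (.inr hJ))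
      exact h.mem_support.2 ⟨t, h3⟩
    have hstep : ∀ y : Σ r, PSub r, y = ⟨s.rule, s.sub⟩ →
        ∃ b, (X j).Transition (X (j + 1)) y.2 b := by
      rintro _ rfl
      exact h.step j s hl
    obtain ⟨b, hst⟩ := hstep _ heq.symm
    obtain ⟨θ'', h3, h4, h5⟩ := h.exists_image hν hst
    -- Going to the names of the run and back returns the original left-hand side, which determines
    -- the instantiation.
    have h6 : PRule.lhs r θ'' = PRule.lhs r θ := by
      rw [h3, h1, Multiset.map_map]
      conv_rhs => rw [← Multiset.map_id (PRule.lhs r θ)]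
      refine Multiset.map_congr rfl fun J hJ => ?_
      obtain ⟨t, -, h7, -⟩ := hgJ J hJ
      exact h7
    cases PSub.eq_of_lhs_eq _ _ h6
    -- The step is made with step number `k`, so its fresh channel has exactly the name that the
    -- derivation uses.
    have hk : (X j).count θ'.subj = k := hj.trans hcount
    rw [hk] at h4 h5
    rw [← h4] at hJ
    obtain ⟨J₀, hJ₀, rfl⟩ := Multiset.mem_map.1 hJ
    obtain ⟨M, -, hM, -⟩ := hst.subj_ne (h.good j)
    exact ⟨j + 1, J₀, by rw [hM]; exact Multiset.mem_add.2 (.inl hJ₀), rfl, (h5 J₀ hJ₀).symm⟩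

/-- Up to canonical names, the judgments that occur in a run occur in every fair run. -/
theorem exists_mem_support (h : IsRun T X) (hν : IsNaming X ν) {T' : procMRS.Trace M₀}
    {X' : ℕ → Config} {ν' : Chan → Chan} (h' : IsRun T' X') (hν' : IsNaming X' ν')
    (hT' : T'.IsFair) {J : Judg} (hJ : J ∈ T.support) :
    ∃ J' ∈ T'.support, J'.map ν' = J.map ν := by
  obtain ⟨t, ht⟩ := h.mem_support.1 hJ
  obtain ⟨s, J', h1, h2, -⟩ := h'.exists_of_derivable hν' hT' (h.derivable hν t ht)
  exact ⟨J', h'.mem_support.2 ⟨s, h1⟩, h2⟩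

theorem exists_msg_mem_support (h : IsRun T X) (hν : IsNaming X ν) {T' : procMRS.Trace M₀}
    {X' : ℕ → Config} {ν' : Chan → Chan} (h' : IsRun T' X') (hν' : IsNaming X' ν')
    (hT' : T'.IsFair) {c c' : Chan} {A : SType} (hc' : .type c' A ∈ T'.support)
    (hcc : ν c = ν' c') {m : Msg} (hm : .msg c m ∈ T.support) :
    ∃ m', .msg c' m' ∈ T'.support ∧ m'.map ν' = m.map ν := by
  obtain ⟨J, hJ, hJm⟩ := h.exists_mem_support hν h' hν' hT' hm
  cases J with
  | proc a P => simp [Judg.map] at hJm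
  | type a B => simp [Judg.map] at hJm
  | msg a m' =>
    simp only [Judg.map, Judg.msg.injEq] at hJm
    obtain ⟨t, ht⟩ := h'.mem_support.1 hJ
    obtain ⟨s, hs⟩ := h'.mem_support.1 hc'
    cases h'.naming_inj hν' ((h'.good t).known ht (by simp [Judg.names])) ⟨A, hs⟩
      (hJm.1.trans hcc)
    exact ⟨m', hJ, hJm.2⟩

/-- The types of the channels carried by a message. -/
theorem msg_type (h : IsRun T X) {c : Chan} {m : Msg} (hm : .msg c m ∈ T.support) :
    (pos c m).WellTyped (fun x A => .type x A ∈ T.support) ∨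
      ∃ k d, m = .label k d ∧ (neg c k d).WellTyped (fun x A => .type x A ∈ T.support) := by
  obtain ⟨t, ht⟩ := h.mem_support.1 hm
  obtain ⟨e, he, hje⟩ := (h.good t).exists_entry ht id
  have hw := ((h.good t).wellTyped e he).mono (Ty' := fun x A => .type x A ∈ T.support)
    fun x A hx => h.mem_support.2 ⟨t, hx⟩
  rcases eq_msg hje with rfl | ⟨k, d, rfl, rfl⟩
  · exact .inl hw
  · exact .inr ⟨k, d, rfl, hw⟩

theorem type_of_chan (h : IsRun T X) {c e d : Chan} (hm : .msg c (.chan e d) ∈ T.support)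
    {B A : SType} (hc : .type c (.tensor B A) ∈ T.support) :
    .type e B ∈ T.support ∧ .type d A ∈ T.support := by
  rcases h.msg_type hm with ⟨B', A', h1, h2, h3⟩ | ⟨_, _, h1, -⟩
  · cases h.type_unique h1 hc
    exact ⟨h2, h3⟩
  · cases h1

theorem type_of_unfold (h : IsRun T X) {c d : Chan} (hm : .msg c (.unfold d) ∈ T.support)
    {A : Ty 1} (hc : .type c (.mu A) ∈ T.support) : .type d A.unfold ∈ T.support := by
  rcases h.msg_type hm with ⟨A', h1, h2⟩ | ⟨_, _, h1, -⟩
  · cases h.type_unique h1 hc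
    exact h2
  · cases h1

theorem type_of_label (h : IsRun T X) {c d : Chan} {L : Finset Label} {A : {l // l ∈ L} → SType}
    {l : {l // l ∈ L}} (hm : .msg c (.label l d) ∈ T.support)
    (hc : .type c (.plus L A) ∈ T.support ∨ .type c (.amp L A) ∈ T.support) :
    .type d (A l) ∈ T.support := by
  rcases hc with hc | hc
  · rcases h.msg_type hm with ⟨L', A', hl, h1, h2⟩ | ⟨_, _, h0, L', A', hl, h1, h2⟩
    · cases h.type_unique h1 hc
      exact h2
    · cases h.type_unique h1 hc
  · rcases h.msg_type hm with ⟨L', A', hl, h1, h2⟩ | ⟨_, _, h0, L', A', hl, h1, h2⟩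
    · cases h.type_unique h1 hc
    · cases h.type_unique h1 hc
      simp only [Msg.label.injEq] at h0
      obtain ⟨rfl, rfl⟩ := h0
      exact h2

end IsRun

/-! ### Observations -/

/-- Observation is the union of all relations closed backwards under the rules, and such a union is
again closed backwards. -/
theorem Observes.obsStep {M₀ : Multiset Judg} {T : procMRS.Trace M₀} {v : Comm} {c : Chan}
    {A : SType} (h : Observes T v c A) : ObsStep T.support (Observes T) v c A := by
  obtain ⟨R, hR, h⟩ := h
  have key : ∀ {v c A}, R v c A → Observes T v c A := fun h => ⟨R, hR, h⟩
  cases hR _ _ _ h with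
  | bot hm ht => exact .bot hm ht
  | one hm => exact .one hm
  | plus hm hv ht => exact .plus hm (key hv) ht
  | amp hm hv ht => exact .amp hm (key hv) ht
  | tensor hm hu hv => exact .tensor hm (key hu) (key hv)
  | mu hm hv => exact .mu hm (key hv)

/-- Fair traces have the same observations on channels of equal canonical names. -/
theorem IsRun.observes_unique {M₀ : Multiset Judg} {T T' : procMRS.Trace M₀}
    {X X' : ℕ → Config} {ν ν' : Chan → Chan} (h : IsRun T X) (hν : IsNaming X ν)
    (h' : IsRun T' X') (hν' : IsNaming X' ν') (hT : T.IsFair) (hT' : T'.IsFair)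
    {v w : Comm} {c c' : Chan} {A : SType} (hv : Observes T v c A) (hw : Observes T' w c' A)
    (hcc : ν c = ν' c') (hc : .type c A ∈ T.support) (hc' : .type c' A ∈ T'.support) :
    v = w := by
  -- The relation also carries the types of the two channels, since the rules for pairs and
  -- unfoldings have no typing premise. The message on a channel hands the types on to the channels
  -- that it carries.
  refine PFunctor.M.bisim (fun v w => ∃ c c' A, Observes T v c A ∧ Observes T' w c' A ∧
    ν c = ν' c' ∧ .type c A ∈ T.support ∧ .type c' A ∈ T'.support) ?_ v w
    ⟨c, c', A, hv, hw, hcc, hc, hc'⟩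
  clear hv hw hcc hc hc' v w c c' A
  rintro v w ⟨c, c', A, hv, hw, hcc, hc, hc'⟩
  have hto {m : Msg} (hm : .msg c m ∈ T.support) :=
    h.exists_msg_mem_support hν h' hν' hT' hc' hcc hm
  have hfrom {m : Msg} (hm : .msg c' m ∈ T'.support) :=
    h'.exists_msg_mem_support hν' h hν hT hc hcc.symm hm
  have hmap {m m' : Msg} (hm : .msg c m ∈ T.support) (hm' : .msg c' m' ∈ T'.support) :
      m'.map ν' = m.map ν := by
    obtain ⟨m'', h1, h2⟩ := hto hm
    rwa [h'.msg_unique hm' h1]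
  by_cases hex : ∃ m, Judg.msg c m ∈ T.support
  · obtain ⟨m₁, hm₁⟩ := hex
    obtain ⟨m₂, hm₂, -⟩ := hto hm₁
    cases hv.obsStep with
    | bot hm => exact absurd hm₁ (hm _)
    | one hm =>
      cases hw.obsStep with
      | bot hm' => exact absurd hm₂ (hm' _)
      | one hm' => exact ⟨_, _, _, PFunctor.M.dest_mk _, PFunctor.M.dest_mk _, fun i => i.elim0⟩
    | @plus _ d _ _ l _ hm hv₁ =>
      cases hw.obsStep with
      | bot hm' => exact absurd hm₂ (hm' _)
      | @plus _ d' _ _ l' _ hm' hw₁ =>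
        have heq := hmap hm hm'
        simp only [Msg.map, Msg.label.injEq] at heq
        cases Subtype.ext heq.1
        exact ⟨_, _, _, PFunctor.M.dest_mk _, PFunctor.M.dest_mk _, Fin.forall_fin_one.2
          ⟨d, d', _, hv₁, hw₁, heq.2.symm, h.type_of_label hm (.inl hc),
            h'.type_of_label hm' (.inl hc')⟩⟩
    | @amp _ d _ _ l _ hm hv₁ =>
      cases hw.obsStep with
      | bot hm' => exact absurd hm₂ (hm' _)
      | @amp _ d' _ _ l' _ hm' hw₁ =>
        have heq := hmap hm hm'
        simp only [Msg.map, Msg.label.injEq] at heq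
        cases Subtype.ext heq.1
        exact ⟨_, _, _, PFunctor.M.dest_mk _, PFunctor.M.dest_mk _, Fin.forall_fin_one.2
          ⟨d, d', _, hv₁, hw₁, heq.2.symm, h.type_of_label hm (.inr hc),
            h'.type_of_label hm' (.inr hc')⟩⟩
    | @tensor _ a d _ _ _ _ hm hu₁ hv₁ =>
      cases hw.obsStep with
      | bot hm' => exact absurd hm₂ (hm' _)
      | @tensor _ a' d' _ _ _ _ hm' hu₂ hv₂ =>
        have heq := hmap hm hm'
        simp only [Msg.map, Msg.chan.injEq] at heq
        obtain ⟨h1, h2⟩ := h.type_of_chan hm hc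
        obtain ⟨h3, h4⟩ := h'.type_of_chan hm' hc'
        exact ⟨_, _, _, PFunctor.M.dest_mk _, PFunctor.M.dest_mk _, Fin.forall_fin_two.2
          ⟨⟨a, a', _, hu₁, hu₂, heq.1.symm, h1, h3⟩, ⟨d, d', _, hv₁, hv₂, heq.2.symm, h2, h4⟩⟩⟩
    | @mu _ d _ _ hm hv₁ =>
      cases hw.obsStep with
      | bot hm' => exact absurd hm₂ (hm' _)
      | @mu _ d' _ _ hm' hw₁ =>
        have heq := hmap hm hm'
        simp only [Msg.map, Msg.unfold.injEq] at heq
        exact ⟨_, _, _, PFunctor.M.dest_mk _, PFunctor.M.dest_mk _, Fin.forall_fin_one.2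
          ⟨d, d', _, hv₁, hw₁, heq.symm, h.type_of_unfold hm hc, h'.type_of_unfold hm' hc'⟩⟩
  -- Without a message on `c` there is none on `c'`, and both observations are `⊥` at the common
  -- type.
  · have hno : ∀ {m}, Judg.msg c m ∈ T.support → False := fun hm => hex ⟨_, hm⟩
    have hno' : ∀ {m}, Judg.msg c' m ∈ T'.support → False := fun hm => by
      obtain ⟨m', h1, -⟩ := hfrom hm
      exact hex ⟨m', h1⟩
    cases hv.obsStep with
    | bot hm =>
      cases hw.obsStep with
      | bot hm' => exact ⟨_, _, _, PFunctor.M.dest_mk _, PFunctor.M.dest_mk _, fun i => i.elim0⟩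
      | one hm' => exact (hno' hm').elim
      | plus hm' => exact (hno' hm').elim
      | amp hm' => exact (hno' hm').elim
      | tensor hm' => exact (hno' hm').elim
      | mu hm' => exact (hno' hm').elim
    | one hm => exact (hno hm).elim
    | plus hm => exact (hno hm).elim
    | amp hm => exact (hno hm).elim
    | tensor hm => exact (hno hm).elim
    | mu hm => exact (hno hm).elim

/-- The initial configuration of a well-typed process satisfies the invariants. -/
theorem good_initialConfig {n : ℕ} {c : Fin (n + 1) → Chan} {A : Fin (n + 1) → SType} {P : Proc}
    (hc : Function.Injective c)
    (hP : Typed [] (Finset.univ.val.map fun i : Fin n => (c i.succ, A i.succ)) P (c 0) (A 0)) :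
    Config.Good ⟨initialConfig c A P,
      {.proc (c 0) P (Finset.univ.val.map fun i : Fin n => (c i.succ, A i.succ)) (A 0)},
      fun _ => 0, fun x => 2 * x⟩ := by
  have htype (x : Chan) (B : SType) :
      .type x B ∈ initialConfig c A P ↔ ∃ i, c i = x ∧ A i = B := by
    simp only [initialConfig, Multiset.mem_cons, reduceCtorEq, false_or, Multiset.mem_map,
      Finset.mem_val, Finset.mem_univ, true_and, Judg.type.injEq]
  have huses : (Entry.proc (c 0) P
      (Finset.univ.val.map fun i : Fin n => (c i.succ, A i.succ)) (A 0)).uses =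
      Finset.univ.val.map fun i : Fin n => c i.succ := by
    simp only [uses, Multiset.map_map, Function.comp_def]
  -- The single process provides `c 0` and uses the other channels, so two ranks suffice; that they
  -- differ is the distinctness of the given channels.
  refine ⟨?_, ?_, ?_, ?_, ?_, ⟨fun x => if x = c 0 then 1 else 0, ?_⟩, ?_, ?_, ?_, ?_⟩
  · have : ephemeral (Multiset.map (fun i => Judg.type (c i) (A i)) Finset.univ.val) = 0 := by
      refine Multiset.filter_eq_nil.2 fun J hJ hJ' => hJ' ?_
      obtain ⟨i, -, rfl⟩ := Multiset.mem_map.1 hJ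
      trivial
    simp only [initialConfig, ephemeral_cons_proc, this]
    rfl
  · simp only [Multiset.mem_singleton, forall_eq, WellTyped, htype]
    refine ⟨hP, ⟨0, rfl, rfl⟩, fun x hx => ?_⟩
    obtain ⟨i, -, rfl⟩ := Multiset.mem_map.1 hx
    exact ⟨i.succ, rfl, rfl⟩
  · intro x B B' hB hB'
    obtain ⟨i, rfl, rfl⟩ := (htype _ _).1 hB
    obtain ⟨j, hj, rfl⟩ := (htype _ _).1 hB'
    rw [hc hj]
  · simp
  · rw [Multiset.singleton_bind, huses]
    exact Multiset.Nodup.map (hc.comp (Fin.succ_injective n)) Finset.univ.nodup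
  · simp only [Multiset.mem_singleton, forall_eq]
    intro x hx
    rw [huses] at hx
    obtain ⟨i, -, rfl⟩ := Multiset.mem_map.1 hx
    have : c i.succ ≠ c 0 := fun h => Fin.succ_ne_zero i (hc h)
    simp [this, prov]
  · exact fun x hx => absurd rfl hx
  · exact fun _ _ _ _ => rfl
  · intro x y _ _ hxy
    exact Nat.eq_of_mul_eq_mul_left (by norm_num : 0 < 2) hxy
  · exact fun x _ => .inl ⟨x, rfl⟩

theorem mainTheorem1 (n : ℕ) (c : Fin (n + 1) → Chan) (A : Fin (n + 1) → SType) (P : Proc)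
    (hc : Function.Injective c)
    (hP : Typed [] (Finset.univ.val.map fun i : Fin n => (c i.succ, A i.succ)) P (c 0) (A 0))
    (T T' : procMRS.Trace (initialConfig c A P))
    (hT : T.IsFairExecution) (hT' : T'.IsFairExecution)
    (i : Fin (n + 1)) (v w : Comm)
    (hv : Observes T v (c i) (A i)) (hw : Observes T' w (c i) (A i)) :
    v = w := by
  have hgood := good_initialConfig hc hP
  obtain ⟨X, h⟩ := exists_isRun T hgood rfl rfl rfl
  obtain ⟨X', h'⟩ := exists_isRun T' hgood rfl rfl rfl
  obtain ⟨ν, hν⟩ := h.exists_isNaming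
  obtain ⟨ν', hν'⟩ := h'.exists_isNaming
  have h0 : .type (c i) (A i) ∈ initialConfig c A P :=
    Multiset.mem_cons_of_mem (Multiset.mem_map.2 ⟨i, Finset.mem_univ i, rfl⟩)
  have h1 : .type (c i) (A i) ∈ (X 0).state := by rwa [h.state_eq, T.state_zero]
  have h2 : .type (c i) (A i) ∈ (X' 0).state := by rwa [h'.state_eq, T'.state_zero]
  refine h.observes_unique hν h' hν' hT.2 hT'.2 hv hw ?_ (h.mem_support.2 ⟨0, h1⟩)
    (h'.mem_support.2 ⟨0, h2⟩)
  -- An initial channel has the same canonical name, twice itself, in both runs.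
  rw [hν 0 _ ⟨_, h1⟩, hν' 0 _ ⟨_, h2⟩, h.name_zero, h'.name_zero]
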